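/- **Setting.** Let $n\ge 1$ and let $(M,g)$ be an $(n+2)$-dimensional Lorentzian spacetime (signature $(-,+,\dots,+)$) with a conformal completion: a smooth manifold with boundary $\widehat M$ whose interior is $M$, and a function $\Omega$ that is positive on $M$, vanishes on $\partial M$ and has $d\Omega\ne0$ there, such that $\hat g=\Omega^2 g$ extends continuously to $\partial M$ as a Lorentzian metric ($g$ and $\Omega$ are smooth on $M$, $\Omega$ is $C^1$ up to $\partial M$). A *boundary-anchored surface* $\Sigma$ is a spacelike embedded surface of codimension two (spacelike for $\hat g$ up to and including its boundary), given by an injective map of a compact manifold with boundary into $\widehat M$ that sends the boundary to $\partial M$ and the interior to $M$, is smooth in the interior and $C^1$ up to the boundary. It is *extremal* if its mean curvature vector with respect to $g$ vanishes. A *normal deviation vector field* on $\Sigma$ is $\eta=\partial_\lambda\Sigma(\lambda)|_{\lambda=0}$, normal to $\Sigma$, for a one-parameter family $\Sigma(\lambda)$, $|\lambda|<\varepsilon$, of boundary-anchored extremal surfaces with $\Sigma(0)=\Sigma$, jointly smooth in the interior and jointly $C^1$ up to the boundary. Fix the side of $\Sigma$ on which its extremal wedge lies, i.e. a continuous spacelike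 normal field $\nu$ along which the homology hypersurface, whose domain of dependence is the wedge, leaves $\Sigma$. A vector $\eta$ normal to $\Sigma$ is *nonvanishing, achronal and pointing into the extremal wedge* if $\hat g(\eta,\eta)\ge0$ and $\hat g(\eta,\nu)>0$, i.e. if it is a nonzero vector of the closed quadrant of the normal plane which contains $\nu$ and is bounded by two null rays. Let $k=\Omega\,\kappa$, where $\kappa$ is a null normal field of $\Sigma$ along one edge of the wedge (pointing into the wedge in the above sense), smooth in the interior and continuous and nonvanishing up to and including $\partial\Sigma$. *Extremal wedge nesting* for $\Sigma$ means: whenever a normal deviation vector field $\eta$ along a family of boundary-anchored extremal surfaces is everywhere on $\partial\Sigma$ nonvanishing, achronal and pointing into the extremal wedge, the same holds everywhere on $\Sigma$; and if, in addition, $\eta$ is nowhere on $\partial\Sigma$ proportional to a null normal along an edge of the wedge (a field such as $\kappa$, for either of the two edges), it is nowhere on $\Sigma$ proportional to it. **Proposition.** Let $\Sigma$ be a boundary-anchored extremal surface for which extremal wedge nesting holds, and let $\eta_1,\eta_2$ be normal deviation vector fields on $\Sigma$ along two one-parameter families of boundary-anchored extremal surfaces such that at every point of $\partial\Sigma$ *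 $\eta_1$ is nonvanishing, achronal, points into the extremal wedge, and is not proportional to $\kappa$; * $\eta_2$ is a positive multiple of $\kappa$. Then there are unique functions $w,v$ on the part of $\Sigma$ in $M$ with $$\eta_2=w\,k+v\,\eta_1 ,$$ and either $w\,Q_{kk}>0$ somewhere or $w\,Q_{kk}=0$ everywhere, where $Q_{kk}=R_{ab}k^ak^b+\sigma_k^2$, with $R_{ab}$ the Ricci tensor of $g$ and $\sigma_k^2=k^ak^bK_{acd}K_b{}^{cd}$ ($K^a{}_{bc}$ the extrinsic curvature of $\Sigma$) the squared shear of the null congruence fired from $\Sigma$ along $k$. Consequently, in the generic situation where $w>0$ everywhere, either $Q_{kk}>0$ somewhere on $\Sigma$ or $Q_{kk}=0$ everywhere on $\Sigma$; in particular $Q_{kk}$ is not everywhere negative. -/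

import Mathlib

open Set Bundle
open scoped Manifold ContDiff Topology

noncomputable section

namespace ExtremalSurface

/-! ### Coordinate expressions of (pseudo-)Riemannian geometry -/

/-- The partial derivative `∂ᵢ f` of a function of `m` real variables. -/
def pd {m : ℕ} (f : EuclideanSpace ℝ (Fin m) → ℝ) (i : Fin m) (u : EuclideanSpace ℝ (Fin m)) : ℝ :=
  fderiv ℝ f u (EuclideanSpace.single i 1)

/-- The Christoffel symbols `Γᵏᵢⱼ` of a metric with coordinate components `G`. -/
def christoffel {d : ℕ} (G : EuclideanSpace ℝ (Fin d) → Matrix (Fin d) (Fin d) ℝ)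
    (u : EuclideanSpace ℝ (Fin d)) (k i j : Fin d) : ℝ :=
  (1 / 2) * ∑ l, (G u)⁻¹ k l *
    (pd (fun z => G z l j) i u + pd (fun z => G z i l) j u - pd (fun z => G z i j) l u)

/-- The Ricci tensor `Rᵢⱼ` of a metric with coordinate components `G`
(positive on round spheres). -/
def ricci {d : ℕ} (G : EuclideanSpace ℝ (Fin d) → Matrix (Fin d) (Fin d) ℝ)
    (u : EuclideanSpace ℝ (Fin d)) (i j : Fin d) : ℝ :=
  (∑ k, pd (fun z => christoffel G z k i j) k u) - (∑ k, pd (fun z => christoffel G z k i k) j u)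
    + (∑ k, ∑ l, christoffel G u k k l * christoffel G u l i j)
    - ∑ k, ∑ l, christoffel G u k j l * christoffel G u l i k

/-- The components `h_{αβ}` of the metric induced by `G` on the surface with embedding functions
`X`. -/
def inducedMetric {n d : ℕ} (G : EuclideanSpace ℝ (Fin d) → Matrix (Fin d) (Fin d) ℝ)
    (X : EuclideanSpace ℝ (Fin n) → EuclideanSpace ℝ (Fin d)) (u : EuclideanSpace ℝ (Fin n)) :
    Matrix (Fin n) (Fin n) ℝ :=
  fun α β => ∑ i, ∑ j, G (X u) i j * pd (fun z => X z i) α u * pd (fun z => X z j) β u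

/-- The components of the ambient covariant derivative `∇_α e_β`, where `e_β = ∂X/∂u^β` are the
coordinate vector fields of the surface with embedding functions `X`. -/
def frameDerivative {n d : ℕ} (G : EuclideanSpace ℝ (Fin d) → Matrix (Fin d) (Fin d) ℝ)
    (X : EuclideanSpace ℝ (Fin n) → EuclideanSpace ℝ (Fin d)) (u : EuclideanSpace ℝ (Fin n))
    (α β : Fin n) (i : Fin d) : ℝ :=
  pd (fun z => pd (fun z' => X z' i) β z) α u
    + ∑ j, ∑ k, christoffel G (X u) i j k * pd (fun z => X z j) α u * pd (fun z => X z k) β u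

/-- The component `N_a Kᵃ_{bc} e_α^b e_β^c` of the extrinsic curvature along a normal vector `N`.
With `N` extended to a normal field it is `e_α^b e_β^c ∇_b N_c = - N_c (∇_α e_β)^c`. -/
def extrinsicCurvature {n d : ℕ} (G : EuclideanSpace ℝ (Fin d) → Matrix (Fin d) (Fin d) ℝ)
    (X : EuclideanSpace ℝ (Fin n) → EuclideanSpace ℝ (Fin d)) (u : EuclideanSpace ℝ (Fin n))
    (N : EuclideanSpace ℝ (Fin d)) (α β : Fin n) : ℝ :=
  - ∑ i, ∑ j, G (X u) i j * N i * frameDerivative G X u α β j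

/-- The component `N_a Kᵃ`, `Kᵃ = h^{bc} Kᵃ_{bc}`, of the mean curvature vector along a normal
vector `N`. -/
def meanCurvature {n d : ℕ} (G : EuclideanSpace ℝ (Fin d) → Matrix (Fin d) (Fin d) ℝ)
    (X : EuclideanSpace ℝ (Fin n) → EuclideanSpace ℝ (Fin d)) (u : EuclideanSpace ℝ (Fin n))
    (N : EuclideanSpace ℝ (Fin d)) : ℝ :=
  ∑ α, ∑ β, (inducedMetric G X u)⁻¹ α β * extrinsicCurvature G X u N α β

/-- Simons' term `S_{kk} = k^a k^b K_{acd} K_b^{cd}`. If the expansion `k_a Kᵃ` vanishes, as it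
does on an extremal surface, this is the squared shear `σ_k²` of the null congruence fired from the
surface along the null normal `k`. -/
def shearSq {n d : ℕ} (G : EuclideanSpace ℝ (Fin d) → Matrix (Fin d) (Fin d) ℝ)
    (X : EuclideanSpace ℝ (Fin n) → EuclideanSpace ℝ (Fin d)) (u : EuclideanSpace ℝ (Fin n))
    (k : EuclideanSpace ℝ (Fin d)) : ℝ :=
  ∑ α, ∑ β, ∑ γ, ∑ δ, (inducedMetric G X u)⁻¹ α γ * (inducedMetric G X u)⁻¹ β δ *
    extrinsicCurvature G X u k α β * extrinsicCurvature G X u k γ δ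

/-! ### Conformally compactified spacetimes -/

/-- A `d`-dimensional spacetime given through a conformal completion: `M` is a manifold with
boundary whose interior is the physical spacetime and whose boundary is the conformal boundary,
`metric` is the conformally rescaled Lorentzian metric `ĝ = Ω² g` of signature `(-,+,…,+)`, which
extends to the boundary, and `Ω` is the conformal factor, a defining function of the boundary. -/
structure ConformalSpacetime (d : ℕ) [NeZero d] (M : Type*) [TopologicalSpace M]
    [ChartedSpace (EuclideanHalfSpace d) M] [IsManifold (𝓡∂ d) ∞ M] where
  metric : ∀ x : M, TangentSpace (𝓡∂ d) x →L[ℝ] TangentSpace (𝓡∂ d) x →L[ℝ] ℝ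
  symm : ∀ (x : M) (a b : TangentSpace (𝓡∂ d) x), metric x a b = metric x b a
  lorentzian : ∀ x : M, ∃ t : TangentSpace (𝓡∂ d) x, metric x t t < 0 ∧
    ∀ a : TangentSpace (𝓡∂ d) x, metric x t a = 0 → a ≠ 0 → 0 < metric x a a
  continuous_metric : ContMDiff (𝓡∂ d) ((𝓡∂ d).prod
      𝓘(ℝ, EuclideanSpace ℝ (Fin d) →L[ℝ] EuclideanSpace ℝ (Fin d) →L[ℝ] ℝ)) 0
    (fun x => TotalSpace.mk' (EuclideanSpace ℝ (Fin d) →L[ℝ] EuclideanSpace ℝ (Fin d) →L[ℝ] ℝ)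
      (E := fun x : M => TangentSpace (𝓡∂ d) x →L[ℝ] TangentSpace (𝓡∂ d) x →L[ℝ] ℝ) x (metric x))
  smooth_metric : ContMDiffOn (𝓡∂ d) ((𝓡∂ d).prod
      𝓘(ℝ, EuclideanSpace ℝ (Fin d) →L[ℝ] EuclideanSpace ℝ (Fin d) →L[ℝ] ℝ)) ∞
    (fun x => TotalSpace.mk' (EuclideanSpace ℝ (Fin d) →L[ℝ] EuclideanSpace ℝ (Fin d) →L[ℝ] ℝ)
      (E := fun x : M => TangentSpace (𝓡∂ d) x →L[ℝ] TangentSpace (𝓡∂ d) x →L[ℝ] ℝ) x (metric x))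
    ((𝓡∂ d).interior M)
  Ω : M → ℝ
  Ω_c1 : ContMDiff (𝓡∂ d) 𝓘(ℝ, ℝ) 1 Ω
  Ω_smooth : ContMDiffOn (𝓡∂ d) 𝓘(ℝ, ℝ) ∞ Ω ((𝓡∂ d).interior M)
  Ω_pos : ∀ x ∈ (𝓡∂ d).interior M, 0 < Ω x
  Ω_zero : ∀ x ∈ (𝓡∂ d).boundary M, Ω x = 0
  dΩ_ne_zero : ∀ x ∈ (𝓡∂ d).boundary M, mfderiv (𝓡∂ d) 𝓘(ℝ, ℝ) Ω x ≠ 0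

section Spacetime

variable {d : ℕ} [NeZero d] {M : Type*} [TopologicalSpace M]
  [ChartedSpace (EuclideanHalfSpace d) M] [IsManifold (𝓡∂ d) ∞ M]

/-- The physical metric `g = Ω⁻² ĝ` (meaningful on the interior). -/
def ConformalSpacetime.physMetric (W : ConformalSpacetime d M) (x : M) :
    TangentSpace (𝓡∂ d) x →L[ℝ] TangentSpace (𝓡∂ d) x →L[ℝ] ℝ :=
  (W.Ω x ^ 2)⁻¹ • W.metric x

/-- The components of the physical metric in the coordinate system around `x₀`. -/
def ConformalSpacetime.metricComp (W : ConformalSpacetime d M) (x₀ : M)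
    (u : EuclideanSpace ℝ (Fin d)) : Matrix (Fin d) (Fin d) ℝ :=
  fun i j => W.physMetric ((extChartAt (𝓡∂ d) x₀).symm u)
    (mfderivWithin 𝓘(ℝ, EuclideanSpace ℝ (Fin d)) (𝓡∂ d) (extChartAt (𝓡∂ d) x₀).symm
      (range (𝓡∂ d)) u (EuclideanSpace.single i (1 : ℝ)))
    (mfderivWithin 𝓘(ℝ, EuclideanSpace ℝ (Fin d)) (𝓡∂ d) (extChartAt (𝓡∂ d) x₀).symm
      (range (𝓡∂ d)) u (EuclideanSpace.single j (1 : ℝ)))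

/-- The components of a tangent vector at `x` in the coordinate system around `x₀`. -/
def vecComp (x₀ : M) {x : M} (a : TangentSpace (𝓡∂ d) x) : EuclideanSpace ℝ (Fin d) :=
  mfderiv (𝓡∂ d) 𝓘(ℝ, EuclideanSpace ℝ (Fin d)) (extChartAt (𝓡∂ d) x₀) x a

/-- The Ricci curvature `R_{ab} k^a k^b` of the physical metric. -/
def ConformalSpacetime.ricciKK (W : ConformalSpacetime d M) {x : M}
    (k : TangentSpace (𝓡∂ d) x) : ℝ :=
  ∑ i, ∑ j, ricci (W.metricComp x) (extChartAt (𝓡∂ d) x x) i j * vecComp x k i * vecComp x k j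

/-! ### Surfaces and families of surfaces -/

variable (n : ℕ) [NeZero n] {S : Type*} [TopologicalSpace S]
  [ChartedSpace (EuclideanHalfSpace n) S]

/-- The embedding functions of the surface `ψ` in the coordinate systems around `s₀` and `x₀`. -/
def coordMap (ψ : S → M) (s₀ : S) (x₀ : M) :
    EuclideanSpace ℝ (Fin n) → EuclideanSpace ℝ (Fin d) :=
  fun u => extChartAt (𝓡∂ d) x₀ (ψ ((extChartAt (𝓡∂ n) s₀).symm u))

/-- A tangent vector of `M` at `ψ y` is normal to the surface. -/
def IsNormal (W : ConformalSpacetime d M) (ψ : S → M) (y : S)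
    (N : TangentSpace (𝓡∂ d) (ψ y)) : Prop :=
  ∀ u : TangentSpace (𝓡∂ n) y, W.metric (ψ y) (mfderiv (𝓡∂ n) (𝓡∂ d) ψ y u) N = 0

/-- `ψ` embeds `S` (the surface together with its boundary at infinity) in the conformal completion
as a spacelike surface with `∂Σ` on the conformal boundary and the rest in the physical
spacetime. -/
structure IsAnchoredSurface (W : ConformalSpacetime d M) (ψ : S → M) : Prop where
  c1 : ContMDiff (𝓡∂ n) (𝓡∂ d) 1 ψ
  smooth : ContMDiffOn (𝓡∂ n) (𝓡∂ d) ∞ ψ ((𝓡∂ n).interior S)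
  injective : Function.Injective ψ
  boundary : ∀ y ∈ (𝓡∂ n).boundary S, ψ y ∈ (𝓡∂ d).boundary M
  interior : ∀ y ∈ (𝓡∂ n).interior S, ψ y ∈ (𝓡∂ d).interior M
  spacelike : ∀ (y : S) (u : TangentSpace (𝓡∂ n) y), u ≠ 0 →
    0 < W.metric (ψ y) (mfderiv (𝓡∂ n) (𝓡∂ d) ψ y u) (mfderiv (𝓡∂ n) (𝓡∂ d) ψ y u)

/-- The surface is extremal for the physical metric: its mean curvature vector vanishes, as
expressed in any coordinate systems on the surface and on the spacetime. -/
def IsExtremal (W : ConformalSpacetime d M) (ψ : S → M) : Prop :=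
  ∀ (s₀ : S) (x₀ : M), ∀ y ∈ (𝓡∂ n).interior S, y ∈ (extChartAt (𝓡∂ n) s₀).source →
    ψ y ∈ (extChartAt (𝓡∂ d) x₀).source → ∀ N : TangentSpace (𝓡∂ d) (ψ y), IsNormal n W ψ y N →
      meanCurvature (W.metricComp x₀) (coordMap n ψ s₀ x₀) (extChartAt (𝓡∂ n) s₀ y)
        (vecComp x₀ N) = 0

/-- `η` is the deviation vector field on `ψ`, normal to `ψ`, along the one-parameter family `Ψ` of
boundary-anchored extremal surfaces through `ψ = Ψ 0`. -/
structure IsNormalDeviation (W : ConformalSpacetime d M) (ψ : S → M) (Ψ : ℝ → S → M)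
    (η : ∀ y : S, TangentSpace (𝓡∂ d) (ψ y)) : Prop where
  zero : Ψ 0 = ψ
  family : ∃ ε > 0,
    ContMDiffOn (𝓘(ℝ, ℝ).prod (𝓡∂ n)) (𝓡∂ d) 1 (fun p : ℝ × S => Ψ p.1 p.2)
      (Ioo (-ε) ε ×ˢ univ) ∧
    ContMDiffOn (𝓘(ℝ, ℝ).prod (𝓡∂ n)) (𝓡∂ d) ∞ (fun p : ℝ × S => Ψ p.1 p.2)
      (Ioo (-ε) ε ×ˢ (𝓡∂ n).interior S) ∧
    ∀ l ∈ Ioo (-ε) ε, IsAnchoredSurface n W (Ψ l) ∧ IsExtremal n W (Ψ l)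
  deviation : ∀ y : S,
    (⟨Ψ 0 y, mfderiv 𝓘(ℝ, ℝ) (𝓡∂ d) (fun l => Ψ l y) 0 (1 : ℝ)⟩ : TangentBundle (𝓡∂ d) M)
      = ⟨ψ y, η y⟩
  normal : ∀ y : S, IsNormal n W ψ y (η y)

/-! ### The extremal wedge and its nesting -/

/-- `ν` singles out the side of the surface on which its extremal wedge lies: it is a continuous
spacelike normal field, the direction in which the homology hypersurface (whose domain of dependence
is the wedge) leaves the surface. -/
structure IsWedgeSide (W : ConformalSpacetime d M) (ψ : S → M)
    (ν : ∀ y : S, TangentSpace (𝓡∂ d) (ψ y)) : Prop where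
  continuous : Continuous (fun y => (⟨ψ y, ν y⟩ : TangentBundle (𝓡∂ d) M))
  normal : ∀ y : S, IsNormal n W ψ y (ν y)
  spacelike : ∀ y : S, 0 < W.metric (ψ y) (ν y) (ν y)

/-- A vector at `ψ y` normal to the surface is nonvanishing, achronal (spacelike or null), and
points into the extremal wedge: it lies in the closed quadrant of the Lorentzian normal plane,
bounded by two null rays, that contains `ν y`, and is not the apex. -/
def PointsIntoWedge (W : ConformalSpacetime d M) (ψ : S → M)
    (ν : ∀ y : S, TangentSpace (𝓡∂ d) (ψ y)) (y : S) (a : TangentSpace (𝓡∂ d) (ψ y)) : Prop :=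
  IsNormal n W ψ y a ∧ 0 ≤ W.metric (ψ y) a a ∧ 0 < W.metric (ψ y) a (ν y)

/-- `k` is a null normal field of the surface along an edge of the extremal wedge, nonvanishing up
to and including the boundary of the conformal completion. -/
structure IsWedgeNullNormal (W : ConformalSpacetime d M) (ψ : S → M)
    (ν k : ∀ y : S, TangentSpace (𝓡∂ d) (ψ y)) : Prop where
  continuous : Continuous (fun y => (⟨ψ y, k y⟩ : TangentBundle (𝓡∂ d) M))
  smooth : ContMDiffOn (𝓡∂ n) (𝓡∂ d).tangent ∞
    (fun y => (⟨ψ y, k y⟩ : TangentBundle (𝓡∂ d) M)) ((𝓡∂ n).interior S)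
  null : ∀ y : S, W.metric (ψ y) (k y) (k y) = 0
  inward : ∀ y : S, PointsIntoWedge n W ψ ν y (k y)

/-- Extremal wedge nesting for deformations of the surface `ψ` through boundary-anchored extremal
surfaces: if the displacement of `∂Σ` is everywhere nonvanishing, achronal and into the extremal
wedge, then so is the displacement of the whole surface, and if in addition it is nowhere along a
null edge `k` of the wedge on `∂Σ` (so that the boundary moves strictly to the inside of that null
face), then it is nowhere along `k` on the whole surface. -/
def ExtremalWedgeNesting (W : ConformalSpacetime d M) (ψ : S → M)
    (ν : ∀ y : S, TangentSpace (𝓡∂ d) (ψ y)) : Prop :=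
  ∀ (Ψ : ℝ → S → M) (η : ∀ y : S, TangentSpace (𝓡∂ d) (ψ y)), IsNormalDeviation n W ψ Ψ η →
    (∀ y ∈ (𝓡∂ n).boundary S, PointsIntoWedge n W ψ ν y (η y)) →
    (∀ y : S, PointsIntoWedge n W ψ ν y (η y)) ∧
    ∀ k : ∀ y : S, TangentSpace (𝓡∂ d) (ψ y), IsWedgeNullNormal n W ψ ν k →
      (∀ y ∈ (𝓡∂ n).boundary S, ¬ ∃ c : ℝ, η y = c • k y) →
      ∀ y : S, ¬ ∃ c : ℝ, η y = c • k y

/-- The focusing term `Q_{kk} = R_{ab} k^a k^b + σ_k²` of a surface along a null normal `k`, in the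
physical metric. -/
def Qkk (W : ConformalSpacetime d M) (ψ : S → M) (y : S) (k : TangentSpace (𝓡∂ d) (ψ y)) : ℝ :=
  W.ricciKK k + shearSq (W.metricComp (ψ y)) (coordMap n ψ y (ψ y)) (extChartAt (𝓡∂ n) y y)
    (vecComp (ψ y) k)

end Spacetime

end ExtremalSurface

end

/-!
# Nested extremal wedges and the focusing term

On the extremal surface `Σ` the normal plane is two-dimensional and Lorentzian, so the null normal
`κ` and the deviation `η₁`, which by nesting is nowhere proportional to `κ`, form a basis of it: `η₂
= a κ + V η₁` with `V = g(η₂, κ) / g(η₁, κ)`. Both pairings are controlled by the wedge: a vector of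
the closed quadrant pairs nonnegatively with an edge, and positively unless it lies along it
(`IsAdaptedFrame.pairing_pos`). Applied to `η₁` and, by nesting again, to `η₂`, this makes `V` a
nonnegative continuous function on the compact surface; it vanishes on the boundary, where `η₂` is a
multiple of `κ`.

Deviations through extremal surfaces solve the Jacobi equation (`jacobi_deviation_eq_zero`): this is
the derivative of the equation "the trace `h^{αβ} ∇_α e_β` is tangential" along the family. The
component along `κ` of the Jacobi operator is a second-order operator obeying a product rule
(`jacobi_smul`), and on the null field `κ` it gives exactly the focusing term `Q` of `κ`
(`jacobi_null`): the curvature contraction is `Ric(κ, κ)` because the frame is adapted, and the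
derivatives of `κ` give the shear. Hence the Jacobi equations of `η₁` and `η₂` combine to
`a Q + L V = 0`, with `L` an elliptic operator without zeroth-order term, whose principal part is
`g(κ, η₁) h^{αβ}` (`focusing_eq_of_jacobi`, `exists_elliptic_equation`).

If `a Q ≤ 0` everywhere, then `L V ≥ 0`, so by the strong maximum principle of Hopf
(`eventually_eq_of_isMax_of_subsolution`) `V` is constant near every interior maximum on a connected
component of `Σ`. As `V` is nonnegative and vanishes on the boundary, it is locally constant
(`eventually_eq_of_forall_isLocalMax`), so `L V = 0` and `a Q = 0`. Since `k = Ω κ` and `w = a / Ω`,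
the product `w Q_{kk}` is `Ω a Q`, which has the sign of `a Q`.

The local computations are done for a metric `g` and a Christoffel form `Γ` on a normed space,
without indices for the ambient space. `Q_{kk}` is defined in charts centred at the point
considered, whereas the elliptic equation needs a fixed chart; `IsAnchoredSurface.Qkk_eq_focusing`
shows that the charts do not matter. That the Christoffel forms transform correctly follows from
the uniqueness of the Levi-Civita connection (`IsCoordChange.cov_fderiv`), and the curvature follows
suit as the commutator of covariant derivatives along a plane (`IsCoordChange.curv_eq`).
-/


noncomputable section

namespace ExtremalSurface

/-! ### The strong maximum principle of Hopf -/

/-- The second-order operator `aⁱʲ ∂ᵢ∂ⱼ f + bⁱ ∂ᵢ f` without zeroth-order term, at the point `x`. -/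
noncomputable def secondOrderOp {n : ℕ} (a : Matrix (Fin n) (Fin n) ℝ) (b : Fin n → ℝ)
    (f : EuclideanSpace ℝ (Fin n) → ℝ) (x : EuclideanSpace ℝ (Fin n)) : ℝ :=
  ∑ i, ∑ j, a i j * pd (fun z => pd f j z) i x + ∑ i, b i * pd f i x

lemma pd_pd_eq {n : ℕ} {f : EuclideanSpace ℝ (Fin n) → ℝ} {x : EuclideanSpace ℝ (Fin n)}
    (hf : ContDiffAt ℝ 2 f x) (i j : Fin n) :
    pd (fun z => pd f j z) i x
      = fderiv ℝ (fderiv ℝ f) x (EuclideanSpace.single i 1) (EuclideanSpace.single j 1) := by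
  have h : DifferentiableAt ℝ (fderiv ℝ f) x :=
    (hf.fderiv_right (m := 1) (by norm_num)).differentiableAt (by norm_num)
  simp only [pd]
  rw [fderiv_clm_apply h (by fun_prop)]
  simp

lemma euclidean_eq_sum {n : ℕ} (q : EuclideanSpace ℝ (Fin n)) :
    q = ∑ i, q i • EuclideanSpace.single i (1 : ℝ) := by
  ext j
  simp [Finset.sum_apply, Pi.single_apply]

lemma hessian_nonpos_of_isLocalMax {n : ℕ} {f : EuclideanSpace ℝ (Fin n) → ℝ}
    {x : EuclideanSpace ℝ (Fin n)} (hf : ContDiffAt ℝ 2 f x) (hmax : IsLocalMax f x)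
    (q : EuclideanSpace ℝ (Fin n)) : fderiv ℝ (fderiv ℝ f) x q q ≤ 0 := by
  by_contra! hpos
  set γ : ℝ → EuclideanSpace ℝ (Fin n) := fun t => x + t • q with hγ
  have hγ0 : γ 0 = x := by simp [hγ]
  have hγd : ∀ t, HasDerivAt γ q t := fun t => by
    simpa [hγ] using ((hasDerivAt_id t).smul_const q).const_add x
  have hγc : Filter.Tendsto γ (𝓝 0) (𝓝 x) := by
    have := (hγd 0).continuousAt.tendsto; rwa [hγ0] at this
  have hd : DifferentiableAt ℝ (fderiv ℝ f) x :=
    (hf.fderiv_right (m := 1) (by norm_num)).differentiableAt (by norm_num)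
  have hder : ∀ᶠ t in 𝓝 (0 : ℝ), deriv (f ∘ γ) t = fderiv ℝ f (γ t) q := by
    have h1 : ∀ᶠ z in 𝓝 x, DifferentiableAt ℝ f z := by
      filter_upwards [hf.eventually (by norm_num)] with z hz using hz.differentiableAt (by norm_num)
    filter_upwards [hγc.eventually h1] with t ht
    exact (ht.hasFDerivAt.comp_hasDerivAt t (hγd t)).deriv
  have hd2 : deriv (deriv (f ∘ γ)) 0 = fderiv ℝ (fderiv ℝ f) x q q := by
    rw [Filter.EventuallyEq.deriv_eq hder]
    have h1 : HasDerivAt (fun t => fderiv ℝ f (γ t)) (fderiv ℝ (fderiv ℝ f) x q) 0 := by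
      have := hd.hasFDerivAt
      rw [← hγ0] at this ⊢
      exact this.comp_hasDerivAt 0 (hγd 0)
    exact (h1.clm_apply (hasDerivAt_const (0 : ℝ) q)).deriv.trans (by simp)
  have hmaxγ : IsLocalMax (f ∘ γ) 0 := by
    have : ∀ᶠ t in 𝓝 (0 : ℝ), f (γ t) ≤ f x := hγc.eventually hmax
    simpa [IsLocalMax, IsMaxFilter, hγ0] using this
  have hcont : ContinuousAt (f ∘ γ) 0 := by
    have h1 : ContinuousAt f (γ 0) := by rw [hγ0]; exact hf.continuousAt
    exact h1.comp (hγd 0).continuousAt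
  have hmin : IsLocalMin (f ∘ γ) 0 :=
    isLocalMin_of_deriv_deriv_pos (by rw [hd2]; exact hpos) hmaxγ.deriv_eq_zero hcont
  -- a local maximum that is also a local minimum is locally constant
  have hconst : f ∘ γ =ᶠ[𝓝 0] fun _ => (f ∘ γ) 0 := by
    filter_upwards [hmaxγ, hmin] with t h1 h2 using le_antisymm h1 h2
  have h0 : deriv (f ∘ γ) =ᶠ[𝓝 0] fun _ => 0 := by
    filter_upwards [hconst.eventuallyEq_nhds] with t ht
    rw [Filter.EventuallyEq.deriv_eq ht]; simp
  rw [Filter.EventuallyEq.deriv_eq h0] at hd2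
  simp at hd2
  linarith

open scoped MatrixOrder in
lemma secondOrderOp_nonpos_of_isLocalMax {n : ℕ} {a : Matrix (Fin n) (Fin n) ℝ} (ha : a.PosSemidef)
    (b : Fin n → ℝ) {f : EuclideanSpace ℝ (Fin n) → ℝ} {x : EuclideanSpace ℝ (Fin n)}
    (hf : ContDiffAt ℝ 2 f x) (hmax : IsLocalMax f x) : secondOrderOp a b f x ≤ 0 := by
  obtain ⟨c, hc⟩ := CStarAlgebra.nonneg_iff_eq_star_mul_self.mp ha.nonneg
  have h1 : ∀ i, pd f i x = 0 := fun i => by simp [pd, hmax.fderiv_eq_zero]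
  have hq : ∀ k : Fin n, ∑ i, ∑ j, c k i * c k j *
      fderiv ℝ (fderiv ℝ f) x (EuclideanSpace.single i 1) (EuclideanSpace.single j 1) ≤ 0 := by
    intro k
    have := hessian_nonpos_of_isLocalMax hf hmax (WithLp.toLp 2 (c k))
    rw [euclidean_eq_sum (WithLp.toLp 2 (c k))] at this
    simp only [map_sum, map_smul, sum_apply, smul_apply,
      smul_eq_mul] at this
    refine le_trans (le_of_eq ?_) this
    rw [Finset.sum_comm]
    simp only [Finset.mul_sum]
    exact Finset.sum_congr rfl fun i _ => Finset.sum_congr rfl fun j _ => by ring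
  have : secondOrderOp a b f x = ∑ k : Fin n, ∑ i, ∑ j, c k i * c k j *
      fderiv ℝ (fderiv ℝ f) x (EuclideanSpace.single i 1) (EuclideanSpace.single j 1) := by
    simp only [secondOrderOp, h1, mul_zero, Finset.sum_const_zero, add_zero, pd_pd_eq hf]
    rw [Finset.sum_comm (s := Finset.univ (α := Fin n)) (t := Finset.univ (α := Fin n))
      (f := fun k i => ∑ j, c k i * c k j * _)]
    refine Finset.sum_congr rfl fun i _ => ?_
    rw [Finset.sum_comm]
    refine Finset.sum_congr rfl fun j _ => ?_
    rw [← Finset.sum_mul, hc]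
    simp [Matrix.mul_apply, Matrix.star_apply]
  rw [this]
  exact Finset.sum_nonpos fun k _ => hq k

lemma secondOrderOp_add_smul {n : ℕ} (a : Matrix (Fin n) (Fin n) ℝ) (b : Fin n → ℝ)
    {f φ : EuclideanSpace ℝ (Fin n) → ℝ} {x : EuclideanSpace ℝ (Fin n)}
    (hf : ContDiffAt ℝ 2 f x) (hφ : ContDiffAt ℝ 2 φ x) (ε : ℝ) :
    secondOrderOp a b (fun z => f z + ε * φ z) x
      = secondOrderOp a b f x + ε * secondOrderOp a b φ x := by
  have hev : ∀ᶠ z in 𝓝 x,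
      fderiv ℝ (fun z => f z + ε * φ z) z = fderiv ℝ f z + ε • fderiv ℝ φ z := by
    filter_upwards [hf.eventually (by norm_num), hφ.eventually (by norm_num)] with z h1 h2
    have h1 := h1.differentiableAt (by norm_num)
    have h2 := h2.differentiableAt (by norm_num)
    exact (h1.hasFDerivAt.add (h2.hasFDerivAt.const_mul ε)).fderiv
  have hfd : DifferentiableAt ℝ (fderiv ℝ f) x :=
    (hf.fderiv_right (m := 1) (by norm_num)).differentiableAt (by norm_num)
  have hφd : DifferentiableAt ℝ (fderiv ℝ φ) x :=
    (hφ.fderiv_right (m := 1) (by norm_num)).differentiableAt (by norm_num)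
  have h2 : fderiv ℝ (fderiv ℝ (fun z => f z + ε * φ z)) x
      = fderiv ℝ (fderiv ℝ f) x + ε • fderiv ℝ (fderiv ℝ φ) x := by
    rw [Filter.EventuallyEq.fderiv_eq hev]
    exact (hfd.hasFDerivAt.add (hφd.hasFDerivAt.const_smul ε)).fderiv
  have hsum : ContDiffAt ℝ 2 (fun z => f z + ε * φ z) x := hf.add (contDiffAt_const.mul hφ)
  simp only [secondOrderOp, pd_pd_eq hf, pd_pd_eq hφ, pd_pd_eq hsum]
  simp only [h2, pd, hev.self_of_nhds, add_apply, smul_apply, smul_eq_mul, mul_add,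
    Finset.sum_add_distrib, Finset.mul_sum]
  simp only [mul_left_comm]
  ring

lemma fderiv_norm_sub_sq_single {n : ℕ} (c x : EuclideanSpace ℝ (Fin n)) (j : Fin n) :
    fderiv ℝ (fun z => ‖z - c‖ ^ 2) x (EuclideanSpace.single j 1) = 2 * (x j - c j) := by
  have h := ((hasFDerivAt_id (𝕜 := ℝ) x).sub_const c).norm_sq
  simp only [id] at h
  rw [h.fderiv]
  simp [EuclideanSpace.inner_single_right]

/-- The barrier `e^{-α|x - c|²} - e^{-αR²}` of Hopf's lemma, positive inside the ball of radius `R`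
around `c` and negative outside. -/
noncomputable def barrier {n : ℕ} (c : EuclideanSpace ℝ (Fin n)) (R α : ℝ)
    (x : EuclideanSpace ℝ (Fin n)) : ℝ :=
  Real.exp (-α * ‖x - c‖ ^ 2) - Real.exp (-α * R ^ 2)

lemma contDiff_barrier {n : ℕ} (c : EuclideanSpace ℝ (Fin n)) (R α : ℝ) :
    ContDiff ℝ ∞ (barrier c R α) := by
  have h : ContDiff ℝ ∞ (fun x : EuclideanSpace ℝ (Fin n) => ‖x - c‖ ^ 2) :=
    (contDiff_id.sub contDiff_const).norm_sq ℝ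
  unfold barrier
  exact ((contDiff_const.mul h).exp).sub contDiff_const

lemma secondOrderOp_barrier {n : ℕ} (a : Matrix (Fin n) (Fin n) ℝ) (b : Fin n → ℝ)
    (c : EuclideanSpace ℝ (Fin n)) (R α : ℝ) (x : EuclideanSpace ℝ (Fin n)) :
    secondOrderOp a b (barrier c R α) x = Real.exp (-α * ‖x - c‖ ^ 2) *
      (4 * α ^ 2 * (∑ i, ∑ j, a i j * (x i - c i) * (x j - c j))
        - 2 * α * (∑ i, a i i + ∑ i, b i * (x i - c i))) := by
  have hsq : ∀ z : EuclideanSpace ℝ (Fin n), DifferentiableAt ℝ (fun z => ‖z - c‖ ^ 2) z := fun z =>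
    (((contDiff_id.sub contDiff_const).norm_sq ℝ).differentiable (n := 1) (by norm_num)) z
  have hexp : ∀ z, HasFDerivAt (fun z : EuclideanSpace ℝ (Fin n) => Real.exp (-α * ‖z - c‖ ^ 2))
      (Real.exp (-α * ‖z - c‖ ^ 2) • (-α • fderiv ℝ (fun z => ‖z - c‖ ^ 2) z)) z := fun z =>
    ((hsq z).hasFDerivAt.const_mul (-α)).exp
  have h1 : ∀ j z, pd (barrier c R α) j z
      = (-2 * α * (z j - c j)) * Real.exp (-α * ‖z - c‖ ^ 2) := fun j z => by
    have := (hexp z).sub_const (Real.exp (-α * R ^ 2))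
    unfold pd
    rw [show barrier c R α = fun z => Real.exp (-α * ‖z - c‖ ^ 2) - Real.exp (-α * R ^ 2) from rfl,
      this.fderiv]
    simp only [smul_apply, smul_eq_mul, fderiv_norm_sub_sq_single]
    ring
  have h2 : ∀ i j, pd (fun z => pd (barrier c R α) j z) i x
      = Real.exp (-α * ‖x - c‖ ^ 2) * (4 * α ^ 2 * (x i - c i) * (x j - c j)
        - 2 * α * (if i = j then 1 else 0)) := fun i j => by
    have hl : HasFDerivAt (fun z : EuclideanSpace ℝ (Fin n) => -2 * α * (z j - c j))
        ((-2 * α) • (EuclideanSpace.proj j : EuclideanSpace ℝ (Fin n) →L[ℝ] ℝ)) x :=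
      (((EuclideanSpace.proj j : EuclideanSpace ℝ (Fin n) →L[ℝ] ℝ).hasFDerivAt (x := x)).sub_const
        (c j)).const_mul (-2 * α)
    simp only [h1]
    unfold pd
    rw [(show HasFDerivAt (fun z => -2 * α * (z j - c j) * Real.exp (-α * ‖z - c‖ ^ 2)) _ x from
      hl.mul (hexp x)).fderiv]
    simp only [add_apply, smul_apply, smul_eq_mul, fderiv_norm_sub_sq_single,
      PiLp.proj_apply, PiLp.single_apply]
    by_cases hij : i = j
    · subst hij; simp; ring
    · simp [hij, Ne.symm hij]; ring
  have hd : ∑ i, a i i = ∑ i, ∑ j, a i j * (if i = j then 1 else 0) := by simp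
  have e1 : ∑ i, ∑ j, a i j * pd (fun z => pd (barrier c R α) j z) i x
      = Real.exp (-α * ‖x - c‖ ^ 2) * (4 * α ^ 2 * ∑ i, ∑ j, a i j * (x i - c i) * (x j - c j))
        - Real.exp (-α * ‖x - c‖ ^ 2) * (2 * α * ∑ i, a i i) := by
    rw [hd]
    simp only [h2, Finset.mul_sum, ← Finset.sum_sub_distrib]
    exact Finset.sum_congr rfl fun i _ => Finset.sum_congr rfl fun j _ => by ring
  have e2 : ∑ i, b i * pd (barrier c R α) i x
      = -(Real.exp (-α * ‖x - c‖ ^ 2) * (2 * α * ∑ i, b i * (x i - c i))) := by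
    simp only [h1, Finset.mul_sum, ← Finset.sum_neg_distrib]
    exact Finset.sum_congr rfl fun i _ => by ring
  rw [secondOrderOp, e1, e2]
  ring

/-- A subsolution cannot have an interior maximum at a point `z` of the boundary of a ball, if it
is strictly smaller than the maximum at all other points of the closed ball near `z`. -/
lemma hopf_contradiction {n : ℕ} {U : Set (EuclideanSpace ℝ (Fin n))} (hU : IsOpen U)
    {a : EuclideanSpace ℝ (Fin n) → Matrix (Fin n) (Fin n) ℝ}
    {b : EuclideanSpace ℝ (Fin n) → Fin n → ℝ} {v : EuclideanSpace ℝ (Fin n) → ℝ}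
    (ha : ∀ x ∈ U, (a x).PosDef) (hac : ∀ i j, ContinuousOn (fun x => a x i j) U)
    (hbc : ∀ i, ContinuousOn (fun x => b x i) U) (hv : ∀ x ∈ U, ContDiffAt ℝ 2 v x)
    (hL : ∀ x ∈ U, 0 ≤ secondOrderOp (a x) (b x) v x) {c z : EuclideanSpace ℝ (Fin n)} {R : ℝ}
    (hR : 0 < R) (hz : z ∈ U) (hzc : dist z c = R) (hmax : ∀ x ∈ U, v x ≤ v z)
    (hlt : ∀ x ∈ U, dist x c ≤ R → x ≠ z → v x < v z) : False := by
  -- `α` is so large that the operator is positive on the barrier at `z`, and hence near `z`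
  set A := ∑ i, ∑ j, a z i j * (z i - c i) * (z j - c j) with hA
  set B := ∑ i, a z i i + ∑ i, b z i * (z i - c i) with hB
  have hApos : 0 < A := by
    have hne : (fun i => z i - c i) ≠ 0 := fun h => by
      have : z = c := by ext i; have := congrFun h i; simp at this; linarith
      rw [this, dist_self] at hzc; linarith
    have := (ha z hz).dotProduct_mulVec_pos hne
    refine lt_of_lt_of_eq this ?_
    simp only [dotProduct, Matrix.mulVec, hA, Finset.mul_sum]
    exact Finset.sum_congr rfl fun i _ => Finset.sum_congr rfl fun j _ => by simp; ring
  obtain ⟨α, hα0, hα⟩ : ∃ α : ℝ, 0 < α ∧ 0 < 4 * α ^ 2 * A - 2 * α * B := by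
    refine ⟨(|B| + 1) / A, by positivity, ?_⟩
    have h1 : 4 * ((|B| + 1) / A) ^ 2 * A - 2 * ((|B| + 1) / A) * B
      = 2 * ((|B| + 1) / A) * (2 * (|B| + 1) - B) := by field_simp; ring
    rw [h1]
    have := le_abs_self B
    have := abs_nonneg B
    have : 0 < 2 * (|B| + 1) - B := by linarith
    positivity
  have hcont : ContinuousOn (fun x => secondOrderOp (a x) (b x) (barrier c R α) x) U := by
    simp only [secondOrderOp_barrier]
    have hx : ∀ i, ContinuousOn (fun x : EuclideanSpace ℝ (Fin n) => x i - c i) U := fun i =>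
      Continuous.continuousOn (by fun_prop)
    refine ContinuousOn.mul (Continuous.continuousOn (by fun_prop)) ?_
    refine ContinuousOn.sub (continuousOn_const.mul ?_)
      (continuousOn_const.mul (ContinuousOn.add ?_ ?_))
    · exact continuousOn_finsetSum _ fun i _ => continuousOn_finsetSum _ fun j _ =>
        ((hac i j).mul (hx i)).mul (hx j)
    · exact continuousOn_finsetSum _ fun i _ => hac i i
    · exact continuousOn_finsetSum _ fun i _ => (hbc i).mul (hx i)
  have hpos : 0 < secondOrderOp (a z) (b z) (barrier c R α) z := by
    rw [secondOrderOp_barrier]; exact mul_pos (Real.exp_pos _) hα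
  have hev : ∀ᶠ x in 𝓝 z, x ∈ U ∧ 0 < secondOrderOp (a x) (b x) (barrier c R α) x :=
    (show ∀ᶠ x in 𝓝 z, x ∈ U from hU.mem_nhds hz).and
      ((hcont.continuousAt (hU.mem_nhds hz)).eventually_const_lt hpos)
  obtain ⟨ρ, hρ, hball⟩ := Metric.nhds_basis_closedBall.mem_iff.mp hev
  have hUb : Metric.closedBall z ρ ⊆ U := fun x hx => (hball hx).1
  have hvc : ContinuousOn v U := fun x hx => (hv x hx).continuousAt.continuousWithinAt
  have hφc : Continuous (barrier c R α) := (contDiff_barrier c R α).continuous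
  have hφneg : ∀ x, R < dist x c → barrier c R α x < 0 := fun x hx => by
    rw [dist_eq_norm] at hx
    simp only [barrier, sub_neg, Real.exp_lt_exp, neg_mul, neg_lt_neg_iff]
    gcongr
  -- on the part of the sphere around `z` inside the ball, `v` stays away from its maximum
  obtain ⟨ε, hε, hεs⟩ : ∃ ε > 0, ∀ x ∈ Metric.sphere z ρ, v x + ε * barrier c R α x < v z := by
    have hK : IsCompact (Metric.sphere z ρ ∩ Metric.closedBall c R) :=
      (isCompact_sphere z ρ).inter_right Metric.isClosed_closedBall
    have hout : ∀ ε > 0, ∀ x ∈ Metric.sphere z ρ, x ∉ Metric.closedBall c R →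
        v x + ε * barrier c R α x < v z := fun ε hε x hx hxn => by
      have h1 := hmax x (hUb (Metric.sphere_subset_closedBall hx))
      have h2 := hφneg x (by simpa using hxn)
      have := mul_neg_of_pos_of_neg hε h2
      linarith
    rcases (Metric.sphere z ρ ∩ Metric.closedBall c R).eq_empty_or_nonempty with he | hne
    · refine ⟨1, one_pos, fun x hx => hout 1 one_pos x hx fun hxc => ?_⟩
      have : x ∈ Metric.sphere z ρ ∩ Metric.closedBall c R := ⟨hx, hxc⟩
      rw [he] at this; exact this
    · have hsub : Metric.sphere z ρ ∩ Metric.closedBall c R ⊆ U := fun x hx =>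
        hUb (Metric.sphere_subset_closedBall hx.1)
      obtain ⟨y, hy, hymax⟩ := hK.exists_isMaxOn hne (hvc.mono hsub)
      have hyz : y ≠ z := fun h => by
        have := hy.1; rw [h] at this; simp at this; linarith
      have hδ : 0 < v z - v y := sub_pos.mpr (hlt y (hsub hy) (by simpa using hy.2) hyz)
      refine ⟨(v z - v y) / 2, by linarith, fun x hx => ?_⟩
      by_cases hxc : x ∈ Metric.closedBall c R
      · have h1 : v x ≤ v y := hymax ⟨hx, hxc⟩
        have h2 : barrier c R α x ≤ 1 := by
          have h3 : Real.exp (-α * ‖x - c‖ ^ 2) ≤ 1 := Real.exp_le_one_iff.mpr (by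
            have : 0 ≤ α * ‖x - c‖ ^ 2 := by positivity
            linarith)
          have := Real.exp_pos (-α * R ^ 2)
          simp only [barrier]; linarith
        nlinarith
      · exact hout _ (by linarith) x hx hxc
  have hφz : barrier c R α z = 0 := by
    rw [dist_eq_norm] at hzc
    simp [barrier, hzc]
  obtain ⟨y, hy, hymax⟩ := (isCompact_closedBall z ρ).exists_isMaxOn
    ⟨z, Metric.mem_closedBall_self hρ.le⟩
    ((hvc.mono hUb).add (continuousOn_const.mul hφc.continuousOn) :
      ContinuousOn (fun x => v x + ε * barrier c R α x) _)
  have hzy : v z ≤ v y + ε * barrier c R α y := by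
    have := hymax (Metric.mem_closedBall_self hρ.le)
    simpa [hφz] using this
  have hyb : y ∈ Metric.ball z ρ := by
    rcases lt_or_eq_of_le (Metric.mem_closedBall.mp hy) with h | h
    · exact h
    · exact absurd hzy (not_le.mpr (hεs y h))
  have hloc : IsLocalMax (fun x => v x + ε * barrier c R α x) y :=
    hymax.isLocalMax (Filter.mem_of_superset (Metric.isOpen_ball.mem_nhds hyb)
      Metric.ball_subset_closedBall)
  have hyU := hUb hy
  have hφ2 : ContDiffAt ℝ 2 (barrier c R α) y :=
    ((contDiff_barrier c R α).contDiffAt).of_le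
    (WithTop.coe_le_coe.mpr (le_top : (2 : ℕ∞) ≤ ⊤))
  have h1 := secondOrderOp_nonpos_of_isLocalMax (ha y hyU).posSemidef (b y)
    ((hv y hyU).add (contDiffAt_const.mul hφ2)) hloc
  rw [secondOrderOp_add_smul _ _ (hv y hyU) hφ2] at h1
  have h2 := hL y hyU
  have h3 := mul_pos hε (hball hy).2
  linarith

/-- **Strong maximum principle**: a subsolution of an elliptic equation without zeroth-order term
is constant near a point where it attains its maximum. -/
theorem eventually_eq_of_isMax_of_subsolution {n : ℕ} {U : Set (EuclideanSpace ℝ (Fin n))}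
    (hU : IsOpen U) {a : EuclideanSpace ℝ (Fin n) → Matrix (Fin n) (Fin n) ℝ}
    {b : EuclideanSpace ℝ (Fin n) → Fin n → ℝ} {v : EuclideanSpace ℝ (Fin n) → ℝ}
    (ha : ∀ x ∈ U, (a x).PosDef) (hac : ∀ i j, ContinuousOn (fun x => a x i j) U)
    (hbc : ∀ i, ContinuousOn (fun x => b x i) U) (hv : ∀ x ∈ U, ContDiffAt ℝ 2 v x)
    (hL : ∀ x ∈ U, 0 ≤ secondOrderOp (a x) (b x) v x) {x₀ : EuclideanSpace ℝ (Fin n)}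
    (hx₀ : x₀ ∈ U) (hmax : ∀ x ∈ U, v x ≤ v x₀) : ∀ᶠ x in 𝓝 x₀, v x = v x₀ := by
  obtain ⟨r, hr, hball⟩ := Metric.isOpen_iff.mp hU x₀ hx₀
  filter_upwards [Metric.ball_mem_nhds x₀ (show 0 < r / 4 by linarith)] with x₁ hx₁
  by_contra hne
  have hvc : ContinuousOn v U := fun x hx => (hv x hx).continuousAt.continuousWithinAt
  have hsub : Metric.closedBall x₀ (r / 2) ⊆ U := fun x hx => hball (by
    rw [Metric.mem_closedBall] at hx; rw [Metric.mem_ball]; linarith)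
  rw [Metric.mem_ball] at hx₁
  -- the point `z` of the set of maxima nearest to `x₁`
  have hF : IsCompact (Metric.closedBall x₀ (r / 2) ∩ v ⁻¹' {v x₀}) := by
    have := (hvc.mono hsub).preimage_isClosed_of_isClosed Metric.isClosed_closedBall
      (isClosed_singleton (x := v x₀))
    exact (isCompact_closedBall x₀ (r / 2)).of_isClosed_subset this inter_subset_left
  obtain ⟨z, ⟨hzb, hzv⟩, hzmin⟩ := hF.exists_isMinOn
    ⟨x₀, Metric.mem_closedBall_self (by linarith), rfl⟩
    (f := fun x => dist x x₁) (by fun_prop)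
  simp only [mem_preimage, mem_singleton_iff] at hzv
  have hzx : dist z x₁ ≤ dist x₀ x₁ := hzmin ⟨Metric.mem_closedBall_self (by linarith), rfl⟩
  have hlt : ∀ x, dist x x₁ < dist z x₁ → v x < v x₀ := fun x hx => by
    have hxb : x ∈ Metric.closedBall x₀ (r / 2) := by
      have := dist_triangle x x₁ x₀
      rw [dist_comm x₀ x₁] at hzx
      rw [Metric.mem_closedBall]; linarith
    refine lt_of_le_of_ne (hmax x (hsub hxb)) fun h => ?_
    have : dist z x₁ ≤ dist x x₁ := hzmin ⟨hxb, h⟩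
    linarith
  have hzx1 : 0 < dist z x₁ := dist_pos.mpr fun h => hne (by rw [← h, hzv])
  -- the ball with diameter `[x₁, z]` touches the set of maxima at `z` only
  have hmid1 : dist z (midpoint ℝ x₁ z) = dist z x₁ / 2 := by
    rw [dist_comm z, dist_midpoint_right, dist_comm x₁ z]; simp; ring
  have hmid2 : dist (midpoint ℝ x₁ z) x₁ = dist z x₁ / 2 := by
    rw [dist_midpoint_left, dist_comm x₁ z]; simp; ring
  refine hopf_contradiction hU ha hac hbc hv hL (half_pos hzx1) (hsub hzb) hmid1
    (fun x hx => by rw [hzv]; exact hmax x hx) fun x _ hxd hxz => ?_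
  rw [hzv]
  apply hlt
  have h1 : dist x x₁ ≤ dist z x₁ := by
    have := dist_triangle x (midpoint ℝ x₁ z) x₁; linarith
  refine lt_of_le_of_ne h1 fun h => hxz ?_
  -- equality in the triangle inequality forces `x = z` by strict convexity
  have h2 : dist x (midpoint ℝ x₁ z) = dist z x₁ / 2 := by
    have := dist_triangle x (midpoint ℝ x₁ z) x₁; linarith
  have h3 : midpoint ℝ x₁ z = midpoint ℝ x₁ x := by
    refine eq_midpoint_of_dist_eq_half ?_ ?_
    · rw [dist_comm, hmid2, dist_comm x₁ x, h]
    · rw [dist_comm, h2, dist_comm x₁ x, h]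
  have h4 := congrArg (fun m => AffineMap.lineMap x₁ m (2 : ℝ)) h3
  simp [midpoint, AffineMap.lineMap_apply] at h4
  exact h4.symm

/-! ### Covariant derivatives along maps -/

section Cov

set_option synthInstance.maxHeartbeats 200000

variable {E : Type*} [NormedAddCommGroup E] [NormedSpace ℝ E]
  {Z : Type*} [NormedAddCommGroup Z] [NormedSpace ℝ Z]
  {P : Type*} [NormedAddCommGroup P] [NormedSpace ℝ P]

/-- The covariant derivative `∂ₐV + Γ(∂ₐX, V)`, in the direction `a`, of a vector field `V` along
the map `X`, for the connection with Christoffel form `Γ`. -/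
def cov (Γ : E → E →L[ℝ] E →L[ℝ] E) (X : Z → E) (a : Z) (V : Z → E) (z : Z) : E :=
  fderiv ℝ V z a + Γ (X z) (fderiv ℝ X z a) (V z)

/-- The curvature `R(a, b)c` of the connection with Christoffel form `Γ`. -/
def curv (Γ : E → E →L[ℝ] E →L[ℝ] E) (x a b c : E) : E :=
  fderiv ℝ Γ x a b c - fderiv ℝ Γ x b a c + Γ x a (Γ x b c) - Γ x b (Γ x a c)

/-- At the point `x`, the connection with Christoffel form `Γ` is torsion free and compatible with
the metric `g`. -/
structure IsLeviCivitaAt (g : E → E →L[ℝ] E →L[ℝ] ℝ) (Γ : E → E →L[ℝ] E →L[ℝ] E) (x : E) :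
    Prop where
  differentiableAt : DifferentiableAt ℝ g x
  metric_symm : ∀ a b, g x a b = g x b a
  torsion_free : ∀ a b, Γ x a b = Γ x b a
  compat : ∀ a b c, fderiv ℝ g x c a b = g x (Γ x c a) b + g x a (Γ x c b)

lemma two_le_infty : (2 : ℕ∞ω) ≤ ∞ := WithTop.coe_le_coe.mpr (le_top : (2 : ℕ∞) ≤ ⊤)

lemma one_le_infty : (1 : ℕ∞ω) ≤ ∞ := WithTop.coe_le_coe.mpr (le_top : (1 : ℕ∞) ≤ ⊤)

lemma differentiableAt_of_infty {f : Z → E} {z : Z} (h : ContDiffAt ℝ ∞ f z) :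
    DifferentiableAt ℝ f z := h.differentiableAt (by simp)

lemma eventually_differentiableAt {f : Z → E} {z : Z} (h : ContDiffAt ℝ ∞ f z) :
    ∀ᶠ y in 𝓝 z, DifferentiableAt ℝ f y := by
  filter_upwards [(h.of_le one_le_infty).eventually (by simp)] with y hy
  exact hy.differentiableAt (by simp)

lemma contDiffAt_fderiv {f : Z → E} {z : Z} (h : ContDiffAt ℝ ∞ f z) :
    ContDiffAt ℝ ∞ (fderiv ℝ f) z := h.fderiv_right (m := ∞) (by simp)

lemma contDiffAt_fderiv_apply {f : Z → E} {z : Z} (h : ContDiffAt ℝ ∞ f z) (a : Z) :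
    ContDiffAt ℝ ∞ (fun y => fderiv ℝ f y a) z :=
  (contDiffAt_fderiv h).clm_apply contDiffAt_const

lemma isSymmSndFDerivAt_of_two {f : Z → E} {z : Z} (h : ContDiffAt ℝ 2 f z) :
    IsSymmSndFDerivAt ℝ f z := h.isSymmSndFDerivAt (by simp)

lemma fderiv_fderiv_apply {f : Z → E} {z : Z} (h : ContDiffAt ℝ ∞ f z) (a b : Z) :
    fderiv ℝ (fun y => fderiv ℝ f y b) z a = fderiv ℝ (fderiv ℝ f) z a b := by
  rw [fderiv_clm_apply (differentiableAt_of_infty (contDiffAt_fderiv h)) (by fun_prop)]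
  simp

lemma fderiv_fderiv_apply_comm {f : Z → E} {z : Z} (h : ContDiffAt ℝ ∞ f z) (a b : Z) :
    fderiv ℝ (fun y => fderiv ℝ f y b) z a = fderiv ℝ (fun y => fderiv ℝ f y a) z b := by
  rw [fderiv_fderiv_apply h, fderiv_fderiv_apply h,
    (isSymmSndFDerivAt_of_two (h.of_le two_le_infty)).eq]

variable {g : E → E →L[ℝ] E →L[ℝ] ℝ} {Γ : E → E →L[ℝ] E →L[ℝ] E} {X V W : Z → E} {z : Z}

lemma contDiffAt_cov (hΓ : ContDiffAt ℝ ∞ Γ (X z)) (hX : ContDiffAt ℝ ∞ X z)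
    (hV : ContDiffAt ℝ ∞ V z) (a : Z) : ContDiffAt ℝ ∞ (cov Γ X a V) z :=
  (contDiffAt_fderiv_apply hV a).add
    (((hΓ.comp z hX).clm_apply (contDiffAt_fderiv_apply hX a)).clm_apply hV)

lemma contDiffAt_metric (hg : ContDiffAt ℝ ∞ g (X z)) (hX : ContDiffAt ℝ ∞ X z)
    (hV : ContDiffAt ℝ ∞ V z) (hW : ContDiffAt ℝ ∞ W z) :
    ContDiffAt ℝ ∞ (fun y => g (X y) (V y) (W y)) z :=
  ((hg.comp z hX).clm_apply hV).clm_apply hW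

lemma cov_congr {V' : Z → E} (h : V =ᶠ[𝓝 z] V') (a : Z) : cov Γ X a V z = cov Γ X a V' z := by
  simp only [cov, h.fderiv_eq, h.eq_of_nhds]

lemma cov_add (hV : DifferentiableAt ℝ V z) (hW : DifferentiableAt ℝ W z) (a : Z) :
    cov Γ X a (fun y => V y + W y) z = cov Γ X a V z + cov Γ X a W z := by
  simp only [cov, fderiv_fun_add hV hW, add_apply, map_add]
  abel

lemma cov_smul {f : Z → ℝ} (hf : DifferentiableAt ℝ f z) (hV : DifferentiableAt ℝ V z) (a : Z) :
    cov Γ X a (fun y => f y • V y) z = fderiv ℝ f z a • V z + f z • cov Γ X a V z := by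
  simp only [cov, fderiv_fun_smul hf hV, add_apply, smul_apply,
    ContinuousLinearMap.smulRight_apply, map_smul, smul_add]
  abel

/-- Restriction of covariant derivatives to a submanifold of the parameter space. -/
lemma cov_comp {ι : P → Z} {u : P} (hι : DifferentiableAt ℝ ι u) (hX : DifferentiableAt ℝ X (ι u))
    (hV : DifferentiableAt ℝ V (ι u)) (a : P) :
    cov Γ (fun y => X (ι y)) a (fun y => V (ι y)) u = cov Γ X (fderiv ℝ ι u a) V (ι u) := by
  simp only [cov]
  rw [show (fun y => X (ι y)) = X ∘ ι from rfl, show (fun y => V (ι y)) = V ∘ ι from rfl,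
    fderiv_comp u hX hι, fderiv_comp u hV hι]
  rfl

/-- Vanishing torsion: `∇ₐ ∂_b X = ∇_b ∂ₐ X`. -/
lemma cov_fderiv_comm (hLC : IsLeviCivitaAt g Γ (X z)) (hX : ContDiffAt ℝ 2 X z) (a b : Z) :
    cov Γ X a (fun y => fderiv ℝ X y b) z = cov Γ X b (fun y => fderiv ℝ X y a) z := by
  have hd : DifferentiableAt ℝ (fderiv ℝ X) z :=
    (hX.fderiv_right (m := 1) (by norm_num)).differentiableAt (by norm_num)
  have h : ∀ c d, fderiv ℝ (fun y => fderiv ℝ X y d) z c = fderiv ℝ (fderiv ℝ X) z c d :=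
    fun c d => by
      rw [fderiv_clm_apply hd (by fun_prop)]; simp
  simp only [cov, h, (isSymmSndFDerivAt_of_two hX).eq a b]
  rw [hLC.torsion_free]

lemma fderiv_metric (hLC : IsLeviCivitaAt g Γ (X z))
    (hX : DifferentiableAt ℝ X z) (hV : DifferentiableAt ℝ V z) (hW : DifferentiableAt ℝ W z)
    (a : Z) : fderiv ℝ (fun y => g (X y) (V y) (W y)) z a
      = g (X z) (cov Γ X a V z) (W z) + g (X z) (V z) (cov Γ X a W z) := by
  have h1 : HasFDerivAt (fun y => g (X y)) ((fderiv ℝ g (X z)).comp (fderiv ℝ X z)) z :=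
    HasFDerivAt.comp (g := g) z hLC.differentiableAt.hasFDerivAt hX.hasFDerivAt
  have h2 := (h1.clm_apply hV.hasFDerivAt).clm_apply hW.hasFDerivAt
  rw [h2.fderiv]
  simp only [cov, add_apply, ContinuousLinearMap.comp_apply, ContinuousLinearMap.flip_apply,
    map_add, hLC.compat]
  ring

/-- The curvature is the commutator of covariant derivatives. -/
lemma cov_cov_sub (hΓ : ContDiffAt ℝ ∞ Γ (X z)) (hX : ContDiffAt ℝ ∞ X z)
    (hV : ContDiffAt ℝ ∞ V z) (a b : Z) :
    cov Γ X a (cov Γ X b V) z - cov Γ X b (cov Γ X a V) z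
      = curv Γ (X z) (fderiv ℝ X z a) (fderiv ℝ X z b) (V z) := by
  have key : ∀ c d, fderiv ℝ (cov Γ X d V) z c
      = fderiv ℝ (fun y => fderiv ℝ V y d) z c
        + (fderiv ℝ Γ (X z) (fderiv ℝ X z c) (fderiv ℝ X z d) (V z)
          + Γ (X z) (fderiv ℝ (fun y => fderiv ℝ X y d) z c) (V z)
          + Γ (X z) (fderiv ℝ X z d) (fderiv ℝ V z c)) := fun c d => by
    have h1 : HasFDerivAt (fun y => Γ (X y)) ((fderiv ℝ Γ (X z)).comp (fderiv ℝ X z)) z :=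
      (differentiableAt_of_infty hΓ).hasFDerivAt.comp z (differentiableAt_of_infty hX).hasFDerivAt
    have h2 := (h1.clm_apply (differentiableAt_of_infty
      (contDiffAt_fderiv_apply hX d)).hasFDerivAt).clm_apply
      (differentiableAt_of_infty hV).hasFDerivAt
    have h3 := (differentiableAt_of_infty (contDiffAt_fderiv_apply hV d)).hasFDerivAt.add h2
    rw [show cov Γ X d V = fun y => fderiv ℝ V y d + Γ (X y) (fderiv ℝ X y d) (V y) from rfl,
      (show HasFDerivAt (fun y => fderiv ℝ V y d + Γ (X y) (fderiv ℝ X y d) (V y)) _ z from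
        h3).fderiv]
    simp only [add_apply, ContinuousLinearMap.comp_apply, ContinuousLinearMap.flip_apply]
    abel
  have hu : ∀ c Y, cov Γ X c Y z = fderiv ℝ Y z c + Γ (X z) (fderiv ℝ X z c) (Y z) :=
    fun _ _ => rfl
  rw [hu a (cov Γ X b V), hu b (cov Γ X a V), key, key, fderiv_fderiv_apply_comm hV a b,
    fderiv_fderiv_apply_comm hX a b]
  simp only [cov, curv, map_add]
  abel

lemma curv_add_left (x a a' b c : E) :
    curv Γ x (a + a') b c = curv Γ x a b c + curv Γ x a' b c := by
  simp only [curv, map_add, add_apply]; abel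

lemma curv_smul_left (x a b c : E) (r : ℝ) : curv Γ x (r • a) b c = r • curv Γ x a b c := by
  simp only [curv, map_smul, smul_apply, smul_sub, smul_add]

lemma curv_swap (x a b c : E) : curv Γ x a b c = - curv Γ x b a c := by
  simp only [curv]; abel

/-- The endomorphism `a ↦ R(a, k)k`, whose trace is the Ricci curvature `Ric(k, k)`. -/
def ricciEndo (Γ : E → E →L[ℝ] E →L[ℝ] E) (x k : E) : E →ₗ[ℝ] E where
  toFun a := curv Γ x a k k
  map_add' a a' := curv_add_left x a a' k k
  map_smul' r a := curv_smul_left x a k k r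

/-- The affine map `(s, t) ↦ x + s a + t b`, used to realise a curvature as a commutator. -/
def plane (x a b : E) (p : ℝ × ℝ) : E := x + (p.1 • a + p.2 • b)

lemma hasFDerivAt_plane (x a b : E) (p : ℝ × ℝ) :
    HasFDerivAt (plane x a b) ((ContinuousLinearMap.fst ℝ ℝ ℝ).smulRight a
      + (ContinuousLinearMap.snd ℝ ℝ ℝ).smulRight b) p := by
  have := (((ContinuousLinearMap.fst ℝ ℝ ℝ).smulRight a
      + (ContinuousLinearMap.snd ℝ ℝ ℝ).smulRight b).hasFDerivAt (x := p)).const_add x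
  exact this

lemma contDiff_plane (x a b : E) : ContDiff ℝ ∞ (plane x a b) := by
  unfold plane; fun_prop

lemma plane_zero (x a b : E) : plane x a b 0 = x := by simp [plane]

/-- The curvature operator is antisymmetric with respect to the metric. -/
lemma metric_curv_antisymm {x : E} (hg : ContDiffAt ℝ ∞ g x) (hΓ : ContDiffAt ℝ ∞ Γ x)
    (hLC : ∀ᶠ y in 𝓝 x, IsLeviCivitaAt g Γ y) (a b c e : E) :
    g x (curv Γ x a b c) e + g x c (curv Γ x a b e) = 0 := by
  set X := plane x a b with hXdef
  have hX0 : X 0 = x := plane_zero x a b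
  have hXs : ∀ p, ContDiffAt ℝ ∞ X p := fun p => (contDiff_plane x a b).contDiffAt
  have hc : ∀ (w : E) p, ContDiffAt ℝ ∞ (fun _ : ℝ × ℝ => w) p := fun w p => contDiffAt_const
  rw [← hX0] at hg hΓ hLC
  have hLCX : ∀ᶠ p in 𝓝 (0 : ℝ × ℝ), IsLeviCivitaAt g Γ (X p) :=
    (hXs 0).continuousAt.eventually hLC
  -- two derivatives of `g(c, e)` along the plane
  have key : ∀ d f : ℝ × ℝ,
      fderiv ℝ (fun p => fderiv ℝ (fun q => g (X q) c e) p f) 0 d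
      = g x (cov Γ X d (cov Γ X f fun _ => c) 0) e
        + g x (cov Γ X f (fun _ => c) 0) (cov Γ X d (fun _ => e) 0)
        + (g x (cov Γ X d (fun _ => c) 0) (cov Γ X f (fun _ => e) 0)
        + g x c (cov Γ X d (cov Γ X f fun _ => e) 0)) := by
    intro d f
    have h1 : (fun p => fderiv ℝ (fun q => g (X q) c e) p f) =ᶠ[𝓝 0] fun p =>
        g (X p) (cov Γ X f (fun _ => c) p) e + g (X p) c (cov Γ X f (fun _ => e) p) := by
      filter_upwards [hLCX] with p hp
      exact fderiv_metric hp (differentiableAt_of_infty (hXs p)) (differentiableAt_const c)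
        (differentiableAt_const e) f
    have hcc := contDiffAt_cov hΓ (hXs 0) (hc c 0) f
    have hce := contDiffAt_cov hΓ (hXs 0) (hc e 0) f
    rw [h1.fderiv_eq, fderiv_fun_add
      (differentiableAt_of_infty (contDiffAt_metric hg (hXs 0) hcc (hc e 0)))
      (differentiableAt_of_infty (contDiffAt_metric hg (hXs 0) (hc c 0) hce)), add_apply,
      fderiv_metric hLCX.self_of_nhds (differentiableAt_of_infty (hXs 0))
        (differentiableAt_of_infty hcc) (differentiableAt_const e),
      fderiv_metric hLCX.self_of_nhds (differentiableAt_of_infty (hXs 0))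
        (differentiableAt_const c) (differentiableAt_of_infty hce), hX0]
  have hsymm := fderiv_fderiv_apply_comm (contDiffAt_metric hg (hXs 0) (hc c 0) (hc e 0))
    ((1 : ℝ), (0 : ℝ)) ((0 : ℝ), (1 : ℝ))
  rw [key, key] at hsymm
  have hRc := cov_cov_sub hΓ (hXs 0) (hc c 0) ((1 : ℝ), (0 : ℝ)) ((0 : ℝ), (1 : ℝ))
  have hRe := cov_cov_sub hΓ (hXs 0) (hc e 0) ((1 : ℝ), (0 : ℝ)) ((0 : ℝ), (1 : ℝ))
  have hda : fderiv ℝ X 0 ((1 : ℝ), (0 : ℝ)) = a := by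
    rw [(hasFDerivAt_plane x a b 0).fderiv]; simp
  have hdb : fderiv ℝ X 0 ((0 : ℝ), (1 : ℝ)) = b := by
    rw [(hasFDerivAt_plane x a b 0).fderiv]; simp
  rw [hda, hdb, hX0] at hRc hRe
  rw [← hRc, ← hRe]
  simp only [map_sub, sub_apply]
  linarith

end Cov

/-! ### Smooth families of matrices -/

section MatrixInverse

variable {Z : Type*} [NormedAddCommGroup Z] [NormedSpace ℝ Z] {ι : Type*} [Fintype ι]
  [DecidableEq ι] {h : Z → Matrix ι ι ℝ} {z : Z}

lemma contDiffAt_det {r : ℕ∞ω} (hh : ∀ α β, ContDiffAt ℝ r (fun y => h y α β) z) :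
    ContDiffAt ℝ r (fun y => (h y).det) z := by
  simp only [Matrix.det_apply]
  refine ContDiffAt.sum fun σ _ => ?_
  simp only [Units.smul_def, zsmul_eq_mul]
  exact contDiffAt_const.mul (contDiffAt_prod fun i _ => hh _ _)

lemma contDiffAt_matrix_inv {r : ℕ∞ω} (hh : ∀ α β, ContDiffAt ℝ r (fun y => h y α β) z)
    (hdet : (h z).det ≠ 0) (α β : ι) : ContDiffAt ℝ r (fun y => (h y)⁻¹ α β) z := by
  simp only [Matrix.inv_def, Ring.inverse_eq_inv', Matrix.smul_apply, smul_eq_mul,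
    Matrix.adjugate_apply]
  refine ((contDiffAt_det hh).inv hdet).mul (contDiffAt_det fun i j => ?_)
  by_cases hi : i = β
  · subst hi; simpa using (contDiffAt_const :
      ContDiffAt ℝ r (fun _ : Z => (Pi.single α 1 : ι → ℝ) j) z)
  · simpa [Matrix.updateRow_ne hi] using hh i j

lemma fderiv_matrix_inv (hh : ∀ α β, ContDiffAt ℝ 1 (fun y => h y α β) z)
    (hdet : (h z).det ≠ 0) (τ : Z) (α β : ι) :
    fderiv ℝ (fun y => (h y)⁻¹ α β) z τ
      = -∑ γ, ∑ δ, (h z)⁻¹ α γ * fderiv ℝ (fun y => h y γ δ) z τ * (h z)⁻¹ δ β := by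
  have hd : ∀ α β, DifferentiableAt ℝ (fun y => h y α β) z := fun α β =>
    (hh α β).differentiableAt (by norm_num)
  have hid : ∀ α β, DifferentiableAt ℝ (fun y => (h y)⁻¹ α β) z := fun α β =>
    (contDiffAt_matrix_inv hh hdet α β).differentiableAt (by norm_num)
  set A : Matrix ι ι ℝ := fun α β => fderiv ℝ (fun y => h y α β) z τ with hA
  set B : Matrix ι ι ℝ := fun α β => fderiv ℝ (fun y => (h y)⁻¹ α β) z τ with hB
  have hev : ∀ᶠ y in 𝓝 z, h y * (h y)⁻¹ = 1 := by
    have : ∀ᶠ y in 𝓝 z, (h y).det ≠ 0 := (contDiffAt_det hh).continuousAt.eventually_ne hdet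
    filter_upwards [this] with y hy using Matrix.mul_nonsing_inv _ (isUnit_iff_ne_zero.mpr hy)
  have hsum : A * (h z)⁻¹ + h z * B = 0 := by
    ext α β
    have h1 : (fun y => ∑ γ, h y α γ * (h y)⁻¹ γ β) =ᶠ[𝓝 z] fun _ => (1 : Matrix ι ι ℝ) α β := by
      filter_upwards [hev] with y hy
      rw [← hy, Matrix.mul_apply]
    have h2 := HasFDerivAt.fun_sum (u := Finset.univ) fun γ _ =>
      (hd α γ).hasFDerivAt.fun_mul (hid γ β).hasFDerivAt
    have h3 := congrArg (fun L => L τ) (h2.fderiv.symm.trans h1.fderiv_eq)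
    simp only [sum_apply, fderiv_fun_const, Pi.zero_apply, zero_apply] at h3
    rw [Matrix.add_apply, Matrix.mul_apply, Matrix.mul_apply, ← Finset.sum_add_distrib,
      Matrix.zero_apply, ← h3]
    refine Finset.sum_congr rfl fun γ _ => ?_
    simp only [add_apply, smul_apply, smul_eq_mul, hA, hB]
    ring
  have hB' : B = -((h z)⁻¹ * A * (h z)⁻¹) := by
    have hu : IsUnit (h z).det := isUnit_iff_ne_zero.mpr hdet
    have h1 : h z * B = -(A * (h z)⁻¹) := by rw [eq_neg_iff_add_eq_zero, add_comm]; exact hsum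
    calc B = (h z)⁻¹ * (h z * B) := by rw [Matrix.nonsing_inv_mul_cancel_left _ _ hu]
      _ = _ := by rw [h1, Matrix.mul_neg, Matrix.mul_assoc]
  have := congrFun (congrFun hB' α) β
  refine this.trans ?_
  rw [Matrix.neg_apply, Matrix.mul_apply]
  simp only [Matrix.mul_apply, Finset.sum_mul]
  rw [Finset.sum_comm]

end MatrixInverse

/-! ### The Jacobi operator of an extremal surface -/

section Jacobi

variable {E : Type*} [NormedAddCommGroup E] [NormedSpace ℝ E]
  {Z : Type*} [NormedAddCommGroup Z] [NormedSpace ℝ Z] {n : ℕ}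

set_option synthInstance.maxHeartbeats 200000

/-- The first fundamental form of the map `X` in the directions `ε α` of its domain. -/
def firstForm (g : E → E →L[ℝ] E →L[ℝ] ℝ) (X : Z → E) (ε : Fin n → Z) (z : Z) :
    Matrix (Fin n) (Fin n) ℝ :=
  fun α β => g (X z) (fderiv ℝ X z (ε α)) (fderiv ℝ X z (ε β))

/-- The covariant derivative `∇_α e_β` of the frame `e_β = ∂X/∂ε_β`. -/
def secondForm (Γ : E → E →L[ℝ] E →L[ℝ] E) (X : Z → E) (ε : Fin n → Z) (α β : Fin n) (z : Z) :
    E :=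
  cov Γ X (ε α) (fun y => fderiv ℝ X y (ε β)) z

/-- The trace `h^{αβ} ∇_α e_β`, whose normal part is the mean curvature vector up to sign. -/
def frameTrace (g : E → E →L[ℝ] E →L[ℝ] ℝ) (Γ : E → E →L[ℝ] E →L[ℝ] E) (X : Z → E)
    (ε : Fin n → Z) (z : Z) : E :=
  ∑ α, ∑ β, (firstForm g X ε z)⁻¹ α β • secondForm Γ X ε α β z

/-- The component along `e_δ` of the tangential part of `frameTrace`. -/
def tangentCoef (g : E → E →L[ℝ] E →L[ℝ] ℝ) (Γ : E → E →L[ℝ] E →L[ℝ] E) (X : Z → E)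
    (ε : Fin n → Z) (δ : Fin n) (z : Z) : ℝ :=
  ∑ γ, (firstForm g X ε z)⁻¹ γ δ * g (X z) (fderiv ℝ X z (ε γ)) (frameTrace g Γ X ε z)

/-- The component along the normal vector `k` of the Jacobi operator, the linearisation of the
mean curvature vector, applied to the vector field `ξ` along `X`. -/
def jacobi (g : E → E →L[ℝ] E →L[ℝ] ℝ) (Γ : E → E →L[ℝ] E →L[ℝ] E) (X : Z → E) (ε : Fin n → Z)
    (k : E) (ξ : Z → E) (z : Z) : ℝ :=
  ∑ α, ∑ β, (firstForm g X ε z)⁻¹ α β * (g (X z) k (cov Γ X (ε α) (cov Γ X (ε β) ξ) z)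
      + g (X z) k (curv Γ (X z) (ξ z) (fderiv ℝ X z (ε α)) (fderiv ℝ X z (ε β))))
    + 2 * ∑ α, ∑ β, ∑ γ, ∑ δ, (firstForm g X ε z)⁻¹ α γ * (firstForm g X ε z)⁻¹ β δ
      * g (X z) (ξ z) (secondForm Γ X ε α β z) * g (X z) k (secondForm Γ X ε γ δ z)
    - ∑ δ, tangentCoef g Γ X ε δ z * g (X z) k (cov Γ X (ε δ) ξ z)

variable {g : E → E →L[ℝ] E →L[ℝ] ℝ} {Γ : E → E →L[ℝ] E →L[ℝ] E} {X : Z → E} {ε : Fin n → Z}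
  {z : Z}

lemma contDiffAt_firstForm (hg : ContDiffAt ℝ ∞ g (X z)) (hX : ContDiffAt ℝ ∞ X z) (α β : Fin n) :
    ContDiffAt ℝ ∞ (fun y => firstForm g X ε y α β) z :=
  contDiffAt_metric hg hX (contDiffAt_fderiv_apply hX _) (contDiffAt_fderiv_apply hX _)

lemma contDiffAt_firstForm_inv (hg : ContDiffAt ℝ ∞ g (X z)) (hX : ContDiffAt ℝ ∞ X z)
    (hdet : (firstForm g X ε z).det ≠ 0) (α β : Fin n) :
    ContDiffAt ℝ ∞ (fun y => (firstForm g X ε y)⁻¹ α β) z :=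
  contDiffAt_matrix_inv (contDiffAt_firstForm hg hX) hdet α β

lemma contDiffAt_secondForm (hΓ : ContDiffAt ℝ ∞ Γ (X z)) (hX : ContDiffAt ℝ ∞ X z)
    (α β : Fin n) : ContDiffAt ℝ ∞ (secondForm Γ X ε α β) z :=
  contDiffAt_cov hΓ hX (contDiffAt_fderiv_apply hX _) _

lemma contDiffAt_frameTrace (hg : ContDiffAt ℝ ∞ g (X z)) (hΓ : ContDiffAt ℝ ∞ Γ (X z))
    (hX : ContDiffAt ℝ ∞ X z) (hdet : (firstForm g X ε z).det ≠ 0) :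
    ContDiffAt ℝ ∞ (frameTrace g Γ X ε) z :=
  ContDiffAt.sum fun α _ => ContDiffAt.sum fun β _ =>
    (contDiffAt_firstForm_inv hg hX hdet α β).smul (contDiffAt_secondForm hΓ hX α β)

lemma contDiffAt_tangentCoef (hg : ContDiffAt ℝ ∞ g (X z)) (hΓ : ContDiffAt ℝ ∞ Γ (X z))
    (hX : ContDiffAt ℝ ∞ X z) (hdet : (firstForm g X ε z).det ≠ 0) (δ : Fin n) :
    ContDiffAt ℝ ∞ (tangentCoef g Γ X ε δ) z :=
  ContDiffAt.sum fun γ _ => (contDiffAt_firstForm_inv hg hX hdet γ δ).mul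
    (contDiffAt_metric hg hX (contDiffAt_fderiv_apply hX _) (contDiffAt_frameTrace hg hΓ hX hdet))

lemma firstForm_symm (hLC : IsLeviCivitaAt g Γ (X z)) (α β : Fin n) :
    firstForm g X ε z α β = firstForm g X ε z β α := hLC.metric_symm _ _

lemma firstForm_inv_symm (hLC : IsLeviCivitaAt g Γ (X z)) (α β : Fin n) :
    (firstForm g X ε z)⁻¹ α β = (firstForm g X ε z)⁻¹ β α := by
  have h : (firstForm g X ε z).transpose = firstForm g X ε z :=
    Matrix.ext fun α β => firstForm_symm hLC β α
  have := Matrix.transpose_nonsing_inv (firstForm g X ε z)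
  rw [h] at this
  exact congrFun (congrFun this β) α

lemma secondForm_symm (hLC : IsLeviCivitaAt g Γ (X z)) (hX : ContDiffAt ℝ ∞ X z) (α β : Fin n) :
    secondForm Γ X ε α β z = secondForm Γ X ε β α z :=
  cov_fderiv_comm hLC (hX.of_le two_le_infty) _ _

lemma metric_frameTrace (Y : E) : g (X z) Y (frameTrace g Γ X ε z)
    = ∑ α, ∑ β, (firstForm g X ε z)⁻¹ α β * g (X z) Y (secondForm Γ X ε α β z) := by
  simp only [frameTrace, map_sum, map_smul, smul_eq_mul]

lemma sum_comm_pairs (F : Fin n → Fin n → Fin n → Fin n → ℝ) :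
    ∑ α, ∑ β, ∑ γ, ∑ δ, F α β γ δ = ∑ γ, ∑ δ, ∑ α, ∑ β, F α β γ δ := by
  have h : ∀ f : Fin n → Fin n → Fin n → ℝ, ∑ α, ∑ β, ∑ γ, f α β γ = ∑ γ, ∑ α, ∑ β, f α β γ :=
    fun f => (Finset.sum_congr rfl fun α _ => Finset.sum_comm).trans Finset.sum_comm
  rw [h (fun α β γ => ∑ δ, F α β γ δ)]
  exact Finset.sum_congr rfl fun γ _ => h fun α β δ => F α β γ δ

lemma sum_contract_symm {hi : Matrix (Fin n) (Fin n) ℝ} (hs : ∀ α β, hi α β = hi β α)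
    (S T : Fin n → Fin n → ℝ) :
    ∑ α, ∑ β, S α β * -∑ γ, ∑ δ, hi α γ * (-2 * T γ δ) * hi δ β
      = 2 * ∑ α, ∑ β, ∑ γ, ∑ δ, hi α γ * hi β δ * T α β * S γ δ := by
  rw [sum_comm_pairs]
  simp only [Finset.mul_sum, ← Finset.sum_neg_distrib]
  refine Finset.sum_congr rfl fun α _ => Finset.sum_congr rfl fun β _ =>
    Finset.sum_congr rfl fun γ _ => Finset.sum_congr rfl fun δ _ => ?_
  rw [hs γ α]
  ring

/-- Along a one-parameter family of surfaces whose mean curvature vanishes, the deviation vector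
field, if normal, is in the kernel of the Jacobi operator. The family is the map `X`, whose domain
includes the parameter in the direction `τ`. -/
theorem jacobi_deviation_eq_zero (hg : ContDiffAt ℝ ∞ g (X z)) (hΓ : ContDiffAt ℝ ∞ Γ (X z))
    (hX : ContDiffAt ℝ ∞ X z) (hLC : ∀ᶠ y in 𝓝 (X z), IsLeviCivitaAt g Γ y)
    (hdet : (firstForm g X ε z).det ≠ 0) {τ : Z} {k : E}
    (hext : ∀ Y : E, g (X z) Y (frameTrace g Γ X ε z)
      = ∑ δ, tangentCoef g Γ X ε δ z * g (X z) Y (fderiv ℝ X z (ε δ)))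
    (hext' : fderiv ℝ (fun y => g (X y) k (frameTrace g Γ X ε y)
      - ∑ δ, tangentCoef g Γ X ε δ y * g (X y) k (fderiv ℝ X y (ε δ))) z τ = 0)
    (hk : ∀ δ, g (X z) k (fderiv ℝ X z (ε δ)) = 0)
    (hη : ∀ γ δ, fderiv ℝ (fun y => g (X y) (fderiv ℝ X y τ) (fderiv ℝ X y (ε δ))) z (ε γ) = 0) :
    jacobi g Γ X ε k (fun y => fderiv ℝ X y τ) z = 0 := by
  have hLCz := hLC.self_of_nhds
  have hXd := differentiableAt_of_infty hX
  have hed : ∀ δ, DifferentiableAt ℝ (fun y => fderiv ℝ X y (ε δ)) z := fun δ =>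
    differentiableAt_of_infty (contDiffAt_fderiv_apply hX _)
  have hηd : DifferentiableAt ℝ (fun y => fderiv ℝ X y τ) z :=
    differentiableAt_of_infty (contDiffAt_fderiv_apply hX _)
  have hid : ∀ α β, DifferentiableAt ℝ (fun y => (firstForm g X ε y)⁻¹ α β) z := fun α β =>
    (contDiffAt_firstForm_inv hg hX hdet α β).differentiableAt (by simp)
  have hDd : ∀ α β, DifferentiableAt ℝ (secondForm Γ X ε α β) z := fun α β =>
    differentiableAt_of_infty (contDiffAt_secondForm hΓ hX α β)
  have hcd : ∀ δ, DifferentiableAt ℝ (tangentCoef g Γ X ε δ) z := fun δ =>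
    (contDiffAt_tangentCoef hg hΓ hX hdet δ).differentiableAt (by simp)
  have hkc : ContDiffAt ℝ ∞ (fun _ : Z => k) z := contDiffAt_const
  have hS : ∀ α β, DifferentiableAt ℝ (fun y => g (X y) k (secondForm Γ X ε α β y)) z := fun α β =>
    (contDiffAt_metric hg hX hkc (contDiffAt_secondForm hΓ hX α β)).differentiableAt (by simp)
  have hT : ∀ δ, DifferentiableAt ℝ (fun y => g (X y) k (fderiv ℝ X y (ε δ))) z := fun δ =>
    (contDiffAt_metric hg hX hkc (contDiffAt_fderiv_apply hX _)).differentiableAt (by simp)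
  set hi := (firstForm g X ε z)⁻¹ with hhi
  set q := cov Γ X τ (fun _ => k) z with hq
  -- `∇_τ e_δ = ∇_δ η`
  have hcomm : ∀ δ, cov Γ X τ (fun y => fderiv ℝ X y (ε δ)) z
      = cov Γ X (ε δ) (fun y => fderiv ℝ X y τ) z := fun δ =>
    cov_fderiv_comm hLCz (hX.of_le two_le_infty) _ _
  -- `∇_τ ∇_α e_β = ∇_α ∇_β η + R(η, e_α) e_β`
  have hcomm2 : ∀ α β, cov Γ X τ (secondForm Γ X ε α β) z
      = cov Γ X (ε α) (cov Γ X (ε β) fun y => fderiv ℝ X y τ) z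
        + curv Γ (X z) (fderiv ℝ X z τ) (fderiv ℝ X z (ε α)) (fderiv ℝ X z (ε β)) := fun α β => by
    have h1 := cov_cov_sub hΓ hX (contDiffAt_fderiv_apply hX (ε β)) τ (ε α)
    have h2 : cov Γ X τ (fun y => fderiv ℝ X y (ε β)) =ᶠ[𝓝 z]
        cov Γ X (ε β) (fun y => fderiv ℝ X y τ) := by
      filter_upwards [hX.continuousAt.eventually hLC,
        (hX.of_le two_le_infty).eventually (by simp)] with y hy1 hy2
      exact cov_fderiv_comm hy1 hy2 _ _
    rw [cov_congr h2, sub_eq_iff_eq_add'] at h1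
    exact h1
  -- `∂_τ h_γδ = -2 g(η, ∇_γ e_δ)`
  have hdh : ∀ γ δ, fderiv ℝ (fun y => firstForm g X ε y γ δ) z τ
      = -2 * g (X z) (fderiv ℝ X z τ) (secondForm Γ X ε γ δ z) := fun γ δ => by
    have h1 : ∀ γ δ, g (X z) (cov Γ X (ε γ) (fun y => fderiv ℝ X y τ) z) (fderiv ℝ X z (ε δ))
        = - g (X z) (fderiv ℝ X z τ) (secondForm Γ X ε γ δ z) := fun γ δ => by
      have := hη γ δ
      rw [fderiv_metric hLCz hXd hηd (hed δ)] at this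
      exact eq_neg_of_add_eq_zero_left this
    rw [show (fun y => firstForm g X ε y γ δ)
        = fun y => g (X y) (fderiv ℝ X y (ε γ)) (fderiv ℝ X y (ε δ)) from rfl,
      fderiv_metric hLCz hXd (hed γ) (hed δ), hcomm, hcomm, h1,
      hLCz.metric_symm (fderiv ℝ X z (ε γ)), h1, secondForm_symm hLCz hX δ γ]
    ring
  -- differentiate the equation of extremality in the direction `τ`
  have hder := hext'
  simp only [metric_frameTrace] at hder
  have hdT : ∀ δ, fderiv ℝ (fun y => g (X y) k (fderiv ℝ X y (ε δ))) z τ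
      = g (X z) q (fderiv ℝ X z (ε δ)) + g (X z) k (cov Γ X (ε δ) (fun y => fderiv ℝ X y τ) z) :=
    fun δ => by rw [fderiv_metric hLCz hXd (differentiableAt_const k) (hed δ), hcomm]
  have hdS : ∀ α β, fderiv ℝ (fun y => g (X y) k (secondForm Γ X ε α β y)) z τ
      = g (X z) q (secondForm Γ X ε α β z)
        + g (X z) k (cov Γ X (ε α) (cov Γ X (ε β) fun y => fderiv ℝ X y τ) z
        + curv Γ (X z) (fderiv ℝ X z τ) (fderiv ℝ X z (ε α)) (fderiv ℝ X z (ε β))) :=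
    fun α β => by rw [fderiv_metric hLCz hXd (differentiableAt_const k) (hDd α β), hcomm2]
  have hF := (HasFDerivAt.fun_sum (u := Finset.univ) fun α _ => HasFDerivAt.fun_sum
      (u := Finset.univ) fun β _ => (hid α β).hasFDerivAt.fun_mul (hS α β).hasFDerivAt).fun_sub
    (HasFDerivAt.fun_sum (u := Finset.univ) fun δ _ =>
      (hcd δ).hasFDerivAt.fun_mul (hT δ).hasFDerivAt)
  rw [hF.fderiv] at hder
  simp only [sub_apply, sum_apply, add_apply, smul_apply, smul_eq_mul, hk, hdT, hdS, zero_mul,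
    add_zero] at hder
  have hq0 := hext q
  rw [metric_frameTrace] at hq0
  have hdi : ∑ α, ∑ β, g (X z) k (secondForm Γ X ε α β z)
        * fderiv ℝ (fun y => (firstForm g X ε y)⁻¹ α β) z τ
      = 2 * ∑ α, ∑ β, ∑ γ, ∑ δ, hi α γ * hi β δ
        * g (X z) (fderiv ℝ X z τ) (secondForm Γ X ε α β z)
        * g (X z) k (secondForm Γ X ε γ δ z) := by
    have h1 := fun α β => fderiv_matrix_inv (fun α β => (contDiffAt_firstForm (ε := ε) hg hX α β
      ).of_le one_le_infty) hdet τ α β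
    simp only [h1, hdh, ← hhi]
    exact sum_contract_symm (fun α β => firstForm_inv_symm hLCz α β) _ _
  simp only [mul_add, Finset.sum_add_distrib, map_add] at hder hq0
  unfold jacobi
  simp only [mul_add, Finset.sum_add_distrib, ← hhi]
  linarith

end Jacobi

/-! ### Adapted frames in codimension two -/

section Frame

variable {E : Type*} [NormedAddCommGroup E] [NormedSpace ℝ E] {n : ℕ}

/-- `e` spans a nondegenerate subspace for the symmetric form `B`, and `κ`, `ξ` span a complement
orthogonal to it, with `κ` null. -/
structure IsAdaptedFrame (B : E →L[ℝ] E →L[ℝ] ℝ) (e : Fin n → E) (κ ξ : E) : Prop where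
  symm : ∀ a b, B a b = B b a
  det_ne_zero : (Matrix.of fun α β => B (e α) (e β)).det ≠ 0
  normal_left : ∀ α, B κ (e α) = 0
  normal_right : ∀ α, B ξ (e α) = 0
  null : B κ κ = 0
  pairing_ne_zero : B ξ κ ≠ 0

variable {B : E →L[ℝ] E →L[ℝ] ℝ} {e : Fin n → E} {κ ξ : E}

/-- The coefficients of a combination of the vectors of an adapted frame. -/
lemma IsAdaptedFrame.coef_eq (hf : IsAdaptedFrame B e κ ξ) (c : Fin n → ℝ) (p q : ℝ) {V : E}
    (hV : V = ∑ α, c α • e α + p • κ + q • ξ) :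
    (∀ α, c α = ∑ β, (Matrix.of fun α β => B (e α) (e β))⁻¹ α β * B V (e β)) ∧
      q = B V κ / B ξ κ ∧ p = (B V ξ - B V κ / B ξ κ * B ξ ξ) / B ξ κ := by
  set h : Matrix (Fin n) (Fin n) ℝ := Matrix.of fun α β => B (e α) (e β) with hh
  have hu : IsUnit h.det := isUnit_iff_ne_zero.mpr hf.det_ne_zero
  have h1 : ∀ β, B V (e β) = ∑ α, h β α * c α := fun β => by
    simp only [hV, map_add, map_sum, map_smul, add_apply, sum_apply, smul_apply, smul_eq_mul,
      hf.normal_left, hf.normal_right, mul_zero, add_zero]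
    exact Finset.sum_congr rfl fun α _ => by rw [hf.symm (e α), mul_comm]; rfl
  have h2 : B V κ = q * B ξ κ := by
    simp only [hV, map_add, map_sum, map_smul, add_apply, sum_apply, smul_apply, smul_eq_mul,
      fun α => hf.symm (e α) κ, hf.normal_left, hf.null, mul_zero, add_zero,
      Finset.sum_const_zero, zero_add]
  have h3 : B V ξ = p * B ξ κ + q * B ξ ξ := by
    simp only [hV, map_add, map_sum, map_smul, add_apply, sum_apply, smul_apply, smul_eq_mul,
      fun α => hf.symm (e α) ξ, hf.normal_right, mul_zero,
      Finset.sum_const_zero, zero_add, hf.symm κ ξ]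
  have hq : q = B V κ / B ξ κ := by rw [h2]; field_simp [hf.pairing_ne_zero]
  refine ⟨fun α => ?_, hq, ?_⟩
  · have : c = h⁻¹.mulVec (fun β => B V (e β)) := by
      rw [show (fun β => B V (e β)) = h.mulVec c from funext h1, Matrix.mulVec_mulVec,
        Matrix.nonsing_inv_mul _ hu, Matrix.one_mulVec]
    exact congrFun this α
  · rw [← hq, h3]; field_simp [hf.pairing_ne_zero]; ring

lemma IsAdaptedFrame.linearIndependent (hf : IsAdaptedFrame B e κ ξ) :
    LinearIndependent ℝ (Sum.elim e ![κ, ξ]) := by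
  rw [Fintype.linearIndependent_iff]
  intro c hc
  rw [Fintype.sum_sum_type, Fin.sum_univ_two] at hc
  simp only [Sum.elim_inl, Sum.elim_inr, Matrix.cons_val_zero, Matrix.cons_val_one] at hc
  obtain ⟨h1, h2, h3⟩ := hf.coef_eq (fun α => c (Sum.inl α)) (c (Sum.inr 0)) (c (Sum.inr 1))
    (V := 0) (by rw [← hc]; abel)
  simp only [map_zero, zero_apply, mul_zero, Finset.sum_const_zero, zero_div, zero_mul,
    sub_zero] at h1 h2 h3
  rintro (α | i)
  · exact h1 α
  · fin_cases i
    · exact h3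
    · exact h2

/-- The basis of the whole space formed by an adapted frame. -/
def IsAdaptedFrame.basis [FiniteDimensional ℝ E] (hf : IsAdaptedFrame B e κ ξ)
    (hdim : Module.finrank ℝ E = n + 2) : Module.Basis (Fin n ⊕ Fin 2) ℝ E :=
  basisOfLinearIndependentOfCardEqFinrank hf.linearIndependent (by simp [hdim])

lemma IsAdaptedFrame.exists_coef [FiniteDimensional ℝ E] (hf : IsAdaptedFrame B e κ ξ)
    (hdim : Module.finrank ℝ E = n + 2) (V : E) :
    V = ∑ α, (hf.basis hdim).repr V (Sum.inl α) • e α + (hf.basis hdim).repr V (Sum.inr 0) • κ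
      + (hf.basis hdim).repr V (Sum.inr 1) • ξ := by
  conv_lhs => rw [← (hf.basis hdim).sum_repr V]
  rw [Fintype.sum_sum_type, Fin.sum_univ_two]
  simp [IsAdaptedFrame.basis, add_assoc]

lemma IsAdaptedFrame.trace_eq [FiniteDimensional ℝ E] (hf : IsAdaptedFrame B e κ ξ)
    (hdim : Module.finrank ℝ E = n + 2) (T : E →ₗ[ℝ] E) :
    LinearMap.trace ℝ E T
      = ∑ α, ∑ β, (Matrix.of fun α β => B (e α) (e β))⁻¹ α β * B (T (e α)) (e β)
        + (B (T κ) ξ - B (T κ) κ / B ξ κ * B ξ ξ) / B ξ κ + B (T ξ) κ / B ξ κ := by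
  have hb : ∀ α, hf.basis hdim (Sum.inl α) = e α := fun α => by simp [IsAdaptedFrame.basis]
  have hb0 : hf.basis hdim (Sum.inr 0) = κ := by simp [IsAdaptedFrame.basis]
  have hb1 : hf.basis hdim (Sum.inr 1) = ξ := by simp [IsAdaptedFrame.basis]
  rw [LinearMap.trace_eq_matrix_trace ℝ (hf.basis hdim), Matrix.trace]
  simp only [Matrix.diag_apply, LinearMap.toMatrix_apply]
  rw [Fintype.sum_sum_type, Fin.sum_univ_two]
  simp only [hb, hb0, hb1]
  have h := fun V => hf.coef_eq _ _ _ (hf.exists_coef hdim V)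
  rw [(h (T κ)).2.2, (h (T ξ)).2.1, Finset.sum_congr rfl fun α _ => (h (T (e α))).1 α]
  ring

/-- On vectors orthogonal to `κ`, the form is computed by the components along `e`. -/
lemma IsAdaptedFrame.apply_eq [FiniteDimensional ℝ E] (hf : IsAdaptedFrame B e κ ξ)
    (hdim : Module.finrank ℝ E = n + 2) {V W : E} (hV : B V κ = 0) (hW : B W κ = 0) :
    B V W = ∑ α, ∑ β, (Matrix.of fun α β => B (e α) (e β))⁻¹ α β * B W (e β) * B V (e α) := by
  obtain ⟨h1, h2, -⟩ := hf.coef_eq _ _ _ (hf.exists_coef hdim W)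
  rw [hW, zero_div] at h2
  conv_lhs => rw [hf.exists_coef hdim W, h2]
  simp only [map_add, map_sum, map_smul, smul_eq_mul, hV, mul_zero, add_zero, zero_smul, h1,
    Finset.sum_mul]

/-- A vector normal to `e` is a combination of `κ` and `ξ`. -/
lemma IsAdaptedFrame.normal_eq [FiniteDimensional ℝ E] (hf : IsAdaptedFrame B e κ ξ)
    (hdim : Module.finrank ℝ E = n + 2) {V : E} (hV : ∀ α, B V (e α) = 0) :
    V = ((B V ξ - B V κ / B ξ κ * B ξ ξ) / B ξ κ) • κ + (B V κ / B ξ κ) • ξ := by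
  obtain ⟨h1, h2, h3⟩ := hf.coef_eq _ _ _ (hf.exists_coef hdim V)
  have h4 := hf.exists_coef hdim V
  simp only [hV, mul_zero, Finset.sum_const_zero] at h1
  rw [h3, h2] at h4
  simpa [h1] using h4

end Frame

/-! ### Properties of the Jacobi operator -/

section JacobiProperties

variable {E : Type*} [NormedAddCommGroup E] [NormedSpace ℝ E]
  {Z : Type*} [NormedAddCommGroup Z] [NormedSpace ℝ Z]
  {P : Type*} [NormedAddCommGroup P] [NormedSpace ℝ P] {n : ℕ}

set_option synthInstance.maxHeartbeats 200000

variable {g : E → E →L[ℝ] E →L[ℝ] ℝ} {Γ : E → E →L[ℝ] E →L[ℝ] E} {X ξ ξ' : Z → E} {ε : Fin n → Z}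
  {z : Z} {k : E}

lemma cov_cov_congr (h : ξ =ᶠ[𝓝 z] ξ') (a b : Z) :
    cov Γ X a (cov Γ X b ξ) z = cov Γ X a (cov Γ X b ξ') z := by
  apply cov_congr
  filter_upwards [h.eventuallyEq_nhds] with y hy using cov_congr hy b

lemma jacobi_congr (h : ξ =ᶠ[𝓝 z] ξ') : jacobi g Γ X ε k ξ z = jacobi g Γ X ε k ξ' z := by
  simp only [jacobi, cov_cov_congr h, cov_congr h, h.eq_of_nhds]

lemma jacobi_add (hΓ : ContDiffAt ℝ ∞ Γ (X z)) (hX : ContDiffAt ℝ ∞ X z)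
    (hξ : ContDiffAt ℝ ∞ ξ z) (hξ' : ContDiffAt ℝ ∞ ξ' z) :
    jacobi g Γ X ε k (fun y => ξ y + ξ' y) z = jacobi g Γ X ε k ξ z + jacobi g Γ X ε k ξ' z := by
  have h2 : ∀ a b, cov Γ X a (cov Γ X b fun y => ξ y + ξ' y) z
      = cov Γ X a (cov Γ X b ξ) z + cov Γ X a (cov Γ X b ξ') z := fun a b => by
    rw [← cov_add (differentiableAt_of_infty (contDiffAt_cov hΓ hX hξ b))
      (differentiableAt_of_infty (contDiffAt_cov hΓ hX hξ' b))]
    apply cov_congr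
    filter_upwards [eventually_differentiableAt hξ, eventually_differentiableAt hξ'] with y h h'
    exact cov_add h h' b
  simp only [jacobi, h2, cov_add (differentiableAt_of_infty hξ) (differentiableAt_of_infty hξ'),
    curv_add_left, map_add, add_apply, mul_add, add_mul, Finset.sum_add_distrib]
  ring

/-- The product rule: `k · J(fξ) - f k · J(ξ)` is a second-order operator without zeroth-order
term applied to `f`. -/
lemma jacobi_smul (hΓ : ContDiffAt ℝ ∞ Γ (X z)) (hX : ContDiffAt ℝ ∞ X z)
    (hξ : ContDiffAt ℝ ∞ ξ z) {f : Z → ℝ} (hf : ContDiffAt ℝ ∞ f z) :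
    jacobi g Γ X ε k (fun y => f y • ξ y) z = f z * jacobi g Γ X ε k ξ z
      + ∑ α, ∑ β, (firstForm g X ε z)⁻¹ α β *
          (fderiv ℝ (fun y => fderiv ℝ f y (ε β)) z (ε α) * g (X z) k (ξ z)
            + fderiv ℝ f z (ε β) * g (X z) k (cov Γ X (ε α) ξ z)
            + fderiv ℝ f z (ε α) * g (X z) k (cov Γ X (ε β) ξ z))
      - ∑ δ, tangentCoef g Γ X ε δ z * (fderiv ℝ f z (ε δ) * g (X z) k (ξ z)) := by
  have h2 : ∀ a b, cov Γ X a (cov Γ X b fun y => f y • ξ y) z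
      = fderiv ℝ (fun y => fderiv ℝ f y b) z a • ξ z + fderiv ℝ f z b • cov Γ X a ξ z
        + (fderiv ℝ f z a • cov Γ X b ξ z + f z • cov Γ X a (cov Γ X b ξ) z) := fun a b => by
    have hc := contDiffAt_cov hΓ hX hξ b
    have hfb := contDiffAt_fderiv_apply hf b
    rw [← cov_smul (differentiableAt_of_infty hfb) (differentiableAt_of_infty hξ),
      ← cov_smul (differentiableAt_of_infty hf) (differentiableAt_of_infty hc),
      ← cov_add (V := fun y => fderiv ℝ f y b • ξ y) (W := fun y => f y • cov Γ X b ξ y)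
        (differentiableAt_of_infty (hfb.smul hξ)) (differentiableAt_of_infty (hf.smul hc))]
    apply cov_congr
    filter_upwards [eventually_differentiableAt hξ, eventually_differentiableAt hf] with y h h'
    exact cov_smul h' h b
  simp only [jacobi, h2, cov_smul (differentiableAt_of_infty hf) (differentiableAt_of_infty hξ),
    curv_smul_left, map_add, map_smul, smul_apply, smul_eq_mul]
  have e1 : ∀ α β γ δ, (firstForm g X ε z)⁻¹ α γ * (firstForm g X ε z)⁻¹ β δ
      * (f z * g (X z) (ξ z) (secondForm Γ X ε α β z)) * g (X z) k (secondForm Γ X ε γ δ z)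
      = f z * ((firstForm g X ε z)⁻¹ α γ * (firstForm g X ε z)⁻¹ β δ
      * g (X z) (ξ z) (secondForm Γ X ε α β z) * g (X z) k (secondForm Γ X ε γ δ z)) :=
    fun α β γ δ => by ring
  simp only [e1, ← Finset.mul_sum]
  rw [show ∀ A B C D E F H : ℝ, A = f z * D + E → C = H + f z * F →
      A + 2 * (f z * B) - C = f z * (D + 2 * B - F) + E - H from
    fun A B C D E F H h1 h2 => by rw [h1, h2]; ring]
  · rw [Finset.mul_sum, ← Finset.sum_add_distrib]
    refine Finset.sum_congr rfl fun α _ => ?_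
    rw [Finset.mul_sum, ← Finset.sum_add_distrib]
    exact Finset.sum_congr rfl fun β _ => by ring
  · rw [Finset.mul_sum, ← Finset.sum_add_distrib]
    exact Finset.sum_congr rfl fun δ _ => by ring

lemma eventually_fderiv_comp {ι : P → Z} {L : P →L[ℝ] Z} (hι : ∀ u, HasFDerivAt ι L u) {u : P}
    (hX : ContDiffAt ℝ ∞ X (ι u)) (a : P) :
    ∀ᶠ y in 𝓝 u, fderiv ℝ (fun y => X (ι y)) y a = fderiv ℝ X (ι y) (L a) := by
  filter_upwards [(hι u).continuousAt.eventually (eventually_differentiableAt hX)] with y hy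
  rw [show (fun y => X (ι y)) = X ∘ ι from rfl, (hy.hasFDerivAt.comp y (hι y)).fderiv]
  rfl

lemma firstForm_comp {ι : P → Z} {L : P →L[ℝ] Z} (hι : ∀ u, HasFDerivAt ι L u) {u : P}
    {ε : Fin n → P} (hX : ContDiffAt ℝ ∞ X (ι u)) :
    firstForm g (fun y => X (ι y)) ε u = firstForm g X (fun α => L (ε α)) (ι u) := by
  ext α β
  simp only [firstForm, (eventually_fderiv_comp hι hX _).self_of_nhds]

lemma secondForm_comp {ι : P → Z} {L : P →L[ℝ] Z} (hι : ∀ u, HasFDerivAt ι L u) {u : P}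
    {ε : Fin n → P} (hX : ContDiffAt ℝ ∞ X (ι u)) (α β : Fin n) :
    secondForm Γ (fun y => X (ι y)) ε α β u = secondForm Γ X (fun α => L (ε α)) α β (ι u) := by
  rw [secondForm, cov_congr (eventually_fderiv_comp hι hX (ε β)),
    cov_comp (V := fun y => fderiv ℝ X y (L (ε β))) (hι u).differentiableAt
      (differentiableAt_of_infty hX) (differentiableAt_of_infty (contDiffAt_fderiv_apply hX _)),
    (hι u).fderiv]
  rfl

lemma frameTrace_comp {ι : P → Z} {L : P →L[ℝ] Z} (hι : ∀ u, HasFDerivAt ι L u) {u : P}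
    {ε : Fin n → P} (hX : ContDiffAt ℝ ∞ X (ι u)) :
    frameTrace g Γ (fun y => X (ι y)) ε u = frameTrace g Γ X (fun α => L (ε α)) (ι u) := by
  simp only [frameTrace, firstForm_comp hι hX, secondForm_comp hι hX]

/-- Restriction of the Jacobi operator to an affine subspace of the parameter space. -/
lemma jacobi_comp {ι : P → Z} {L : P →L[ℝ] Z} (hι : ∀ u, HasFDerivAt ι L u) {u : P}
    {ε : Fin n → P} (hΓ : ContDiffAt ℝ ∞ Γ (X (ι u))) (hX : ContDiffAt ℝ ∞ X (ι u))
    (hξ : ContDiffAt ℝ ∞ ξ (ι u)) :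
    jacobi g Γ (fun y => X (ι y)) ε k (fun y => ξ (ι y)) u
      = jacobi g Γ X (fun α => L (ε α)) k ξ (ι u) := by
  have hιc : ContinuousAt ι u := (hι u).continuousAt
  have hcov : ∀ a (V : Z → E), DifferentiableAt ℝ V (ι u) →
      cov Γ (fun y => X (ι y)) a (fun y => V (ι y)) u = cov Γ X (L a) V (ι u) := fun a V hV => by
    rw [cov_comp (hι u).differentiableAt (differentiableAt_of_infty hX) hV, (hι u).fderiv]
  have hcov2 : ∀ a b, cov Γ (fun y => X (ι y)) a (cov Γ (fun y => X (ι y)) b fun y => ξ (ι y)) u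
      = cov Γ X (L a) (cov Γ X (L b) ξ) (ι u) := fun a b => by
    rw [← hcov _ _ (differentiableAt_of_infty (contDiffAt_cov hΓ hX hξ (L b)))]
    apply cov_congr
    filter_upwards [hιc.eventually (eventually_differentiableAt hX),
      hιc.eventually (eventually_differentiableAt hξ)] with y h1 h2
    rw [cov_comp (hι y).differentiableAt h1 h2, (hι y).fderiv]
  simp only [jacobi, tangentCoef, frameTrace_comp hι hX, firstForm_comp hι hX,
    secondForm_comp hι hX, hcov2, (eventually_fderiv_comp hι hX _).self_of_nhds,
    hcov _ ξ (differentiableAt_of_infty hξ)]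

lemma eventually_metric_cov_null (hX : ContDiffAt ℝ ∞ X z)
    (hLC : ∀ᶠ y in 𝓝 (X z), IsLeviCivitaAt g Γ y) {κ : Z → E} (hκ : ContDiffAt ℝ ∞ κ z)
    (hnull : ∀ᶠ y in 𝓝 z, g (X y) (κ y) (κ y) = 0) (b : Z) :
    ∀ᶠ y in 𝓝 z, g (X y) (κ y) (cov Γ X b κ y) = 0 := by
  have hLCX : ∀ᶠ y in 𝓝 z, IsLeviCivitaAt g Γ (X y) := hX.continuousAt.eventually hLC
  filter_upwards [hLCX, hnull.eventually_nhds, eventually_differentiableAt hX,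
    eventually_differentiableAt hκ] with y hy1 hy2 hy3 hy4
  have h := fderiv_metric hy1 hy3 hy4 hy4 b
  have h0 : fderiv ℝ (fun y => g (X y) (κ y) (κ y)) y b = 0 := by
    have : (fun y => g (X y) (κ y) (κ y)) =ᶠ[𝓝 y] fun _ => 0 := hy2
    rw [this.fderiv_eq]; simp
  rw [h0, hy1.metric_symm (cov Γ X b κ y)] at h
  linarith

/-- The focusing term `Ric(k, k) + k^a k^b K_{acd} K_b^{cd}` of the map `X` along `k`. -/
def focusing (g : E → E →L[ℝ] E →L[ℝ] ℝ) (Γ : E → E →L[ℝ] E →L[ℝ] E) (X : Z → E) (ε : Fin n → Z)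
    (k : E) (z : Z) : ℝ :=
  LinearMap.trace ℝ E (ricciEndo Γ (X z) k)
    + ∑ α, ∑ β, ∑ γ, ∑ δ, (firstForm g X ε z)⁻¹ α γ * (firstForm g X ε z)⁻¹ β δ
      * g (X z) k (secondForm Γ X ε α β z) * g (X z) k (secondForm Γ X ε γ δ z)

/-- On a null normal field `κ` of a surface of codimension two, the component along `κ` of the
Jacobi operator is the focusing term. -/
theorem jacobi_null [FiniteDimensional ℝ E] (hdim : Module.finrank ℝ E = n + 2)
    (hg : ContDiffAt ℝ ∞ g (X z)) (hΓ : ContDiffAt ℝ ∞ Γ (X z)) (hX : ContDiffAt ℝ ∞ X z)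
    (hLC : ∀ᶠ y in 𝓝 (X z), IsLeviCivitaAt g Γ y) {κ : Z → E} (hκ : ContDiffAt ℝ ∞ κ z)
    {l : E} (hf : IsAdaptedFrame (g (X z)) (fun α => fderiv ℝ X z (ε α)) (κ z) l)
    (hnull : ∀ᶠ y in 𝓝 z, g (X y) (κ y) (κ y) = 0)
    (hnormal : ∀ α, ∀ᶠ y in 𝓝 z, g (X y) (κ y) (fderiv ℝ X y (ε α)) = 0) :
    jacobi g Γ X ε (κ z) κ z = focusing g Γ X ε (κ z) z := by
  have hLCz := hLC.self_of_nhds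
  have hXd := differentiableAt_of_infty hX
  have hκd := differentiableAt_of_infty hκ
  -- derivatives of `g(κ, κ) = 0` and `g(κ, e_α) = 0`
  have h1 := eventually_metric_cov_null hX hLC hκ hnull
  have h2 : ∀ a b, g (X z) (κ z) (cov Γ X a (cov Γ X b κ) z)
      = - g (X z) (cov Γ X a κ z) (cov Γ X b κ z) := fun a b => by
    have h := fderiv_metric hLCz hXd hκd
      (differentiableAt_of_infty (contDiffAt_cov hΓ hX hκ b)) a
    have h0 : fderiv ℝ (fun y => g (X y) (κ y) (cov Γ X b κ y)) z a = 0 := by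
      have : (fun y => g (X y) (κ y) (cov Γ X b κ y)) =ᶠ[𝓝 z] fun _ => 0 := h1 b
      rw [this.fderiv_eq]; simp
    rw [h0] at h
    linarith
  have h3 : ∀ α β, g (X z) (cov Γ X (ε α) κ z) (fderiv ℝ X z (ε β))
      = - g (X z) (κ z) (secondForm Γ X ε α β z) := fun α β => by
    have h := fderiv_metric hLCz hXd hκd
      (differentiableAt_of_infty (contDiffAt_fderiv_apply hX (ε β))) (ε α)
    have h0 : fderiv ℝ (fun y => g (X y) (κ y) (fderiv ℝ X y (ε β))) z (ε α) = 0 := by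
      have : (fun y => g (X y) (κ y) (fderiv ℝ X y (ε β))) =ᶠ[𝓝 z] fun _ => 0 := hnormal β
      rw [this.fderiv_eq]; simp
    rw [h0] at h
    simp only [secondForm]
    linarith
  have h4 : ∀ α, g (X z) (cov Γ X (ε α) κ z) (κ z) = 0 := fun α => by
    rw [hLCz.metric_symm]; exact (h1 (ε α)).self_of_nhds
  set hi := (firstForm g X ε z)⁻¹ with hhi
  have hof : (Matrix.of fun α β => g (X z) (fderiv ℝ X z (ε α)) (fderiv ℝ X z (ε β)))⁻¹ = hi := rfl
  have h5 : ∀ α β, g (X z) (cov Γ X (ε α) κ z) (cov Γ X (ε β) κ z)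
      = ∑ γ, ∑ δ, hi γ δ * g (X z) (κ z) (secondForm Γ X ε β δ z)
        * g (X z) (κ z) (secondForm Γ X ε α γ z) := fun α β => by
    rw [hf.apply_eq hdim (h4 α) (h4 β)]
    simp only [hof, h3, mul_neg, neg_mul, neg_neg]
  -- the Ricci term
  have h6 : LinearMap.trace ℝ E (ricciEndo Γ (X z) (κ z))
      = ∑ α, ∑ β, hi α β *
        g (X z) (κ z) (curv Γ (X z) (κ z) (fderiv ℝ X z (ε α)) (fderiv ℝ X z (ε β))) := by
    rw [hf.trace_eq hdim]
    have ha := fun a b c e => metric_curv_antisymm hg hΓ hLC a b c e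
    have e1 : ricciEndo Γ (X z) (κ z) (κ z) = 0 := by
      change curv Γ (X z) (κ z) (κ z) (κ z) = 0
      simp [curv]
    have e2 : g (X z) (ricciEndo Γ (X z) (κ z) l) (κ z) = 0 := by
      have := ha l (κ z) (κ z) (κ z)
      rw [hLCz.metric_symm (κ z)] at this
      change g (X z) (curv Γ (X z) l (κ z) (κ z)) (κ z) = 0
      linarith
    rw [e1, e2]
    simp only [map_zero, zero_apply, zero_div, zero_mul, sub_zero, add_zero, hof]
    refine Finset.sum_congr rfl fun α _ => Finset.sum_congr rfl fun β _ => ?_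
    congr 1
    have := ha (fderiv ℝ X z (ε α)) (κ z) (κ z) (fderiv ℝ X z (ε β))
    rw [curv_swap (X z) (κ z), map_neg]
    change g (X z) (curv Γ (X z) (fderiv ℝ X z (ε α)) (κ z) (κ z)) _ = _
    linarith
  rw [focusing, h6]
  simp only [jacobi, h2, h5, (h1 _).self_of_nhds, mul_zero, Finset.sum_const_zero, sub_zero,
    ← hhi, mul_add, Finset.sum_add_distrib]
  have h7 : ∑ α, ∑ β, hi α β * -∑ γ, ∑ δ, hi γ δ * g (X z) (κ z) (secondForm Γ X ε β δ z)
        * g (X z) (κ z) (secondForm Γ X ε α γ z)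
      = - ∑ α, ∑ β, ∑ γ, ∑ δ, hi α γ * hi β δ
        * g (X z) (κ z) (secondForm Γ X ε α β z) * g (X z) (κ z) (secondForm Γ X ε γ δ z) := by
    simp only [Finset.mul_sum, mul_neg, Finset.sum_neg_distrib]
    congr 1
    refine Finset.sum_congr rfl fun α _ => ?_
    rw [Finset.sum_comm]
    refine Finset.sum_congr rfl fun γ _ => Finset.sum_congr rfl fun β _ =>
      Finset.sum_congr rfl fun δ _ => ?_
    ring
  rw [h7]
  ring

end JacobiProperties

/-! ### The equation relating two deviations -/

section LocalEquation

variable {E : Type*} [NormedAddCommGroup E] [NormedSpace ℝ E]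
  {P : Type*} [NormedAddCommGroup P] [NormedSpace ℝ P] {n : ℕ}

set_option synthInstance.maxHeartbeats 200000

variable {g : E → E →L[ℝ] E →L[ℝ] ℝ} {Γ : E → E →L[ℝ] E →L[ℝ] E}

lemma hasFDerivAt_slice (l : ℝ) (u : P) :
    HasFDerivAt (fun y : P => (l, y)) (ContinuousLinearMap.inr ℝ ℝ P) u :=
  hasFDerivAt_prodMk_right l u

/-- If the mean curvature vanishes, then `frameTrace` is tangential. -/
lemma metric_frameTrace_eq_of_extremal {X : P → E} {ε : Fin n → P} {u : P}
    (hLC : IsLeviCivitaAt g Γ (X u)) (hdet : (firstForm g X ε u).det ≠ 0)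
    (hext : ∀ N : E, (∀ δ, g (X u) N (fderiv ℝ X u (ε δ)) = 0) →
      g (X u) N (frameTrace g Γ X ε u) = 0) (Y : E) :
    g (X u) Y (frameTrace g Γ X ε u)
      = ∑ δ, tangentCoef g Γ X ε δ u * g (X u) Y (fderiv ℝ X u (ε δ)) := by
  set h := firstForm g X ε u with hh
  have hu : IsUnit h.det := isUnit_iff_ne_zero.mpr hdet
  -- subtract from `Y` its tangential part
  set y : Fin n → ℝ := fun δ => g (X u) Y (fderiv ℝ X u (ε δ)) with hy
  have h1 := hext (Y - ∑ γ, (h⁻¹.mulVec y) γ • fderiv ℝ X u (ε γ)) fun δ => by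
    simp only [map_sub, map_sum, map_smul, sub_apply, sum_apply, smul_apply, smul_eq_mul]
    have : (h.mulVec (h⁻¹.mulVec y)) δ = y δ := by
      rw [Matrix.mulVec_mulVec, Matrix.mul_nonsing_inv _ hu, Matrix.one_mulVec]
    rw [sub_eq_zero, ← show y δ = g (X u) Y (fderiv ℝ X u (ε δ)) from rfl, ← this]
    simp only [Matrix.mulVec, dotProduct, hh]
    exact Finset.sum_congr rfl fun γ _ => by rw [firstForm_symm hLC δ γ, mul_comm]; rfl
  simp only [map_sub, map_sum, map_smul, sub_apply, sum_apply, smul_apply, smul_eq_mul,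
    sub_eq_zero] at h1
  rw [h1]
  simp only [Matrix.mulVec, dotProduct, tangentCoef, Finset.sum_mul, ← hh]
  rw [Finset.sum_comm]
  refine Finset.sum_congr rfl fun δ _ => Finset.sum_congr rfl fun γ _ => ?_
  simp only [hy]
  ring

/-- The deviation vector field of a one-parameter family `F` of extremal surfaces solves the Jacobi
equation. -/
lemma jacobi_family_eq_zero {F : ℝ × P → E} {ε : Fin n → P} {u : P}
    (hg : ContDiffAt ℝ ∞ g (F (0, u))) (hΓ : ContDiffAt ℝ ∞ Γ (F (0, u)))
    (hLC : ∀ᶠ y in 𝓝 (F (0, u)), IsLeviCivitaAt g Γ y)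
    (hF : ∀ᶠ l in 𝓝 (0 : ℝ), ContDiffAt ℝ ∞ F (l, u))
    (hdet : (firstForm g (fun y => F (0, y)) ε u).det ≠ 0)
    (hext : ∀ᶠ l in 𝓝 (0 : ℝ), ∀ N : E,
      (∀ δ, g (F (l, u)) N (fderiv ℝ (fun y => F (l, y)) u (ε δ)) = 0) →
      g (F (l, u)) N (frameTrace g Γ (fun y => F (l, y)) ε u) = 0)
    (hnormal : ∀ δ, ∀ᶠ y in 𝓝 u, g (F (0, y)) (fderiv ℝ F (0, y) (1, 0))
      (fderiv ℝ (fun y => F (0, y)) y (ε δ)) = 0)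
    {k : E} (hk : ∀ δ, g (F (0, u)) k (fderiv ℝ (fun y => F (0, y)) u (ε δ)) = 0) :
    jacobi g Γ (fun y => F (0, y)) ε k (fun y => fderiv ℝ F (0, y) (1, 0)) u = 0 := by
  have hF0 := hF.self_of_nhds
  have hsl := fun l : ℝ => hasFDerivAt_slice (P := P) l
  rw [jacobi_comp (ξ := fun p => fderiv ℝ F p (1, 0)) (hsl 0) hΓ hF0
    (contDiffAt_fderiv_apply hF0 _)]
  rw [firstForm_comp (hsl 0) hF0] at hdet
  have hev := fun δ => eventually_fderiv_comp (hsl 0) hF0 (ε δ)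
  set ε' : Fin n → ℝ × P := fun α => ContinuousLinearMap.inr ℝ ℝ P (ε α) with hε'
  have hlc : ContinuousAt (fun l : ℝ => (l, u)) 0 := by fun_prop
  have hdetc : ContinuousAt (fun p => (firstForm g F ε' p).det) (0, u) :=
    (contDiffAt_det (contDiffAt_firstForm hg hF0)).continuousAt
  -- extremality of the whole family
  have hextF : ∀ᶠ l in 𝓝 (0 : ℝ), ∀ Y : E, g (F (l, u)) Y (frameTrace g Γ F ε' (l, u))
      = ∑ δ, tangentCoef g Γ F ε' δ (l, u) * g (F (l, u)) Y (fderiv ℝ F (l, u) (ε' δ)) := by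
    filter_upwards [hF, hext, hlc.eventually (hF0.continuousAt.eventually hLC),
      hlc.eventually (hdetc.eventually_ne hdet)] with l h1 h2 h3 h4 Y
    have := metric_frameTrace_eq_of_extremal (X := fun y => F (l, y)) (ε := ε) h3
      (by rw [firstForm_comp (hsl l) h1]; exact h4) h2 Y
    simp only [tangentCoef, frameTrace_comp (hsl l) h1, firstForm_comp (hsl l) h1,
      (eventually_fderiv_comp (hsl l) h1 _).self_of_nhds] at this
    exact this
  refine jacobi_deviation_eq_zero hg hΓ hF0 hLC hdet hextF.self_of_nhds ?_ ?_ ?_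
  · set f : ℝ × P → ℝ := fun y => g (F y) k (frameTrace g Γ F ε' y)
      - ∑ δ, tangentCoef g Γ F ε' δ y * g (F y) k (fderiv ℝ F y (ε' δ)) with hf
    have hfd : DifferentiableAt ℝ f (0, u) := by
      refine ContDiffAt.differentiableAt (n := ∞) (ContDiffAt.sub ?_ (ContDiffAt.sum fun δ _ =>
        (contDiffAt_tangentCoef hg hΓ hF0 hdet δ).mul ?_)) (by simp)
      · exact contDiffAt_metric hg hF0 contDiffAt_const (contDiffAt_frameTrace hg hΓ hF0 hdet)
      · exact contDiffAt_metric hg hF0 contDiffAt_const (contDiffAt_fderiv_apply hF0 _)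
    have h1 : HasFDerivAt (fun l : ℝ => (l, u)) (ContinuousLinearMap.inl ℝ ℝ P) 0 :=
      hasFDerivAt_prodMk_left 0 u
    have h2 : (fun l : ℝ => f (l, u)) =ᶠ[𝓝 0] fun _ => 0 := by
      filter_upwards [hextF] with l hl
      rw [hf]; exact sub_eq_zero.mpr (hl k)
    have h3 := congrArg (fun L => L (1 : ℝ)) ((hfd.hasFDerivAt.comp (0 : ℝ) h1).fderiv.symm.trans
      h2.fderiv_eq)
    simpa using h3
  · intro δ
    rw [← (hev δ).self_of_nhds]; exact hk δ
  · intro γ δ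
    set f : ℝ × P → ℝ := fun y => g (F y) (fderiv ℝ F y (1, 0)) (fderiv ℝ F y (ε' δ)) with hf
    have hfd : DifferentiableAt ℝ f (0, u) :=
      (contDiffAt_metric hg hF0 (contDiffAt_fderiv_apply hF0 _)
        (contDiffAt_fderiv_apply hF0 _)).differentiableAt (by simp)
    have h2 : (fun y : P => f (0, y)) =ᶠ[𝓝 u] fun _ => 0 := by
      filter_upwards [hnormal δ, hev δ] with y h1 h2
      have h3 : fderiv ℝ F (0, y) (ε' δ) = fderiv ℝ (fun y => F (0, y)) y (ε δ) := h2.symm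
      simp only [hf, h3]
      exact h1
    have h3 := congrArg (fun L => L (ε γ)) ((hfd.hasFDerivAt.comp u (hsl 0 u)).fderiv.symm.trans
      h2.fderiv_eq)
    simpa [hε'] using h3

/-- If two solutions `η₁`, `η₂` of the Jacobi equation are related by `η₂ = a κ + v η₁` with a null
normal field `κ`, then `a` times the focusing term of `κ` is minus a second-order operator without
zeroth-order term applied to `v`. -/
theorem focusing_eq_of_jacobi [FiniteDimensional ℝ E] (hdim : Module.finrank ℝ E = n + 2)
    {X : P → E} {ε : Fin n → P} {u : P}
    (hg : ContDiffAt ℝ ∞ g (X u)) (hΓ : ContDiffAt ℝ ∞ Γ (X u)) (hX : ContDiffAt ℝ ∞ X u)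
    (hLC : ∀ᶠ y in 𝓝 (X u), IsLeviCivitaAt g Γ y) {κ η₁ η₂ : P → E} (hκ : ContDiffAt ℝ ∞ κ u)
    (hη₁ : ContDiffAt ℝ ∞ η₁ u)
    (hf : IsAdaptedFrame (g (X u)) (fun α => fderiv ℝ X u (ε α)) (κ u) (η₁ u))
    (hnull : ∀ᶠ y in 𝓝 u, g (X y) (κ y) (κ y) = 0)
    (hnormal : ∀ α, ∀ᶠ y in 𝓝 u, g (X y) (κ y) (fderiv ℝ X y (ε α)) = 0)
    (h₁ : jacobi g Γ X ε (κ u) η₁ u = 0) (h₂ : jacobi g Γ X ε (κ u) η₂ u = 0)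
    {a v : P → ℝ} (ha : ContDiffAt ℝ ∞ a u) (hv : ContDiffAt ℝ ∞ v u)
    (hrel : ∀ᶠ y in 𝓝 u, η₂ y = a y • κ y + v y • η₁ y) :
    a u * focusing g Γ X ε (κ u) u
      + (∑ α, ∑ β, (firstForm g X ε u)⁻¹ α β * g (X u) (κ u) (η₁ u)
          * fderiv ℝ (fun y => fderiv ℝ v y (ε β)) u (ε α)
      + ∑ δ, (2 * ∑ α, (firstForm g X ε u)⁻¹ δ α * g (X u) (κ u) (cov Γ X (ε α) η₁ u)
        - tangentCoef g Γ X ε δ u * g (X u) (κ u) (η₁ u)) * fderiv ℝ v u (ε δ)) = 0 := by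
  have hrel' : η₂ =ᶠ[𝓝 u] fun y => a y • κ y + v y • η₁ y := hrel
  rw [jacobi_congr hrel', jacobi_add (ξ := fun y => a y • κ y) (ξ' := fun y => v y • η₁ y)
    hΓ hX (ha.smul hκ)
    (hv.smul hη₁), jacobi_smul hΓ hX hκ ha,
    jacobi_smul hΓ hX hη₁ hv, h₁, jacobi_null hdim hg hΓ hX hLC hκ hf hnull hnormal] at h₂
  simp only [hnull.self_of_nhds,
    (eventually_metric_cov_null hX hLC hκ hnull _).self_of_nhds, mul_zero, add_zero,
    Finset.sum_const_zero, sub_zero, zero_add] at h₂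
  rw [← h₂]
  congr 1
  simp only [mul_add, sub_mul, Finset.sum_add_distrib, Finset.sum_sub_distrib]
  have e1 : ∑ δ, (2 * ∑ α, (firstForm g X ε u)⁻¹ δ α * g (X u) (κ u) (cov Γ X (ε α) η₁ u))
        * fderiv ℝ v u (ε δ)
      = ∑ α, ∑ β, (firstForm g X ε u)⁻¹ α β
          * (fderiv ℝ v u (ε β) * g (X u) (κ u) (cov Γ X (ε α) η₁ u))
        + ∑ α, ∑ β, (firstForm g X ε u)⁻¹ α β
          * (fderiv ℝ v u (ε α) * g (X u) (κ u) (cov Γ X (ε β) η₁ u)) := by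
    rw [Finset.sum_comm (s := Finset.univ (α := Fin n)) (f := fun α β =>
      (firstForm g X ε u)⁻¹ α β * (fderiv ℝ v u (ε β) * g (X u) (κ u) (cov Γ X (ε α) η₁ u))),
      ← Finset.sum_add_distrib]
    refine Finset.sum_congr rfl fun δ _ => ?_
    rw [← Finset.sum_add_distrib, Finset.mul_sum, Finset.sum_mul]
    refine Finset.sum_congr rfl fun α _ => ?_
    rw [firstForm_inv_symm hLC.self_of_nhds α δ]
    ring
  have e2 : ∑ α, ∑ β, (firstForm g X ε u)⁻¹ α β * g (X u) (κ u) (η₁ u)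
          * fderiv ℝ (fun y => fderiv ℝ v y (ε β)) u (ε α)
      = ∑ α, ∑ β, (firstForm g X ε u)⁻¹ α β
          * (fderiv ℝ (fun y => fderiv ℝ v y (ε β)) u (ε α) * g (X u) (κ u) (η₁ u)) :=
    Finset.sum_congr rfl fun α _ => Finset.sum_congr rfl fun β _ => by ring
  have e3 : ∑ δ, tangentCoef g Γ X ε δ u * g (X u) (κ u) (η₁ u) * fderiv ℝ v u (ε δ)
      = ∑ δ, tangentCoef g Γ X ε δ u * (fderiv ℝ v u (ε δ) * g (X u) (κ u) (η₁ u)) :=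
    Finset.sum_congr rfl fun α _ => by ring
  rw [e1, e2, e3]
  ring

end LocalEquation

/-! ### Invariance under coordinate changes -/

lemma fderiv_comp_apply {Z F G : Type*} [NormedAddCommGroup Z] [NormedSpace ℝ Z]
    [NormedAddCommGroup F] [NormedSpace ℝ F] [NormedAddCommGroup G] [NormedSpace ℝ G]
    {f : F → G} {X : Z → F} {z : Z} (hf : DifferentiableAt ℝ f (X z)) (hX : DifferentiableAt ℝ X z)
    (a : Z) : fderiv ℝ (fun w => f (X w)) z a = fderiv ℝ f (X z) (fderiv ℝ X z a) := by
  rw [show (fun w => f (X w)) = f ∘ X from rfl, fderiv_comp z hf hX]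
  rfl

section Invariance

variable {E : Type*} [NormedAddCommGroup E] [NormedSpace ℝ E]
  {Z : Type*} [NormedAddCommGroup Z] [NormedSpace ℝ Z] {n : ℕ}

set_option synthInstance.maxHeartbeats 200000

variable {g g' : E → E →L[ℝ] E →L[ℝ] ℝ} {Γ Γ' : E → E →L[ℝ] E →L[ℝ] E} {φ : E → E}

/-- Near `x`, the local diffeomorphism `φ` is an isometry from the metric `g` to the nondegenerate
metric `g'`, with Christoffel forms `Γ` and `Γ'`. -/
structure IsCoordChange (g g' : E → E →L[ℝ] E →L[ℝ] ℝ) (Γ Γ' : E → E →L[ℝ] E →L[ℝ] E) (φ : E → E)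
    (x : E) : Prop where
  contDiffAt : ContDiffAt ℝ ∞ φ x
  bijective : ∀ᶠ y in 𝓝 x, Function.Bijective (fderiv ℝ φ y)
  isometry : ∀ᶠ y in 𝓝 x, ∀ a b, g' (φ y) (fderiv ℝ φ y a) (fderiv ℝ φ y b) = g y a b
  leviCivita : ∀ᶠ y in 𝓝 x, IsLeviCivitaAt g Γ y
  leviCivita' : ∀ᶠ y in 𝓝 (φ x), IsLeviCivitaAt g' Γ' y
  nondegenerate' : ∀ᶠ y in 𝓝 (φ x), ∀ a, (∀ b, g' y a b = 0) → a = 0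
  contDiffAt_christoffel : ContDiffAt ℝ ∞ Γ x
  contDiffAt_christoffel' : ContDiffAt ℝ ∞ Γ' (φ x)

/-- The transformation law of the Christoffel symbols, by uniqueness of the torsion-free metric
connection. -/
lemma IsCoordChange.cov_fderiv {x : E} (h : IsCoordChange g g' Γ Γ' φ x) : ∀ᶠ y in 𝓝 x, ∀ c a,
    cov Γ' φ c (fun y => fderiv ℝ φ y a) y = fderiv ℝ φ y (Γ y c a) := by
  have hc := h.contDiffAt.continuousAt
  filter_upwards [(h.contDiffAt.of_le two_le_infty).eventually (by simp), h.bijective,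
    h.isometry.eventually_nhds, h.leviCivita, hc.eventually h.leviCivita',
    hc.eventually h.nondegenerate'] with y h1 h2 h3 h4 h5 h6
  have hφd : DifferentiableAt ℝ φ y := h1.differentiableAt (by norm_num)
  have hφ2 : ∀ a, DifferentiableAt ℝ (fun y => fderiv ℝ φ y a) y := fun a =>
    ((h1.fderiv_right (m := 1) (by norm_num)).differentiableAt (by norm_num)).clm_apply
      (differentiableAt_const a)
  -- the difference of the two connections, lowered with the metric
  set T : E → E → E → ℝ := fun c a b =>
    g' (φ y) (cov Γ' φ c (fun y => fderiv ℝ φ y a) y - fderiv ℝ φ y (Γ y c a)) (fderiv ℝ φ y b)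
    with hT
  have hsymm : ∀ c a b, T c a b = T a c b := fun c a b => by
    simp only [hT]; rw [cov_fderiv_comm h5 h1 c a, h4.torsion_free]
  have hanti : ∀ c a b, T c a b = - T c b a := fun c a b => by
    have e1 := fderiv_metric h5 hφd (hφ2 a) (hφ2 b) c
    have e2 : (fun y => g' (φ y) (fderiv ℝ φ y a) (fderiv ℝ φ y b)) =ᶠ[𝓝 y] fun y => g y a b := by
      filter_upwards [h3] with w hw using hw a b
    have e3 : fderiv ℝ (fun y => g y a b) y c = fderiv ℝ g y c a b := by
      have := (h4.differentiableAt.hasFDerivAt.clm_apply (hasFDerivAt_const a y)).clm_apply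
        (hasFDerivAt_const b y)
      rw [this.fderiv]; simp
    rw [e2.fderiv_eq, e3, h4.compat, ← h3.self_of_nhds, ← h3.self_of_nhds] at e1
    simp only [hT, map_sub, sub_apply]
    have e4 := h5.metric_symm (fderiv ℝ φ y a) (cov Γ' φ c (fun y => fderiv ℝ φ y b) y)
    have e5 := h5.metric_symm (fderiv ℝ φ y a) (fderiv ℝ φ y (Γ y c b))
    linarith
  intro c a
  rw [← sub_eq_zero]
  refine h6 _ fun b' => ?_
  obtain ⟨b, rfl⟩ := h2.2 b'
  have e1 := hsymm c a b
  have e2 := hanti a c b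
  have e3 := hsymm a b c
  have e4 := hanti b a c
  have e5 := hsymm b c a
  have e6 := hanti c b a
  change T c a b = 0
  linarith

lemma IsCoordChange.cov_comp {x : E} (h : IsCoordChange g g' Γ Γ' φ x) : ∀ᶠ y in 𝓝 x,
    ∀ (X V : Z → E) (z : Z) (a : Z), X z = y → DifferentiableAt ℝ X z → DifferentiableAt ℝ V z →
      cov Γ' (fun w => φ (X w)) a (fun w => fderiv ℝ φ (X w) (V w)) z
        = fderiv ℝ φ (X z) (cov Γ X a V z) := by
  filter_upwards [h.cov_fderiv, (h.contDiffAt.of_le two_le_infty).eventually (by simp)]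
    with y h1 h2 X V z a hz hX hV
  subst hz
  have hφd : DifferentiableAt ℝ φ (X z) := h2.differentiableAt (by norm_num)
  have hφ2 : DifferentiableAt ℝ (fderiv ℝ φ) (X z) :=
    (h2.fderiv_right (m := 1) (by norm_num)).differentiableAt (by norm_num)
  have e1 : fderiv ℝ (fun w => φ (X w)) z a = fderiv ℝ φ (X z) (fderiv ℝ X z a) :=
    fderiv_comp_apply hφd hX a
  have e2 : fderiv ℝ (fun w => fderiv ℝ φ (X w) (V w)) z a
      = fderiv ℝ (fderiv ℝ φ) (X z) (fderiv ℝ X z a) (V z) + fderiv ℝ φ (X z) (fderiv ℝ V z a) := by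
    have e3 : HasFDerivAt (fun w => fderiv ℝ φ (X w)) _ z := hφ2.hasFDerivAt.comp z hX.hasFDerivAt
    rw [(e3.clm_apply hV.hasFDerivAt).fderiv]
    simp [add_comm]
  have e4 := h1 (fderiv ℝ X z a) (V z)
  have e5 : fderiv ℝ (fun y => fderiv ℝ φ y (V z)) (X z) (fderiv ℝ X z a)
      = fderiv ℝ (fderiv ℝ φ) (X z) (fderiv ℝ X z a) (V z) := by
    rw [fderiv_clm_apply hφ2 (by fun_prop)]; simp
  simp only [cov, e5] at e4
  simp only [cov, e1, e2, map_add, ← e4]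
  abel

lemma IsCoordChange.curv_eq {x : E} (h : IsCoordChange g g' Γ Γ' φ x) (a b c : E) :
    curv Γ' (φ x) (fderiv ℝ φ x a) (fderiv ℝ φ x b) (fderiv ℝ φ x c)
      = fderiv ℝ φ x (curv Γ x a b c) := by
  set X := plane x a b with hXdef
  have hX0 : X 0 = x := plane_zero x a b
  have hXs : ∀ p, ContDiffAt ℝ ∞ X p := fun p => (contDiff_plane x a b).contDiffAt
  have hφX : ContDiffAt ℝ ∞ (fun p => φ (X p)) 0 := by
    have := h.contDiffAt; rw [← hX0] at this; exact this.comp 0 (hXs 0)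
  have hdφ : ContDiffAt ℝ ∞ (fun p => fderiv ℝ φ (X p)) 0 := by
    have := contDiffAt_fderiv h.contDiffAt; rw [← hX0] at this; exact this.comp 0 (hXs 0)
  have hcc : ContDiffAt ℝ ∞ (fun _ : ℝ × ℝ => c) 0 := contDiffAt_const
  have hΓ : ContDiffAt ℝ ∞ Γ (X 0) := by rw [hX0]; exact h.contDiffAt_christoffel
  have hΓ' : ContDiffAt ℝ ∞ Γ' (φ (X 0)) := by rw [hX0]; exact h.contDiffAt_christoffel'
  have hXt : Filter.Tendsto X (𝓝 0) (𝓝 x) := by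
    have := (hXs 0).continuousAt.tendsto; rwa [hX0] at this
  have hcov := hXt.eventually (h.cov_comp (Z := ℝ × ℝ))
  have key : ∀ d f : ℝ × ℝ,
      cov Γ' (fun p => φ (X p)) d (cov Γ' (fun p => φ (X p)) f fun p => fderiv ℝ φ (X p) c) 0
        = fderiv ℝ φ (X 0) (cov Γ X d (cov Γ X f fun _ => c) 0) := fun d f => by
    rw [← hcov.self_of_nhds X _ 0 d rfl (differentiableAt_of_infty (hXs 0))
      (differentiableAt_of_infty (contDiffAt_cov hΓ (hXs 0) hcc f))]
    apply cov_congr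
    filter_upwards [hcov] with p hp
    exact hp X (fun _ => c) p f rfl (differentiableAt_of_infty (hXs p)) (differentiableAt_const c)
  have hR := cov_cov_sub (X := X) hΓ (hXs 0) hcc ((1 : ℝ), (0 : ℝ)) ((0 : ℝ), (1 : ℝ))
  have hR' := cov_cov_sub (X := fun p => φ (X p)) hΓ' hφX (hdφ.clm_apply hcc)
    ((1 : ℝ), (0 : ℝ)) ((0 : ℝ), (1 : ℝ))
  have hφd : DifferentiableAt ℝ φ (X 0) := by
    rw [hX0]; exact differentiableAt_of_infty h.contDiffAt
  have e1 : ∀ d, fderiv ℝ (fun p => φ (X p)) 0 d = fderiv ℝ φ (X 0) (fderiv ℝ X 0 d) := fun d =>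
    fderiv_comp_apply hφd (differentiableAt_of_infty (hXs 0)) d
  have hda : fderiv ℝ X 0 ((1 : ℝ), (0 : ℝ)) = a := by
    rw [(hasFDerivAt_plane x a b 0).fderiv]; simp
  have hdb : fderiv ℝ X 0 ((0 : ℝ), (1 : ℝ)) = b := by
    rw [(hasFDerivAt_plane x a b 0).fderiv]; simp
  rw [key, key, ← map_sub, hR] at hR'
  simp only [e1, hda, hdb, hX0] at hR'
  exact hR'.symm

lemma IsCoordChange.trace_ricciEndo_eq {x : E} (h : IsCoordChange g g' Γ Γ' φ x) (k : E) :
    LinearMap.trace ℝ E (ricciEndo Γ' (φ x) (fderiv ℝ φ x k))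
      = LinearMap.trace ℝ E (ricciEndo Γ x k) := by
  set L : E ≃ₗ[ℝ] E := LinearEquiv.ofBijective (fderiv ℝ φ x : E →ₗ[ℝ] E) h.bijective.self_of_nhds
    with hL
  rw [← LinearMap.trace_conj' (ricciEndo Γ x k) L]
  congr 1
  ext a'
  obtain ⟨a, rfl⟩ := L.surjective a'
  rw [LinearEquiv.conj_apply_apply, LinearEquiv.symm_apply_apply]
  exact h.curv_eq a k k

/-- The focusing term does not depend on the coordinates of the ambient space. -/
lemma IsCoordChange.focusing_eq {X : Z → E} {z : Z} {ε : Fin n → Z} (hX : ContDiffAt ℝ ∞ X z)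
    (h : IsCoordChange g g' Γ Γ' φ (X z)) (k : E) :
    focusing g' Γ' (fun w => φ (X w)) ε (fderiv ℝ φ (X z) k) z = focusing g Γ X ε k z := by
  have hev : ∀ a, ∀ᶠ w in 𝓝 z, fderiv ℝ (fun w => φ (X w)) w a
      = fderiv ℝ φ (X w) (fderiv ℝ X w a) := fun a => by
    filter_upwards [eventually_differentiableAt hX,
      hX.continuousAt.eventually (eventually_differentiableAt h.contDiffAt)] with w h1 h2
    exact fderiv_comp_apply h2 h1 a
  have h1 : firstForm g' (fun w => φ (X w)) ε z = firstForm g X ε z := by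
    ext α β
    simp only [firstForm, (hev _).self_of_nhds, h.isometry.self_of_nhds]
  have h2 : ∀ α β, secondForm Γ' (fun w => φ (X w)) ε α β z
      = fderiv ℝ φ (X z) (secondForm Γ X ε α β z) := fun α β => by
    rw [secondForm, cov_congr (hev (ε β))]
    exact h.cov_comp.self_of_nhds X _ z (ε α) rfl (differentiableAt_of_infty hX)
      (differentiableAt_of_infty (contDiffAt_fderiv_apply hX _))
  simp only [focusing, h1, h2, h.isometry.self_of_nhds, h.trace_ricciEndo_eq]

end Invariance

section Reparametrisation

variable {E : Type*} [NormedAddCommGroup E] [NormedSpace ℝ E] {n : ℕ}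

set_option synthInstance.maxHeartbeats 200000

variable {g : E → E →L[ℝ] E →L[ℝ] ℝ} {Γ : E → E →L[ℝ] E →L[ℝ] E}

/-- The squared norm of a bilinear form with components `K` for a metric with components `h` is
invariant under linear substitutions. -/
lemma sum_sq_congruence {h h' K K' A : Matrix (Fin n) (Fin n) ℝ} (hA : IsUnit A.det)
    (hh : h = A.transpose * h' * A) (hK : K = A.transpose * K' * A) :
    ∑ α, ∑ β, ∑ γ, ∑ δ, h⁻¹ α γ * h⁻¹ β δ * K α β * K γ δ
      = ∑ α, ∑ β, ∑ γ, ∑ δ, h'⁻¹ α γ * h'⁻¹ β δ * K' α β * K' γ δ := by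
  have key : ∀ h K : Matrix (Fin n) (Fin n) ℝ,
      ∑ α, ∑ β, ∑ γ, ∑ δ, h⁻¹ α γ * h⁻¹ β δ * K α β * K γ δ
        = (h⁻¹.transpose * K * (h⁻¹ * K.transpose)).trace := fun h K => by
    simp only [Matrix.trace, Matrix.diag_apply, Matrix.mul_apply, Matrix.transpose_apply,
      Finset.sum_mul, Finset.mul_sum]
    rw [sum_comm_pairs]
    refine Finset.sum_congr rfl fun γ _ => ?_
    rw [show ∀ F : Fin n → Fin n → Fin n → ℝ, ∑ δ, ∑ α, ∑ β, F δ α β = ∑ β, ∑ δ, ∑ α, F δ α β from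
      fun F => (Finset.sum_congr rfl fun δ _ => Finset.sum_comm).trans Finset.sum_comm]
    refine Finset.sum_congr rfl fun β _ => ?_
    refine Finset.sum_congr rfl fun δ _ => Finset.sum_congr rfl fun α _ => ?_
    ring
  have hAt : IsUnit A.transpose.det := by rwa [Matrix.det_transpose]
  have hinv : h⁻¹ = A⁻¹ * h'⁻¹ * A.transpose⁻¹ := by
    rw [hh, Matrix.mul_inv_rev, Matrix.mul_inv_rev, Matrix.mul_assoc]
  rw [key, key, hinv, hK]
  simp only [Matrix.transpose_mul, Matrix.transpose_transpose]
  rw [Matrix.transpose_nonsing_inv A.transpose, Matrix.transpose_transpose,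
    Matrix.transpose_nonsing_inv A]
  rw [show A⁻¹ * (h'⁻¹.transpose * A.transpose⁻¹) * (A.transpose * K' * A)
      * (A⁻¹ * h'⁻¹ * A.transpose⁻¹ * (A.transpose * (K'.transpose * A)))
      = A⁻¹ * (h'⁻¹.transpose * K' * (h'⁻¹ * K'.transpose) * A) by
    simp only [Matrix.mul_assoc, Matrix.nonsing_inv_mul_cancel_left _ _ hAt,
      Matrix.mul_nonsing_inv_cancel_left _ _ hA]]
  rw [Matrix.trace_mul_comm, Matrix.mul_assoc, Matrix.mul_nonsing_inv _ hA, Matrix.mul_one]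

/-- The focusing term along a normal vector does not depend on the coordinates of the surface. -/
lemma focusing_comp_eq {X : EuclideanSpace ℝ (Fin n) → E}
    {θ : EuclideanSpace ℝ (Fin n) → EuclideanSpace ℝ (Fin n)} {u : EuclideanSpace ℝ (Fin n)}
    (hX : ContDiffAt ℝ ∞ X (θ u)) (hθ : ContDiffAt ℝ ∞ θ u)
    (hbij : Function.Bijective (fderiv ℝ θ u)) {k : E}
    (hk : ∀ a, g (X (θ u)) k (fderiv ℝ X (θ u) a) = 0) :
    focusing g Γ (fun w => X (θ w)) (fun α => EuclideanSpace.single α 1) k u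
      = focusing g Γ X (fun α => EuclideanSpace.single α 1) k (θ u) := by
  set s : Fin n → EuclideanSpace ℝ (Fin n) := fun α => EuclideanSpace.single α 1 with hs
  have hev : ∀ a, ∀ᶠ w in 𝓝 u, fderiv ℝ (fun w => X (θ w)) w a
      = fderiv ℝ X (θ w) (fderiv ℝ θ w a) := fun a => by
    filter_upwards [eventually_differentiableAt hθ,
      hθ.continuousAt.eventually (eventually_differentiableAt hX)] with w h1 h2
    exact fderiv_comp_apply h2 h1 a
  set A : Matrix (Fin n) (Fin n) ℝ := fun μ α => fderiv ℝ θ u (s α) μ with hA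
  have hexp : ∀ α, fderiv ℝ θ u (s α) = ∑ μ, A μ α • s μ := fun α =>
    euclidean_eq_sum (fderiv ℝ θ u (s α))
  have hAdet : IsUnit A.det := by
    rw [← Matrix.isUnit_iff_isUnit_det, ← Matrix.mulVec_injective_iff_isUnit]
    intro c c' hc
    have hsum : ∀ c : Fin n → ℝ, fderiv ℝ θ u (∑ α, c α • s α) = WithLp.toLp 2 (A.mulVec c) :=
      fun c => by
        ext μ
        simp only [map_sum, map_smul, Matrix.mulVec, dotProduct, hA]
        simp [Finset.sum_apply, mul_comm]
    have h1 : ∑ α, c α • s α = ∑ α, c' α • s α := hbij.1 (by rw [hsum, hsum, hc])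
    have h2 : ∀ c : Fin n → ℝ, ∑ α, c α • s α = WithLp.toLp 2 c := fun c =>
      (euclidean_eq_sum (WithLp.toLp 2 c)).symm
    rw [h2, h2] at h1
    exact congrArg WithLp.ofLp h1
  have hfirst : firstForm g (fun w => X (θ w)) s u = A.transpose * firstForm g X s (θ u) * A := by
    ext α β
    simp only [firstForm, (hev _).self_of_nhds, hexp, map_sum, map_smul, sum_apply, smul_apply,
      smul_eq_mul, Matrix.mul_apply, Matrix.transpose_apply, Finset.sum_mul, Finset.mul_sum]
    exact Finset.sum_congr rfl fun μ _ => Finset.sum_congr rfl fun ν _ => by ring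
  have hfθ : ContDiffAt ℝ ∞ (fderiv ℝ X) (θ u) := contDiffAt_fderiv hX
  have hsecond : ∀ α β, g (X (θ u)) k (secondForm Γ (fun w => X (θ w)) s α β u)
      = ∑ μ, ∑ ν, A μ α * A ν β * g (X (θ u)) k (secondForm Γ X s μ ν (θ u)) := fun α β => by
    have e1 : HasFDerivAt (fun w => fderiv ℝ X (θ w)) _ u :=
      (differentiableAt_of_infty hfθ).hasFDerivAt.comp u (differentiableAt_of_infty hθ).hasFDerivAt
    have e2 := e1.clm_apply
      (differentiableAt_of_infty (contDiffAt_fderiv_apply hθ (s β))).hasFDerivAt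
    have e3 : ∀ μ ν, fderiv ℝ (fun y => fderiv ℝ X y (s ν)) (θ u) (s μ)
        = fderiv ℝ (fderiv ℝ X) (θ u) (s μ) (s ν) := fun μ ν => fderiv_fderiv_apply hX _ _
    rw [secondForm, cov_congr (hev (s β)), cov, e2.fderiv, (hev _).self_of_nhds]
    simp only [secondForm, cov, e3, add_apply, ContinuousLinearMap.comp_apply,
      ContinuousLinearMap.flip_apply, map_add, hk, zero_add]
    simp only [hexp, map_sum, map_smul, sum_apply, smul_apply, smul_eq_mul, mul_add,
      Finset.sum_add_distrib, Finset.mul_sum]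
    congr 1
    · rw [Finset.sum_comm]
      exact Finset.sum_congr rfl fun μ _ => Finset.sum_congr rfl fun ν _ => by ring
    · rw [Finset.sum_comm]
      exact Finset.sum_congr rfl fun μ _ => Finset.sum_congr rfl fun ν _ => by ring
  have hK : Matrix.of (fun α β => g (X (θ u)) k (secondForm Γ (fun w => X (θ w)) s α β u))
      = A.transpose * Matrix.of (fun α β => g (X (θ u)) k (secondForm Γ X s α β (θ u))) * A := by
    ext α β
    rw [Matrix.of_apply, hsecond]
    simp only [Matrix.mul_apply, Matrix.transpose_apply, Matrix.of_apply, Finset.sum_mul]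
    rw [Finset.sum_comm]
    exact Finset.sum_congr rfl fun μ _ => Finset.sum_congr rfl fun ν _ => by ring
  unfold focusing
  congr 1
  exact sum_sq_congruence hAdet hfirst hK

end Reparametrisation

/-! ### Coordinate components -/

section Components

set_option synthInstance.maxHeartbeats 200000

variable {d : ℕ} {G : EuclideanSpace ℝ (Fin d) → Matrix (Fin d) (Fin d) ℝ}
  {x : EuclideanSpace ℝ (Fin d)}

/-- The bilinear form with components `G`. -/
def metricForm (G : EuclideanSpace ℝ (Fin d) → Matrix (Fin d) (Fin d) ℝ)
    (x : EuclideanSpace ℝ (Fin d)) :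
    EuclideanSpace ℝ (Fin d) →L[ℝ] EuclideanSpace ℝ (Fin d) →L[ℝ] ℝ :=
  ∑ i, ∑ j, G x i j • (EuclideanSpace.proj i : EuclideanSpace ℝ (Fin d) →L[ℝ] ℝ).smulRight
    (EuclideanSpace.proj j : EuclideanSpace ℝ (Fin d) →L[ℝ] ℝ)

/-- The Christoffel symbols as a vector-valued bilinear form. -/
def christoffelForm (G : EuclideanSpace ℝ (Fin d) → Matrix (Fin d) (Fin d) ℝ)
    (x : EuclideanSpace ℝ (Fin d)) :
    EuclideanSpace ℝ (Fin d) →L[ℝ] EuclideanSpace ℝ (Fin d) →L[ℝ] EuclideanSpace ℝ (Fin d) :=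
  ∑ k, ∑ i, ∑ j, christoffel G x k i j •
    (EuclideanSpace.proj i : EuclideanSpace ℝ (Fin d) →L[ℝ] ℝ).smulRight
      ((EuclideanSpace.proj j : EuclideanSpace ℝ (Fin d) →L[ℝ] ℝ).smulRight
        (EuclideanSpace.single k (1 : ℝ)))

lemma metricForm_apply (a b : EuclideanSpace ℝ (Fin d)) :
    metricForm G x a b = ∑ i, ∑ j, G x i j * a i * b j := by
  simp only [metricForm, sum_apply, smul_apply, ContinuousLinearMap.smulRight_apply,
    PiLp.proj_apply, smul_eq_mul, mul_assoc]

lemma christoffelForm_apply (a b : EuclideanSpace ℝ (Fin d)) (k : Fin d) :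
    christoffelForm G x a b k = ∑ i, ∑ j, christoffel G x k i j * a i * b j := by
  simp only [christoffelForm, sum_apply, smul_apply, ContinuousLinearMap.smulRight_apply,
    PiLp.proj_apply]
  simp only [WithLp.ofLp_sum, WithLp.ofLp_smul, Finset.sum_apply, Pi.smul_apply, smul_eq_mul,
    PiLp.single_apply]
  rw [Finset.sum_eq_single k (fun l _ hl => by simp [Ne.symm hl]) (by simp)]
  simp [mul_assoc]

lemma contDiffAt_pd {m : ℕ} {f : EuclideanSpace ℝ (Fin m) → ℝ} {u : EuclideanSpace ℝ (Fin m)}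
    (hf : ContDiffAt ℝ ∞ f u) (i : Fin m) : ContDiffAt ℝ ∞ (fun z => pd f i z) u :=
  contDiffAt_fderiv_apply hf _

lemma contDiffAt_christoffel (hG : ∀ i j, ContDiffAt ℝ ∞ (fun y => G y i j) x)
    (hdet : (G x).det ≠ 0) (k i j : Fin d) :
    ContDiffAt ℝ ∞ (fun y => christoffel G y k i j) x := by
  unfold christoffel
  exact contDiffAt_const.mul (ContDiffAt.sum fun l _ => (contDiffAt_matrix_inv hG hdet k l).mul
    (((contDiffAt_pd (hG l j) i).add (contDiffAt_pd (hG i l) j)).sub (contDiffAt_pd (hG i j) l)))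

lemma contDiffAt_smul_const {Z F : Type*} [NormedAddCommGroup Z] [NormedSpace ℝ Z]
    [NormedAddCommGroup F] [NormedSpace ℝ F] {f : Z → ℝ} {z : Z} (hf : ContDiffAt ℝ ∞ f z)
    (c : F) : ContDiffAt ℝ ∞ (fun y => f y • c) z := hf.smul contDiffAt_const

lemma contDiffAt_metricForm (hG : ∀ i j, ContDiffAt ℝ ∞ (fun y => G y i j) x) :
    ContDiffAt ℝ ∞ (metricForm G) x :=
  ContDiffAt.sum fun i _ => ContDiffAt.sum fun j _ => contDiffAt_smul_const (hG i j) _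

lemma contDiffAt_christoffelForm (hG : ∀ i j, ContDiffAt ℝ ∞ (fun y => G y i j) x)
    (hdet : (G x).det ≠ 0) : ContDiffAt ℝ ∞ (christoffelForm G) x :=
  ContDiffAt.sum fun k _ => ContDiffAt.sum fun i _ => ContDiffAt.sum fun j _ =>
    contDiffAt_smul_const (contDiffAt_christoffel hG hdet k i j) _

lemma christoffel_symm (hsymm : ∀ y i j, G y i j = G y j i) (k i j : Fin d) :
    christoffel G x k i j = christoffel G x k j i := by
  unfold christoffel
  congr 1
  refine Finset.sum_congr rfl fun l _ => ?_
  simp only [fun y => hsymm y l j, fun y => hsymm y i l, fun y => hsymm y i j]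
  ring

lemma sum_mul_christoffel (hdet : (G x).det ≠ 0) (j l i : Fin d) :
    ∑ k, G x j k * christoffel G x k l i
      = (1 / 2) * (pd (fun z => G z j i) l x + pd (fun z => G z l j) i x
        - pd (fun z => G z l i) j x) := by
  set c : Fin d → ℝ := fun m =>
    pd (fun z => G z m i) l x + pd (fun z => G z l m) i x - pd (fun z => G z l i) m x with hc
  have h1 : ∀ k, christoffel G x k l i = (1 / 2) * ((G x)⁻¹.mulVec c) k := fun k => rfl
  have h2 := congrFun (Matrix.mulVec_mulVec c (G x) (G x)⁻¹) j
  rw [Matrix.mul_nonsing_inv _ (isUnit_iff_ne_zero.mpr hdet), Matrix.one_mulVec] at h2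
  change _ = (1 / 2) * c j
  rw [← h2]
  simp only [h1, Matrix.mulVec, dotProduct, Finset.mul_sum]
  exact Finset.sum_congr rfl fun k _ => Finset.sum_congr rfl fun m _ => by ring

lemma metricForm_nondegenerate (hsymm : ∀ y i j, G y i j = G y j i) (hdet : (G x).det ≠ 0)
    {a : EuclideanSpace ℝ (Fin d)} (ha : ∀ b, metricForm G x a b = 0) : a = 0 := by
  have h1 : (G x).mulVec a = 0 := by
    ext j
    have := ha (EuclideanSpace.single j 1)
    rw [metricForm_apply] at this
    simpa [PiLp.single_apply, Matrix.mulVec, dotProduct, hsymm x j] using this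
  have h2 := Matrix.eq_zero_of_mulVec_eq_zero hdet h1
  ext j
  exact congrFun h2 j

lemma fderiv_metricForm_apply (hG : ∀ i j, ContDiffAt ℝ ∞ (fun y => G y i j) x)
    (c a b : EuclideanSpace ℝ (Fin d)) :
    fderiv ℝ (metricForm G) x c a b
      = ∑ l, ∑ i, ∑ j, pd (fun y => G y i j) l x * c l * a i * b j := by
  have hd := differentiableAt_of_infty (contDiffAt_metricForm hG)
  have h1 : fderiv ℝ (fun y => metricForm G y a b) x c = fderiv ℝ (metricForm G) x c a b := by
    rw [((hd.hasFDerivAt.clm_apply (hasFDerivAt_const a x)).clm_apply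
      (hasFDerivAt_const b x)).fderiv]
    simp
  rw [← h1]
  simp only [metricForm_apply]
  have h2 := HasFDerivAt.fun_sum (u := Finset.univ) fun i (_ : i ∈ Finset.univ) =>
    HasFDerivAt.fun_sum (u := Finset.univ) fun j (_ : j ∈ Finset.univ) =>
    (((hG i j).differentiableAt (by simp)).hasFDerivAt.mul_const (a i)).mul_const (b j)
  rw [h2.fderiv]
  simp only [sum_apply, smul_apply, smul_eq_mul]
  conv_lhs => rw [euclidean_eq_sum c]
  simp only [map_sum, map_smul, smul_eq_mul, Finset.mul_sum]
  have h : ∀ f : Fin d → Fin d → Fin d → ℝ, ∑ α, ∑ β, ∑ γ, f α β γ = ∑ γ, ∑ α, ∑ β, f α β γ :=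
    fun f => (Finset.sum_congr rfl fun α _ => Finset.sum_comm).trans Finset.sum_comm
  rw [h]
  exact Finset.sum_congr rfl fun l _ => Finset.sum_congr rfl fun i _ =>
    Finset.sum_congr rfl fun j _ => by simp only [pd]; ring

/-- The Christoffel symbols define the Levi-Civita connection. -/
lemma isLeviCivitaAt_christoffelForm (hsymm : ∀ y i j, G y i j = G y j i)
    (hG : ∀ i j, ContDiffAt ℝ ∞ (fun y => G y i j) x) (hdet : (G x).det ≠ 0) :
    IsLeviCivitaAt (metricForm G) (christoffelForm G) x where
  differentiableAt := differentiableAt_of_infty (contDiffAt_metricForm hG)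
  metric_symm a b := by
    rw [metricForm_apply, metricForm_apply, Finset.sum_comm]
    exact Finset.sum_congr rfl fun i _ => Finset.sum_congr rfl fun j _ => by
      rw [hsymm x j i]; ring
  torsion_free a b := by
    ext k
    rw [christoffelForm_apply, christoffelForm_apply, Finset.sum_comm]
    exact Finset.sum_congr rfl fun i _ => Finset.sum_congr rfl fun j _ => by
      rw [christoffel_symm hsymm k j i]; ring
  compat a b c := by
    have h : ∀ f : Fin d → Fin d → Fin d → Fin d → ℝ,
        ∑ k, ∑ j, ∑ l, ∑ i, f k j l i = ∑ l, ∑ i, ∑ j, ∑ k, f k j l i := fun f => by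
      rw [sum_comm_pairs]
      exact Finset.sum_congr rfl fun l _ => Finset.sum_congr rfl fun i _ => Finset.sum_comm
    have key : ∀ a b, metricForm G x (christoffelForm G x c a) b = ∑ l, ∑ i, ∑ j,
        (1 / 2) * (pd (fun z => G z j i) l x + pd (fun z => G z l j) i x
        - pd (fun z => G z l i) j x) * (c l * a i * b j) := fun a b => by
      simp only [metricForm_apply, christoffelForm_apply, Finset.mul_sum, Finset.sum_mul]
      rw [h]
      refine Finset.sum_congr rfl fun l _ => Finset.sum_congr rfl fun i _ =>
        Finset.sum_congr rfl fun j _ => ?_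
      rw [← sum_mul_christoffel hdet, Finset.sum_mul]
      exact Finset.sum_congr rfl fun k _ => by rw [hsymm x k j]; ring
    have hms : ∀ a b, metricForm G x a b = metricForm G x b a := fun a b => by
      rw [metricForm_apply, metricForm_apply, Finset.sum_comm]
      exact Finset.sum_congr rfl fun i _ => Finset.sum_congr rfl fun j _ => by
        rw [hsymm x j i]; ring
    rw [fderiv_metricForm_apply hG, hms a, key, key, ← Finset.sum_add_distrib]
    refine Finset.sum_congr rfl fun l _ => ?_
    rw [Finset.sum_comm (f := fun i j => (1 / 2) * (pd (fun z => G z j i) l x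
      + pd (fun z => G z l j) i x - pd (fun z => G z l i) j x) * (c l * b i * a j)),
      ← Finset.sum_add_distrib]
    refine Finset.sum_congr rfl fun i _ => ?_
    rw [← Finset.sum_add_distrib]
    refine Finset.sum_congr rfl fun j _ => ?_
    simp only [fun y => hsymm y j i]
    ring

lemma fderiv_christoffelForm_apply (hG : ∀ i j, ContDiffAt ℝ ∞ (fun y => G y i j) x)
    (hdet : (G x).det ≠ 0) (c a b : EuclideanSpace ℝ (Fin d)) (k : Fin d) :
    fderiv ℝ (christoffelForm G) x c a b k
      = ∑ i, ∑ j, fderiv ℝ (fun y => christoffel G y k i j) x c * a i * b j := by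
  have hd := differentiableAt_of_infty (contDiffAt_christoffelForm hG hdet)
  have h1 : fderiv ℝ (fun y => christoffelForm G y a b k) x c
      = fderiv ℝ (christoffelForm G) x c a b k := by
    have e1 := (hd.hasFDerivAt.clm_apply (hasFDerivAt_const a x)).clm_apply (hasFDerivAt_const b x)
    have e2 := (EuclideanSpace.proj k : EuclideanSpace ℝ (Fin d) →L[ℝ] ℝ).hasFDerivAt.comp x e1
    rw [show (fun y => christoffelForm G y a b k) = (EuclideanSpace.proj k :
      EuclideanSpace ℝ (Fin d) →L[ℝ] ℝ) ∘ fun y => christoffelForm G y a b from rfl, e2.fderiv]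
    simp
  rw [← h1]
  simp only [christoffelForm_apply]
  have h2 := HasFDerivAt.fun_sum (u := Finset.univ) fun i (_ : i ∈ Finset.univ) =>
    HasFDerivAt.fun_sum (u := Finset.univ) fun j (_ : j ∈ Finset.univ) =>
    (((contDiffAt_christoffel hG hdet k i j).differentiableAt
      (by simp)).hasFDerivAt.mul_const (a i)).mul_const (b j)
  rw [h2.fderiv]
  simp only [sum_apply, smul_apply, smul_eq_mul]
  exact Finset.sum_congr rfl fun i _ => Finset.sum_congr rfl fun j _ => by ring

lemma sum_single_mul (f : Fin d → Fin d → ℝ) (k : Fin d) (b : Fin d → ℝ) :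
    ∑ i, ∑ j, f i j * (EuclideanSpace.single k (1 : ℝ) : EuclideanSpace ℝ (Fin d)) i * b j
      = ∑ j, f k j * b j := by
  rw [Finset.sum_eq_single k (fun i _ hi => by simp [hi]) (by simp)]
  simp

/-- The Ricci tensor is the trace of the curvature. -/
lemma sum_ricci_eq_trace (hsymm : ∀ y i j, G y i j = G y j i)
    (hG : ∀ i j, ContDiffAt ℝ ∞ (fun y => G y i j) x) (hdet : (G x).det ≠ 0)
    (K : EuclideanSpace ℝ (Fin d)) :
    ∑ i, ∑ j, ricci G x i j * K i * K j
      = LinearMap.trace ℝ _ (ricciEndo (christoffelForm G) x K) := by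
  rw [LinearMap.trace_eq_matrix_trace ℝ (EuclideanSpace.basisFun (Fin d) ℝ).toBasis, Matrix.trace]
  have h1 : ∀ k, (LinearMap.toMatrix (EuclideanSpace.basisFun (Fin d) ℝ).toBasis
      (EuclideanSpace.basisFun (Fin d) ℝ).toBasis (ricciEndo (christoffelForm G) x K)).diag k
      = curv (christoffelForm G) x (EuclideanSpace.single k 1) K K k := fun k => by
    simp [LinearMap.toMatrix_apply, ricciEndo]
  have h2 : ∀ k, curv (christoffelForm G) x (EuclideanSpace.single k 1) K K k
      = ∑ i, ∑ j, (pd (fun z => christoffel G z k i j) k x - pd (fun z => christoffel G z k i k) j x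
        + (∑ l, christoffel G x k k l * christoffel G x l i j)
        - ∑ l, christoffel G x k j l * christoffel G x l i k) * K i * K j := fun k => by
    have e1 : fderiv ℝ (christoffelForm G) x (EuclideanSpace.single k 1) K K k
        = ∑ i, ∑ j, pd (fun z => christoffel G z k i j) k x * K i * K j :=
      fderiv_christoffelForm_apply hG hdet _ _ _ k
    have e2 : fderiv ℝ (christoffelForm G) x K (EuclideanSpace.single k 1) K k
        = ∑ i, ∑ j, pd (fun z => christoffel G z k i k) j x * K i * K j := by
      rw [fderiv_christoffelForm_apply hG hdet, sum_single_mul]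
      refine Finset.sum_congr rfl fun i _ => ?_
      conv_lhs => rw [euclidean_eq_sum K]
      simp only [map_sum, map_smul, smul_eq_mul, fun y => christoffel_symm (x := y) hsymm k k i]
      rw [← euclidean_eq_sum K, Finset.sum_mul]
      exact Finset.sum_congr rfl fun j _ => by rw [pd]; ring
    have e3 : christoffelForm G x (EuclideanSpace.single k 1) (christoffelForm G x K K) k
        = ∑ i, ∑ j, (∑ l, christoffel G x k k l * christoffel G x l i j) * K i * K j := by
      rw [christoffelForm_apply, sum_single_mul]
      simp only [christoffelForm_apply, Finset.mul_sum, Finset.sum_mul]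
      rw [Finset.sum_comm]
      refine Finset.sum_congr rfl fun i _ => ?_
      rw [Finset.sum_comm]
      exact Finset.sum_congr rfl fun j _ => Finset.sum_congr rfl fun l _ => by ring
    have e4 : christoffelForm G x K (christoffelForm G x (EuclideanSpace.single k 1) K) k
        = ∑ i, ∑ j, (∑ l, christoffel G x k j l * christoffel G x l i k) * K i * K j := by
      rw [christoffelForm_apply]
      simp only [christoffelForm_apply, sum_single_mul]
      simp only [Finset.mul_sum, Finset.sum_mul]
      rw [Finset.sum_comm]
      refine (Finset.sum_congr rfl fun i _ => Finset.sum_comm).trans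
        (Finset.sum_comm.trans (Finset.sum_congr rfl fun i _ => ?_))
      rw [Finset.sum_comm]
      exact Finset.sum_congr rfl fun j _ => Finset.sum_congr rfl fun l _ => by
        rw [christoffel_symm hsymm l k i]; ring
    simp only [curv, PiLp.add_apply, PiLp.sub_apply, e1, e2, e3, e4, add_mul, sub_mul,
      Finset.sum_add_distrib, Finset.sum_sub_distrib]
  simp only [h1, h2, ricci]
  have h3 : ∀ f : Fin d → Fin d → Fin d → ℝ, ∑ k, ∑ i, ∑ j, f k i j = ∑ i, ∑ j, ∑ k, f k i j :=
    fun f => Finset.sum_comm.trans (Finset.sum_congr rfl fun α _ => Finset.sum_comm)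
  rw [h3]
  refine Finset.sum_congr rfl fun i _ => Finset.sum_congr rfl fun j _ => ?_
  simp only [← Finset.sum_mul, Finset.sum_add_distrib, Finset.sum_sub_distrib]

variable {n : ℕ} {X : EuclideanSpace ℝ (Fin n) → EuclideanSpace ℝ (Fin d)}
  {u : EuclideanSpace ℝ (Fin n)}

lemma pd_component (hX : DifferentiableAt ℝ X u) (i : Fin d) (α : Fin n) :
    pd (fun z => X z i) α u = fderiv ℝ X u (EuclideanSpace.single α 1) i :=
  fderiv_comp_apply (f := (EuclideanSpace.proj i : EuclideanSpace ℝ (Fin d) →L[ℝ] ℝ))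
    (ContinuousLinearMap.differentiableAt _) hX _ |>.trans (by
      rw [ContinuousLinearMap.fderiv]; rfl)

lemma inducedMetric_eq (hX : DifferentiableAt ℝ X u) :
    inducedMetric G X u
      = firstForm (metricForm G) X (fun α => EuclideanSpace.single α 1) u := by
  ext α β
  simp only [inducedMetric, firstForm, metricForm_apply, pd_component hX]

lemma frameDerivative_eq (hX : ContDiffAt ℝ ∞ X u) (α β : Fin n) (i : Fin d) :
    frameDerivative G X u α β i
      = secondForm (christoffelForm G) X (fun α => EuclideanSpace.single α 1) α β u i := by
  have h1 : (fun z => pd (fun z' => X z' i) β z) =ᶠ[𝓝 u]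
      fun z => (fderiv ℝ X z (EuclideanSpace.single β 1)) i := by
    filter_upwards [eventually_differentiableAt hX] with z hz using pd_component hz i β
  have h2 : pd (fun z => pd (fun z' => X z' i) β z) α u
      = fderiv ℝ (fun z => fderiv ℝ X z (EuclideanSpace.single β 1)) u
        (EuclideanSpace.single α 1) i := by
    rw [pd, h1.fderiv_eq]
    exact pd_component (X := fun z => fderiv ℝ X z (EuclideanSpace.single β 1))
      (differentiableAt_of_infty (contDiffAt_fderiv_apply hX _)) i α
  rw [frameDerivative, h2]
  simp only [secondForm, cov, PiLp.add_apply, christoffelForm_apply,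
    pd_component (differentiableAt_of_infty hX)]

lemma extrinsicCurvature_eq (hX : ContDiffAt ℝ ∞ X u) (N : EuclideanSpace ℝ (Fin d))
    (α β : Fin n) : extrinsicCurvature G X u N α β = - metricForm G (X u) N
      (secondForm (christoffelForm G) X (fun α => EuclideanSpace.single α 1) α β u) := by
  simp only [extrinsicCurvature, metricForm_apply, frameDerivative_eq hX]

lemma meanCurvature_eq (hX : ContDiffAt ℝ ∞ X u) (N : EuclideanSpace ℝ (Fin d)) :
    meanCurvature G X u N = - metricForm G (X u) N
      (frameTrace (metricForm G) (christoffelForm G) X (fun α => EuclideanSpace.single α 1) u) := by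
  rw [metric_frameTrace]
  simp only [meanCurvature, extrinsicCurvature_eq hX,
    inducedMetric_eq (differentiableAt_of_infty hX), mul_neg, Finset.sum_neg_distrib]

lemma focusing_eq_sum_ricci_add_shearSq (hsymm : ∀ y i j, G y i j = G y j i)
    (hG : ∀ i j, ContDiffAt ℝ ∞ (fun y => G y i j) (X u)) (hdet : (G (X u)).det ≠ 0)
    (hX : ContDiffAt ℝ ∞ X u) (K : EuclideanSpace ℝ (Fin d)) :
    focusing (metricForm G) (christoffelForm G) X (fun α => EuclideanSpace.single α 1) K u
      = ∑ i, ∑ j, ricci G (X u) i j * K i * K j + shearSq G X u K := by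
  rw [sum_ricci_eq_trace hsymm hG hdet]
  simp only [focusing, shearSq, extrinsicCurvature_eq hX,
    inducedMetric_eq (differentiableAt_of_infty hX), mul_neg, neg_mul, neg_neg]

end Components

/-! ### Charts at interior points -/

section Charts

set_option linter.unusedSectionVars false

variable {d : ℕ} [NeZero d] {M : Type*} [TopologicalSpace M]
  [ChartedSpace (EuclideanHalfSpace d) M] [IsManifold (𝓡∂ d) ∞ M]

lemma extChartAt_mem_interior_target {x₀ x : M} (hx : x ∈ (extChartAt (𝓡∂ d) x₀).source)
    (hint : x ∈ (𝓡∂ d).interior M) :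
    extChartAt (𝓡∂ d) x₀ x ∈ interior (extChartAt (𝓡∂ d) x₀).target := by
  rw [extChartAt_source] at hx
  exact (ModelWithCorners.isInteriorPoint_iff_of_mem_atlas (I := 𝓡∂ d) (n := ∞) (by simp)
    (chart_mem_atlas _ x₀) hx).1 hint

lemma extChartAt_symm_mem_source {x₀ : M} {u : EuclideanSpace ℝ (Fin d)}
    (hu : u ∈ interior (extChartAt (𝓡∂ d) x₀).target) :
    (extChartAt (𝓡∂ d) x₀).symm u ∈ (extChartAt (𝓡∂ d) x₀).source :=
  (extChartAt (𝓡∂ d) x₀).map_target (interior_subset hu)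

lemma extChartAt_symm_mem_interior {x₀ : M} {u : EuclideanSpace ℝ (Fin d)}
    (hu : u ∈ interior (extChartAt (𝓡∂ d) x₀).target) :
    (extChartAt (𝓡∂ d) x₀).symm u ∈ (𝓡∂ d).interior M := by
  have hs := extChartAt_symm_mem_source hu
  have h := (extChartAt (𝓡∂ d) x₀).right_inv (interior_subset hu)
  rw [extChartAt_source] at hs
  refine (ModelWithCorners.isInteriorPoint_iff_of_mem_atlas (I := 𝓡∂ d) (n := ∞) (by simp)
    (chart_mem_atlas _ x₀) hs).2 ?_
  change extChartAt (𝓡∂ d) x₀ _ ∈ interior (extChartAt (𝓡∂ d) x₀).target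
  rwa [h]

lemma contMDiffAt_extChartAt_symm {x₀ : M} {u : EuclideanSpace ℝ (Fin d)}
    (hu : u ∈ interior (extChartAt (𝓡∂ d) x₀).target) :
    ContMDiffAt 𝓘(ℝ, EuclideanSpace ℝ (Fin d)) (𝓡∂ d) ∞ (extChartAt (𝓡∂ d) x₀).symm u :=
  (contMDiffOn_extChartAt_symm x₀).contMDiffAt (mem_interior_iff_mem_nhds.1 hu)

lemma contMDiffAt_extChartAt_of_mem {x₀ x : M} (hx : x ∈ (extChartAt (𝓡∂ d) x₀).source) :
    ContMDiffAt (𝓡∂ d) 𝓘(ℝ, EuclideanSpace ℝ (Fin d)) ∞ (extChartAt (𝓡∂ d) x₀) x := by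
  rw [extChartAt_source] at hx
  exact contMDiffAt_extChartAt' hx

/-- The tangent vector with given components in the coordinate system around `x₀`. -/
def tangentOf (x₀ : M) (u : EuclideanSpace ℝ (Fin d)) :
    EuclideanSpace ℝ (Fin d) →L[ℝ] TangentSpace (𝓡∂ d) ((extChartAt (𝓡∂ d) x₀).symm u) :=
  mfderivWithin 𝓘(ℝ, EuclideanSpace ℝ (Fin d)) (𝓡∂ d) (extChartAt (𝓡∂ d) x₀).symm
    (range (𝓡∂ d)) u

lemma tangentOf_eq_mfderiv {x₀ : M} {u : EuclideanSpace ℝ (Fin d)}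
    (hu : u ∈ interior (extChartAt (𝓡∂ d) x₀).target) :
    tangentOf x₀ u = mfderiv 𝓘(ℝ, EuclideanSpace ℝ (Fin d)) (𝓡∂ d)
      (extChartAt (𝓡∂ d) x₀).symm u :=
  mfderivWithin_of_mem_nhds (Filter.mem_of_superset (mem_interior_iff_mem_nhds.1 hu)
    (extChartAt_target_subset_range x₀))

lemma vecComp_tangentOf {x₀ : M} {u : EuclideanSpace ℝ (Fin d)}
    (hu : u ∈ (extChartAt (𝓡∂ d) x₀).target) (a : EuclideanSpace ℝ (Fin d)) :
    vecComp x₀ (tangentOf x₀ u a) = a :=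
  have : IsManifold (𝓡∂ d) 1 M := .of_le (n := ∞) (by simp)
  DFunLike.congr_fun (mfderiv_extChartAt_comp_mfderivWithin_extChartAt_symm hu) a

lemma tangentOf_vecComp {x₀ : M} {u : EuclideanSpace ℝ (Fin d)}
    (hu : u ∈ (extChartAt (𝓡∂ d) x₀).target)
    (a : TangentSpace (𝓡∂ d) ((extChartAt (𝓡∂ d) x₀).symm u)) :
    tangentOf x₀ u (vecComp x₀ a) = a :=
  have : IsManifold (𝓡∂ d) 1 M := .of_le (n := ∞) (by simp)
  DFunLike.congr_fun (mfderivWithin_extChartAt_symm_comp_mfderiv_extChartAt hu) a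

lemma vecComp_add (x₀ : M) {x : M} (a b : TangentSpace (𝓡∂ d) x) :
    vecComp x₀ (a + b) = vecComp x₀ a + vecComp x₀ b :=
  map_add (mfderiv (𝓡∂ d) 𝓘(ℝ, EuclideanSpace ℝ (Fin d)) (extChartAt (𝓡∂ d) x₀) x) a b

lemma vecComp_smul (x₀ : M) {x : M} (c : ℝ) (a : TangentSpace (𝓡∂ d) x) :
    vecComp x₀ (c • a) = c • vecComp x₀ a :=
  map_smul (mfderiv (𝓡∂ d) 𝓘(ℝ, EuclideanSpace ℝ (Fin d)) (extChartAt (𝓡∂ d) x₀) x) c a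

lemma vecComp_zero (x₀ : M) {x : M} : vecComp x₀ (0 : TangentSpace (𝓡∂ d) x) = 0 :=
  map_zero (mfderiv (𝓡∂ d) 𝓘(ℝ, EuclideanSpace ℝ (Fin d)) (extChartAt (𝓡∂ d) x₀) x)

lemma vecComp_bijective {x₀ x : M} (hx : x ∈ (extChartAt (𝓡∂ d) x₀).source) :
    Function.Bijective (fun a : TangentSpace (𝓡∂ d) x => vecComp x₀ a) := by
  obtain ⟨u, hu, rfl⟩ : ∃ u ∈ (extChartAt (𝓡∂ d) x₀).target, (extChartAt (𝓡∂ d) x₀).symm u = x :=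
    ⟨_, (extChartAt (𝓡∂ d) x₀).map_source hx, (extChartAt (𝓡∂ d) x₀).left_inv hx⟩
  exact ⟨Function.LeftInverse.injective (tangentOf_vecComp hu),
    Function.RightInverse.surjective (vecComp_tangentOf hu)⟩

/-- A map into the tangent bundle is smooth when its base point and its components are. -/
lemma contMDiffAt_tangentBundle_iff {EN HN N : Type*} [NormedAddCommGroup EN] [NormedSpace ℝ EN]
    [TopologicalSpace HN] {J : ModelWithCorners ℝ EN HN} [TopologicalSpace N] [ChartedSpace HN N]
    {σ : N → TangentBundle (𝓡∂ d) M} {z : N} {x₀ : M}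
    (hz : (σ z).proj ∈ (extChartAt (𝓡∂ d) x₀).source) :
    ContMDiffAt J (𝓡∂ d).tangent ∞ σ z ↔
      ContMDiffAt J (𝓡∂ d) ∞ (fun y => (σ y).proj) z ∧
      ContMDiffAt J 𝓘(ℝ, EuclideanSpace ℝ (Fin d)) ∞ (fun y => vecComp x₀ (σ y).2) z := by
  have : IsManifold (𝓡∂ d) 1 M := .of_le (n := ∞) (by simp)
  have : IsManifold (𝓡∂ d) (∞ + 1) M := ‹IsManifold (𝓡∂ d) ∞ M›
  have hz' := hz
  rw [extChartAt_source] at hz'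
  rw [Bundle.Trivialization.contMDiffAt_iff (e := trivializationAt (EuclideanSpace ℝ (Fin d))
    (TangentSpace (𝓡∂ d)) x₀) (by
      rw [Trivialization.mem_source, TangentBundle.trivializationAt_baseSet]; exact hz')]
  refine and_congr_right fun h => Filter.EventuallyEq.contMDiffAt_iff ?_
  filter_upwards [h.continuousAt.preimage_mem_nhds
    ((chartAt (EuclideanHalfSpace d) x₀).open_source.mem_nhds hz')] with y hy
  have h1 := TangentBundle.continuousLinearMapAt_trivializationAt (I := 𝓡∂ d) hy
  have h2 := DFunLike.congr_fun h1 (σ y).2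
  rw [Trivialization.continuousLinearMapAt_apply, Trivialization.linearMapAt_apply] at h2
  rw [if_pos (by rw [TangentBundle.trivializationAt_baseSet]; exact hy)] at h2
  exact h2

end Charts

/-! ### The spacetime metric in coordinates -/

section SpacetimeMetric

set_option linter.unusedSectionVars false

variable {d : ℕ} [NeZero d] {M : Type*} [TopologicalSpace M]
  [ChartedSpace (EuclideanHalfSpace d) M] [IsManifold (𝓡∂ d) ∞ M] (W : ConformalSpacetime d M)

lemma physMetric_apply {x : M} (a b : TangentSpace (𝓡∂ d) x) :
    W.physMetric x a b = (W.Ω x ^ 2)⁻¹ * W.metric x a b := rfl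

lemma metricForm_metricComp (x₀ : M) (u a b : EuclideanSpace ℝ (Fin d)) :
    metricForm (W.metricComp x₀) u a b
      = W.physMetric ((extChartAt (𝓡∂ d) x₀).symm u) (tangentOf x₀ u a) (tangentOf x₀ u b) := by
  rw [metricForm_apply]
  conv_rhs => rw [euclidean_eq_sum a, euclidean_eq_sum b]
  simp only [map_sum, map_smul, sum_apply, smul_apply, smul_eq_mul, Finset.mul_sum]
  rw [Finset.sum_comm]
  exact Finset.sum_congr rfl fun i _ => Finset.sum_congr rfl fun j _ => by
    have h : W.physMetric ((extChartAt (𝓡∂ d) x₀).symm u)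
        (tangentOf x₀ u (EuclideanSpace.single j 1)) (tangentOf x₀ u (EuclideanSpace.single i 1))
        = W.metricComp x₀ u j i := rfl
    rw [h]; ring

lemma metricForm_vecComp {x₀ x : M} (hx : x ∈ (extChartAt (𝓡∂ d) x₀).source)
    (a b : TangentSpace (𝓡∂ d) x) :
    metricForm (W.metricComp x₀) (extChartAt (𝓡∂ d) x₀ x) (vecComp x₀ a) (vecComp x₀ b)
      = W.physMetric x a b := by
  obtain ⟨u, hu, rfl⟩ : ∃ u ∈ (extChartAt (𝓡∂ d) x₀).target, (extChartAt (𝓡∂ d) x₀).symm u = x :=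
    ⟨_, (extChartAt (𝓡∂ d) x₀).map_source hx, (extChartAt (𝓡∂ d) x₀).left_inv hx⟩
  rw [(extChartAt (𝓡∂ d) x₀).right_inv hu, metricForm_metricComp, tangentOf_vecComp hu,
    tangentOf_vecComp hu]

lemma metricComp_symm (x₀ : M) (u : EuclideanSpace ℝ (Fin d)) (i j : Fin d) :
    W.metricComp x₀ u i j = W.metricComp x₀ u j i := by
  simp only [ConformalSpacetime.metricComp, physMetric_apply]
  rw [W.symm]

lemma metric_nondegenerate {x : M} {a : TangentSpace (𝓡∂ d) x} (ha : ∀ b, W.metric x a b = 0) :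
    a = 0 := by
  obtain ⟨t, -, ht⟩ := W.lorentzian x
  by_contra h
  exact (ht a (by rw [W.symm, ha]) h).ne' (ha a)

lemma det_metricComp_ne_zero {x₀ : M} {u : EuclideanSpace ℝ (Fin d)}
    (hu : u ∈ interior (extChartAt (𝓡∂ d) x₀).target) : (W.metricComp x₀ u).det ≠ 0 := by
  intro h
  obtain ⟨a, ha0, ha⟩ := Matrix.exists_mulVec_eq_zero_iff.2 h
  have h1 : ∀ b, metricForm (W.metricComp x₀) u b (WithLp.toLp 2 a) = 0 := fun b => by
    rw [metricForm_apply]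
    refine Finset.sum_eq_zero fun i _ => ?_
    have := congrFun ha i
    simp only [Matrix.mulVec, dotProduct, Pi.zero_apply] at this
    calc _ = b i * ∑ j, W.metricComp x₀ u i j * a j := by
            rw [Finset.mul_sum]; exact Finset.sum_congr rfl fun j _ => by ring
      _ = 0 := by rw [this, mul_zero]
  have hΩ := W.Ω_pos _ (extChartAt_symm_mem_interior hu)
  have h2 : tangentOf x₀ u (WithLp.toLp 2 a) = 0 := by
    refine metric_nondegenerate W fun b => ?_
    have h3 := h1 (vecComp x₀ b)
    rw [metricForm_metricComp, tangentOf_vecComp (interior_subset hu), physMetric_apply] at h3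
    rw [W.symm]
    exact (mul_eq_zero.1 h3).resolve_left (by positivity)
  have h4 := vecComp_tangentOf (interior_subset hu) (WithLp.toLp 2 a)
  rw [h2, vecComp_zero] at h4
  exact ha0 (by simpa using congrArg WithLp.ofLp h4.symm)

/-- The metric is smooth in the interior, so its values on smooth vector fields are smooth. -/
lemma contMDiffAt_metric_apply {EN HN N : Type*} [NormedAddCommGroup EN] [NormedSpace ℝ EN]
    [TopologicalSpace HN] {J : ModelWithCorners ℝ EN HN} [TopologicalSpace N] [ChartedSpace HN N]
    {b : N → M} {v w : ∀ z, TangentSpace (𝓡∂ d) (b z)} {z : N}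
    (hz : b z ∈ (𝓡∂ d).interior M)
    (hv : ContMDiffAt J (𝓡∂ d).tangent ∞ (fun y => (⟨b y, v y⟩ : TangentBundle (𝓡∂ d) M)) z)
    (hw : ContMDiffAt J (𝓡∂ d).tangent ∞ (fun y => (⟨b y, w y⟩ : TangentBundle (𝓡∂ d) M)) z) :
    ContMDiffAt J 𝓘(ℝ, ℝ) ∞ (fun y => W.metric (b y) (v y) (w y)) z := by
  have : IsManifold (𝓡∂ d) 1 M := .of_le (n := ∞) (by simp)
  have : IsManifold (𝓡∂ d) (∞ + 1) M := ‹IsManifold (𝓡∂ d) ∞ M›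
  have hb : ContMDiffAt J (𝓡∂ d) ∞ b z := by
    simp only [contMDiffAt_totalSpace] at hv
    exact hv.1
  have hW := W.smooth_metric.contMDiffAt
    ((ModelWithCorners.isOpen_interior (n := ∞) (by simp)).mem_nhds hz)
  have : ContMDiffAt J ((𝓡∂ d).prod 𝓘(ℝ)) ∞
      (fun m ↦ TotalSpace.mk' ℝ (E := Bundle.Trivial M ℝ) (b m)
        (W.metric (b m) (v m) (w m))) z := by
    apply ContMDiffAt.clm_bundle_apply₂ (F₁ := EuclideanSpace ℝ (Fin d))
      (F₂ := EuclideanSpace ℝ (Fin d))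
    · exact ContMDiffAt.comp z hW hb
    · exact hv
    · exact hw
  simp only [contMDiffAt_totalSpace] at this
  exact this.2

lemma continuous_metric_apply {EN HN N : Type*} [NormedAddCommGroup EN] [NormedSpace ℝ EN]
    [TopologicalSpace HN] (J : ModelWithCorners ℝ EN HN) [TopologicalSpace N] [ChartedSpace HN N]
    {b : N → M} {v w : ∀ z, TangentSpace (𝓡∂ d) (b z)}
    (hv : Continuous (fun y => (⟨b y, v y⟩ : TangentBundle (𝓡∂ d) M)))
    (hw : Continuous (fun y => (⟨b y, w y⟩ : TangentBundle (𝓡∂ d) M))) :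
    Continuous (fun y => W.metric (b y) (v y) (w y)) := by
  have : IsManifold (𝓡∂ d) 1 M := .of_le (n := ∞) (by simp)
  have : IsManifold (𝓡∂ d) (0 + 1) M := by simpa
  have hb : Continuous b := (FiberBundle.continuous_proj _ _).comp hv
  rw [← contMDiff_zero_iff (I := J) (I' := (𝓡∂ d).tangent)] at hv hw
  rw [← contMDiff_zero_iff (I := J) (I' := 𝓘(ℝ, ℝ))]
  intro z
  have : ContMDiffAt J ((𝓡∂ d).prod 𝓘(ℝ)) 0
      (fun m ↦ TotalSpace.mk' ℝ (E := Bundle.Trivial M ℝ) (b m)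
        (W.metric (b m) (v m) (w m))) z := by
    apply ContMDiffAt.clm_bundle_apply₂ (F₁ := EuclideanSpace ℝ (Fin d))
      (F₂ := EuclideanSpace ℝ (Fin d))
    · exact ContMDiffAt.comp z (W.continuous_metric _) (contMDiff_zero_iff.2 hb z)
    · exact hv z
    · exact hw z
  simp only [contMDiffAt_totalSpace] at this
  exact this.2

lemma contDiffAt_metricComp {x₀ : M} {u : EuclideanSpace ℝ (Fin d)}
    (hu : u ∈ interior (extChartAt (𝓡∂ d) x₀).target) (i j : Fin d) :
    ContDiffAt ℝ ∞ (fun z => W.metricComp x₀ z i j) u := by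
  have hΩ := W.Ω_pos _ (extChartAt_symm_mem_interior hu)
  have hint := (ModelWithCorners.isOpen_interior (I := 𝓡∂ d) (M := M) (n := ∞) (by simp)).mem_nhds
    (extChartAt_symm_mem_interior hu)
  have hs : ∀ i : Fin d, ContMDiffAt 𝓘(ℝ, EuclideanSpace ℝ (Fin d)) (𝓡∂ d).tangent ∞
      (fun z => (⟨(extChartAt (𝓡∂ d) x₀).symm z, tangentOf x₀ z (EuclideanSpace.single i 1)⟩ :
        TangentBundle (𝓡∂ d) M)) u := fun i => by
    refine (contMDiffAt_tangentBundle_iff (x₀ := x₀) (extChartAt_symm_mem_source hu)).2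
      ⟨contMDiffAt_extChartAt_symm hu, ?_⟩
    refine (contMDiffAt_const (c := (EuclideanSpace.single i 1 : EuclideanSpace ℝ (Fin d)))
      ).congr_of_eventuallyEq ?_
    filter_upwards [isOpen_interior.mem_nhds hu] with z hz
    exact vecComp_tangentOf (interior_subset hz) _
  have h1 := contMDiffAt_metric_apply W (extChartAt_symm_mem_interior hu) (hs i) (hs j)
  have h2 : ContDiffAt ℝ ∞ (fun z => W.Ω ((extChartAt (𝓡∂ d) x₀).symm z)) u :=
    ((W.Ω_smooth.contMDiffAt hint).comp u (contMDiffAt_extChartAt_symm hu)).contDiffAt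
  exact ((h2.pow 2).inv (by positivity)).mul h1.contDiffAt

end SpacetimeMetric

/-! ### Surfaces in coordinates -/

section Surfaces

set_option linter.unusedSectionVars false

variable {d : ℕ} [NeZero d] {M : Type*} [TopologicalSpace M]
  [ChartedSpace (EuclideanHalfSpace d) M] [IsManifold (𝓡∂ d) ∞ M] {W : ConformalSpacetime d M}
  {n : ℕ} [NeZero n] {S : Type*} [TopologicalSpace S] [ChartedSpace (EuclideanHalfSpace n) S]
  [IsManifold (𝓡∂ n) ∞ S] {ψ : S → M} {s₀ : S} {x₀ : M} {u : EuclideanSpace ℝ (Fin n)}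

/-- The coordinates of the interior points of `S` in the coordinate system around `s₀` that `ψ` maps
into the coordinate system around `x₀`. -/
def coordDomain (d n : ℕ) [NeZero d] [NeZero n] {M : Type*} [TopologicalSpace M]
    [ChartedSpace (EuclideanHalfSpace d) M] {S : Type*} [TopologicalSpace S]
    [ChartedSpace (EuclideanHalfSpace n) S] (ψ : S → M) (s₀ : S) (x₀ : M) :
    Set (EuclideanSpace ℝ (Fin n)) :=
  {u | u ∈ interior (extChartAt (𝓡∂ n) s₀).target ∧
    ψ ((extChartAt (𝓡∂ n) s₀).symm u) ∈ (extChartAt (𝓡∂ d) x₀).source}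

lemma isOpen_coordDomain (hψ : Continuous ψ) (s₀ : S) (x₀ : M) :
    IsOpen (coordDomain d n ψ s₀ x₀) := by
  have h : ContinuousOn (fun u => ψ ((extChartAt (𝓡∂ n) s₀).symm u))
      (interior (extChartAt (𝓡∂ n) s₀).target) :=
    hψ.comp_continuousOn ((continuousOn_extChartAt_symm s₀).mono interior_subset)
  exact h.isOpen_inter_preimage isOpen_interior (isOpen_extChartAt_source x₀)

lemma extChartAt_mem_coordDomain {y : S} (hy : y ∈ (𝓡∂ n).interior S)
    (hs : y ∈ (extChartAt (𝓡∂ n) s₀).source) (hx : ψ y ∈ (extChartAt (𝓡∂ d) x₀).source) :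
    extChartAt (𝓡∂ n) s₀ y ∈ coordDomain d n ψ s₀ x₀ :=
  ⟨extChartAt_mem_interior_target hs hy, by rwa [(extChartAt (𝓡∂ n) s₀).left_inv hs]⟩

lemma IsAnchoredSurface.contMDiffAt (hψ : IsAnchoredSurface n W ψ) {y : S}
    (hy : y ∈ (𝓡∂ n).interior S) : ContMDiffAt (𝓡∂ n) (𝓡∂ d) ∞ ψ y :=
  hψ.smooth.contMDiffAt ((ModelWithCorners.isOpen_interior (n := ∞) (by simp)).mem_nhds hy)

lemma IsAnchoredSurface.contDiffAt_coordMap (hψ : IsAnchoredSurface n W ψ)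
    (hu : u ∈ coordDomain d n ψ s₀ x₀) : ContDiffAt ℝ ∞ (coordMap (d := d) n ψ s₀ x₀) u :=
  ((contMDiffAt_extChartAt_of_mem hu.2).comp u
    ((hψ.contMDiffAt (extChartAt_symm_mem_interior hu.1)).comp u
      (contMDiffAt_extChartAt_symm hu.1))).contDiffAt

lemma IsAnchoredSurface.coordMap_mem (hψ : IsAnchoredSurface n W ψ)
    (hu : u ∈ coordDomain d n ψ s₀ x₀) :
    coordMap n ψ s₀ x₀ u ∈ _root_.interior (extChartAt (𝓡∂ d) x₀).target :=
  extChartAt_mem_interior_target hu.2 (hψ.interior _ (extChartAt_symm_mem_interior hu.1))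

lemma IsAnchoredSurface.fderiv_coordMap (hψ : IsAnchoredSurface n W ψ)
    (hu : u ∈ coordDomain d n ψ s₀ x₀) (a : EuclideanSpace ℝ (Fin n)) :
    fderiv ℝ (coordMap n ψ s₀ x₀) u a = vecComp x₀ (mfderiv (𝓡∂ n) (𝓡∂ d) ψ
      ((extChartAt (𝓡∂ n) s₀).symm u) (tangentOf s₀ u a)) := by
  have h1 : MDifferentiableAt 𝓘(ℝ, EuclideanSpace ℝ (Fin n)) (𝓡∂ n) (extChartAt (𝓡∂ n) s₀).symm u :=
    (contMDiffAt_extChartAt_symm hu.1).mdifferentiableAt (by simp)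
  have h2 : MDifferentiableAt (𝓡∂ n) (𝓡∂ d) ψ ((extChartAt (𝓡∂ n) s₀).symm u) :=
    (hψ.contMDiffAt (extChartAt_symm_mem_interior hu.1)).mdifferentiableAt (by simp)
  have h3 : MDifferentiableAt (𝓡∂ d) 𝓘(ℝ, EuclideanSpace ℝ (Fin d)) (extChartAt (𝓡∂ d) x₀)
      (ψ ((extChartAt (𝓡∂ n) s₀).symm u)) :=
    (contMDiffAt_extChartAt_of_mem hu.2).mdifferentiableAt (by simp)
  have h4 := mfderiv_comp u h3 (h2.comp u h1)
  rw [mfderiv_comp u h2 h1, ← tangentOf_eq_mfderiv hu.1] at h4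
  have h5 : fderiv ℝ (coordMap n ψ s₀ x₀) u = mfderiv 𝓘(ℝ, EuclideanSpace ℝ (Fin n))
      𝓘(ℝ, EuclideanSpace ℝ (Fin d)) (extChartAt (𝓡∂ d) x₀ ∘ ψ ∘ (extChartAt (𝓡∂ n) s₀).symm) u :=
    mfderiv_eq_fderiv.symm
  rw [h5, h4]
  rfl

/-- The coordinate expression of a vector at a point of the surface is orthogonal to the coordinate
vector fields precisely if the vector is normal. -/
lemma IsAnchoredSurface.forall_metricForm_eq_zero_iff (hψ : IsAnchoredSurface n W ψ)
    (hu : u ∈ coordDomain d n ψ s₀ x₀)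
    (N : TangentSpace (𝓡∂ d) (ψ ((extChartAt (𝓡∂ n) s₀).symm u))) :
    (∀ α, metricForm (W.metricComp x₀) (coordMap n ψ s₀ x₀ u) (vecComp x₀ N)
      (fderiv ℝ (coordMap n ψ s₀ x₀) u (EuclideanSpace.single α 1)) = 0)
      ↔ IsNormal n W ψ ((extChartAt (𝓡∂ n) s₀).symm u) N := by
  have hΩ := W.Ω_pos _ (hψ.interior _ (extChartAt_symm_mem_interior hu.1))
  have key : ∀ a, metricForm (W.metricComp x₀) (coordMap n ψ s₀ x₀ u) (vecComp x₀ N)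
      (fderiv ℝ (coordMap n ψ s₀ x₀) u a) = 0 ↔ W.metric _ (mfderiv (𝓡∂ n) (𝓡∂ d) ψ
      ((extChartAt (𝓡∂ n) s₀).symm u) (tangentOf s₀ u a)) N = 0 := fun a => by
    rw [hψ.fderiv_coordMap hu, coordMap, metricForm_vecComp W hu.2, physMetric_apply, W.symm,
      mul_eq_zero, or_iff_right (by positivity)]
  constructor
  · intro h v
    rw [← tangentOf_vecComp (interior_subset hu.1) v, ← key, euclidean_eq_sum (vecComp s₀ v)]
    simp only [map_sum, map_smul, h, smul_zero, Finset.sum_const_zero]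
  · exact fun h α => (key _).2 (h _)

lemma IsAnchoredSurface.posDef_firstForm (hψ : IsAnchoredSurface n W ψ)
    (hu : u ∈ coordDomain d n ψ s₀ x₀) :
    (firstForm (metricForm (W.metricComp x₀)) (coordMap n ψ s₀ x₀)
      (fun α => EuclideanSpace.single α 1) u).PosDef := by
  have hΩ := W.Ω_pos _ (hψ.interior _ (extChartAt_symm_mem_interior hu.1))
  refine Matrix.PosDef.of_dotProduct_mulVec_pos ?_ fun c hc => ?_
  · ext α β
    simp only [Matrix.conjTranspose_apply, star_trivial, firstForm, metricForm_apply]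
    rw [Finset.sum_comm]
    exact Finset.sum_congr rfl fun i _ => Finset.sum_congr rfl fun j _ => by
      rw [metricComp_symm]; ring
  · have hc' : WithLp.toLp 2 c ≠ 0 := fun h => hc (by simpa using congrArg WithLp.ofLp h)
    set v : EuclideanSpace ℝ (Fin n) := WithLp.toLp 2 c with hv
    have h1 : tangentOf s₀ u v ≠ 0 := fun h => hc' (by
      rw [← vecComp_tangentOf (interior_subset hu.1) v, h, vecComp_zero])
    have h2 := hψ.spacelike _ _ h1
    have h3 : metricForm (W.metricComp x₀) (coordMap n ψ s₀ x₀ u)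
        (fderiv ℝ (coordMap n ψ s₀ x₀) u v) (fderiv ℝ (coordMap n ψ s₀ x₀) u v) > 0 := by
      rw [hψ.fderiv_coordMap hu, coordMap, metricForm_vecComp W hu.2, physMetric_apply]
      positivity
    rw [euclidean_eq_sum v] at h3
    simp only [map_sum, map_smul, sum_apply, smul_apply, smul_eq_mul] at h3
    refine lt_of_lt_of_eq h3 ?_
    simp only [Matrix.mulVec, dotProduct, firstForm, star_trivial, Finset.mul_sum]
    rw [Finset.sum_comm]
    exact Finset.sum_congr rfl fun i _ => Finset.sum_congr rfl fun j _ => by simp [hv]; ring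

/-- The vanishing of the mean curvature vector in coordinates. -/
lemma IsAnchoredSurface.metric_frameTrace_eq_zero (hψ : IsAnchoredSurface n W ψ)
    (hext : IsExtremal n W ψ) (hu : u ∈ coordDomain d n ψ s₀ x₀) {N : EuclideanSpace ℝ (Fin d)}
    (hN : ∀ α, metricForm (W.metricComp x₀) (coordMap n ψ s₀ x₀ u) N
      (fderiv ℝ (coordMap n ψ s₀ x₀) u (EuclideanSpace.single α 1)) = 0) :
    metricForm (W.metricComp x₀) (coordMap n ψ s₀ x₀ u) N
      (frameTrace (metricForm (W.metricComp x₀)) (christoffelForm (W.metricComp x₀))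
        (coordMap n ψ s₀ x₀) (fun α => EuclideanSpace.single α 1) u) = 0 := by
  obtain ⟨N', rfl⟩ := (vecComp_bijective hu.2).2 N
  have h := hext s₀ x₀ _ (extChartAt_symm_mem_interior hu.1) (extChartAt_symm_mem_source hu.1) hu.2
    N' ((hψ.forall_metricForm_eq_zero_iff hu N').1 hN)
  rw [(extChartAt (𝓡∂ n) s₀).right_inv (interior_subset hu.1),
    meanCurvature_eq (hψ.contDiffAt_coordMap hu)] at h
  exact neg_eq_zero.1 h

end Surfaces

/-! ### Independence of the focusing term of the coordinate systems -/

section CoordinateChange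

set_option linter.unusedSectionVars false

variable {d : ℕ} [NeZero d] {M : Type*} [TopologicalSpace M]
  [ChartedSpace (EuclideanHalfSpace d) M] [IsManifold (𝓡∂ d) ∞ M] {W : ConformalSpacetime d M}
  {n : ℕ} [NeZero n] {S : Type*} [TopologicalSpace S] [ChartedSpace (EuclideanHalfSpace n) S]
  [IsManifold (𝓡∂ n) ∞ S] {ψ : S → M}

lemma contDiffAt_extChartAt_comp_symm {x₀ x₁ : M} {u : EuclideanSpace ℝ (Fin d)}
    (hu : u ∈ interior (extChartAt (𝓡∂ d) x₀).target)
    (hx : (extChartAt (𝓡∂ d) x₀).symm u ∈ (extChartAt (𝓡∂ d) x₁).source) :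
    ContDiffAt ℝ ∞ (fun u => extChartAt (𝓡∂ d) x₁ ((extChartAt (𝓡∂ d) x₀).symm u)) u :=
  ((contMDiffAt_extChartAt_of_mem hx).comp u (contMDiffAt_extChartAt_symm hu)).contDiffAt

lemma fderiv_extChartAt_comp_symm {x₀ x₁ : M} {u : EuclideanSpace ℝ (Fin d)}
    (hu : u ∈ interior (extChartAt (𝓡∂ d) x₀).target)
    (hx : (extChartAt (𝓡∂ d) x₀).symm u ∈ (extChartAt (𝓡∂ d) x₁).source)
    (a : EuclideanSpace ℝ (Fin d)) :
    fderiv ℝ (fun u => extChartAt (𝓡∂ d) x₁ ((extChartAt (𝓡∂ d) x₀).symm u)) u a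
      = vecComp x₁ (tangentOf x₀ u a) := by
  have h := mfderiv_comp u
    ((contMDiffAt_extChartAt_of_mem hx).mdifferentiableAt (by simp))
    ((contMDiffAt_extChartAt_symm hu).mdifferentiableAt (by simp))
  rw [← tangentOf_eq_mfderiv hu] at h
  rw [← mfderiv_eq_fderiv]
  exact DFunLike.congr_fun h a

lemma fderiv_extChartAt_comp_symm_vecComp {x₀ x₁ x : M} (hint : x ∈ (𝓡∂ d).interior M)
    (h₀ : x ∈ (extChartAt (𝓡∂ d) x₀).source) (h₁ : x ∈ (extChartAt (𝓡∂ d) x₁).source)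
    (a : TangentSpace (𝓡∂ d) x) :
    fderiv ℝ (fun u => extChartAt (𝓡∂ d) x₁ ((extChartAt (𝓡∂ d) x₀).symm u))
      (extChartAt (𝓡∂ d) x₀ x) (vecComp x₀ a) = vecComp x₁ a := by
  have hu' := extChartAt_mem_interior_target h₀ hint
  obtain ⟨u, hu, rfl⟩ : ∃ u ∈ (extChartAt (𝓡∂ d) x₀).target, (extChartAt (𝓡∂ d) x₀).symm u = x :=
    ⟨_, (extChartAt (𝓡∂ d) x₀).map_source h₀, (extChartAt (𝓡∂ d) x₀).left_inv h₀⟩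
  rw [(extChartAt (𝓡∂ d) x₀).right_inv hu] at hu' ⊢
  rw [fderiv_extChartAt_comp_symm hu' h₁, tangentOf_vecComp hu]

lemma fderiv_extChartAt_comp_symm_bijective {x₀ x₁ : M} {u : EuclideanSpace ℝ (Fin d)}
    (hu : u ∈ interior (extChartAt (𝓡∂ d) x₀).target)
    (hx : (extChartAt (𝓡∂ d) x₀).symm u ∈ (extChartAt (𝓡∂ d) x₁).source) :
    Function.Bijective
      (fderiv ℝ (fun u => extChartAt (𝓡∂ d) x₁ ((extChartAt (𝓡∂ d) x₀).symm u)) u) := by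
  have h1 : (fderiv ℝ (fun u => extChartAt (𝓡∂ d) x₁ ((extChartAt (𝓡∂ d) x₀).symm u)) u :
      EuclideanSpace ℝ (Fin d) → EuclideanSpace ℝ (Fin d)) =
      (fun a => vecComp x₁ a) ∘ fun a => tangentOf x₀ u a :=
    funext fun a => fderiv_extChartAt_comp_symm hu hx a
  rw [h1]
  exact (vecComp_bijective hx).comp
    ⟨Function.LeftInverse.injective (vecComp_tangentOf (interior_subset hu)),
      Function.RightInverse.surjective (tangentOf_vecComp (interior_subset hu))⟩

variable (W) in
lemma eventually_isLeviCivitaAt {x₀ : M} {u : EuclideanSpace ℝ (Fin d)}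
    (hu : u ∈ interior (extChartAt (𝓡∂ d) x₀).target) :
    ∀ᶠ v in 𝓝 u, IsLeviCivitaAt (metricForm (W.metricComp x₀))
      (christoffelForm (W.metricComp x₀)) v := by
  filter_upwards [isOpen_interior.mem_nhds hu] with v hv
  exact isLeviCivitaAt_christoffelForm (metricComp_symm W x₀) (contDiffAt_metricComp W hv)
    (det_metricComp_ne_zero W hv)

variable (W) in
lemma isCoordChange_extChartAt {x₀ x₁ x : M} (hint : x ∈ (𝓡∂ d).interior M)
    (h₀ : x ∈ (extChartAt (𝓡∂ d) x₀).source) (h₁ : x ∈ (extChartAt (𝓡∂ d) x₁).source) :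
    IsCoordChange (metricForm (W.metricComp x₀)) (metricForm (W.metricComp x₁))
      (christoffelForm (W.metricComp x₀)) (christoffelForm (W.metricComp x₁))
      (fun u => extChartAt (𝓡∂ d) x₁ ((extChartAt (𝓡∂ d) x₀).symm u))
      (extChartAt (𝓡∂ d) x₀ x) := by
  have hu := extChartAt_mem_interior_target h₀ hint
  have hu₁ := extChartAt_mem_interior_target h₁ hint
  have hx : (extChartAt (𝓡∂ d) x₀).symm (extChartAt (𝓡∂ d) x₀ x) = x :=
    (extChartAt (𝓡∂ d) x₀).left_inv h₀
  have hev : ∀ᶠ u in 𝓝 (extChartAt (𝓡∂ d) x₀ x), u ∈ interior (extChartAt (𝓡∂ d) x₀).target ∧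
      (extChartAt (𝓡∂ d) x₀).symm u ∈ (extChartAt (𝓡∂ d) x₁).source :=
    (isOpen_interior.eventually_mem hu).and
      ((contMDiffAt_extChartAt_symm hu).continuousAt.preimage_mem_nhds
        ((isOpen_extChartAt_source x₁).mem_nhds (by rwa [hx])))
  have hu₁' : extChartAt (𝓡∂ d) x₁ ((extChartAt (𝓡∂ d) x₀).symm (extChartAt (𝓡∂ d) x₀ x))
      ∈ interior (extChartAt (𝓡∂ d) x₁).target := by rwa [hx]
  refine ⟨contDiffAt_extChartAt_comp_symm hu (by rwa [hx]), ?_, ?_, eventually_isLeviCivitaAt W hu,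
    eventually_isLeviCivitaAt W hu₁', ?_,
    contDiffAt_christoffelForm (contDiffAt_metricComp W hu) (det_metricComp_ne_zero W hu),
    contDiffAt_christoffelForm (contDiffAt_metricComp W hu₁') (det_metricComp_ne_zero W hu₁')⟩
  · filter_upwards [hev] with u hu using fderiv_extChartAt_comp_symm_bijective hu.1 hu.2
  · filter_upwards [hev] with u hu a b
    rw [fderiv_extChartAt_comp_symm hu.1 hu.2, fderiv_extChartAt_comp_symm hu.1 hu.2,
      metricForm_vecComp W hu.2, metricForm_metricComp]
  · filter_upwards [isOpen_interior.mem_nhds hu₁'] with v hv a ha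
    exact metricForm_nondegenerate (metricComp_symm W x₁) (det_metricComp_ne_zero W hv) ha

lemma focusing_congr {E Z : Type*} [NormedAddCommGroup E] [NormedSpace ℝ E]
    [NormedAddCommGroup Z] [NormedSpace ℝ Z] {g : E → E →L[ℝ] E →L[ℝ] ℝ}
    {Γ : E → E →L[ℝ] E →L[ℝ] E} {X X' : Z → E} {z : Z} (h : X =ᶠ[𝓝 z] X') (ε : Fin n → Z) (k : E) :
    focusing g Γ X ε k z = focusing g Γ X' ε k z := by
  have h1 : firstForm g X ε z = firstForm g X' ε z := by
    ext α β
    simp only [firstForm, h.fderiv_eq, h.eq_of_nhds]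
  have h2 : ∀ α β, secondForm Γ X ε α β z = secondForm Γ X' ε α β z := fun α β => by
    have h3 : (fun y => fderiv ℝ X y (ε β)) =ᶠ[𝓝 z] fun y => fderiv ℝ X' y (ε β) := by
      filter_upwards [h.fderiv (𝕜 := ℝ)] with y hy
      rw [hy]
    simp only [secondForm, cov, h3.fderiv_eq, h.fderiv_eq, h.eq_of_nhds]
  simp only [focusing, h1, h2, h.eq_of_nhds]

/-- `Q_{kk}` can be computed in any coordinate systems on the surface and on the spacetime. -/
theorem IsAnchoredSurface.Qkk_eq_focusing (hψ : IsAnchoredSurface n W ψ) {s₀ : S} {x₀ : M}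
    {u : EuclideanSpace ℝ (Fin n)} (hu : u ∈ coordDomain d n ψ s₀ x₀)
    {k : TangentSpace (𝓡∂ d) (ψ ((extChartAt (𝓡∂ n) s₀).symm u))}
    (hk : IsNormal n W ψ ((extChartAt (𝓡∂ n) s₀).symm u) k) :
    Qkk n W ψ ((extChartAt (𝓡∂ n) s₀).symm u) k
      = focusing (metricForm (W.metricComp x₀)) (christoffelForm (W.metricComp x₀))
        (coordMap n ψ s₀ x₀) (fun α => EuclideanSpace.single α 1) (vecComp x₀ k) u := by
  have hyint := extChartAt_symm_mem_interior hu.1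
  have hysrc := extChartAt_symm_mem_source hu.1
  have hru : extChartAt (𝓡∂ n) s₀ ((extChartAt (𝓡∂ n) s₀).symm u) = u :=
    (extChartAt (𝓡∂ n) s₀).right_inv (interior_subset hu.1)
  have hk' := (hψ.forall_metricForm_eq_zero_iff hu k).2 hk
  -- these facts are recorded before the base point is abbreviated to `y`, as the type of `k`
  -- depends on it
  have hX := hψ.contDiffAt_coordMap hu
  have hcu : coordMap n ψ s₀ x₀ u = extChartAt (𝓡∂ d) x₀ (ψ ((extChartAt (𝓡∂ n) s₀).symm u)) := rfl
  have hcm := hψ.coordMap_mem hu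
  have hux := hu.2
  generalize hy : (extChartAt (𝓡∂ n) s₀).symm u = y at *
  have hy1 := mem_extChartAt_source (I := 𝓡∂ n) y
  have hx1 := mem_extChartAt_source (I := 𝓡∂ d) (ψ y)
  have hu' : extChartAt (𝓡∂ n) y y ∈ coordDomain d n ψ y (ψ y) :=
    extChartAt_mem_coordDomain hyint hy1 hx1
  have hly : (extChartAt (𝓡∂ n) y).symm (extChartAt (𝓡∂ n) y y) = y :=
    (extChartAt (𝓡∂ n) y).left_inv hy1
  have hcm' := hψ.coordMap_mem hu'
  have hcy : coordMap n ψ y (ψ y) (extChartAt (𝓡∂ n) y y) = extChartAt (𝓡∂ d) (ψ y) (ψ y) := by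
    rw [coordMap, hly]
  have h1 : Qkk n W ψ y k = focusing (metricForm (W.metricComp (ψ y)))
      (christoffelForm (W.metricComp (ψ y))) (coordMap n ψ y (ψ y))
      (fun α => EuclideanSpace.single α 1) (vecComp (ψ y) k) (extChartAt (𝓡∂ n) y y) := by
    rw [focusing_eq_sum_ricci_add_shearSq (metricComp_symm W _) (contDiffAt_metricComp W hcm')
      (det_metricComp_ne_zero W hcm') (hψ.contDiffAt_coordMap hu'), hcy]
    rfl
  -- the changes of coordinates on the surface and on the spacetime
  set θ : EuclideanSpace ℝ (Fin n) → EuclideanSpace ℝ (Fin n) :=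
    fun v => extChartAt (𝓡∂ n) s₀ ((extChartAt (𝓡∂ n) y).symm v) with hθ
  set φ : EuclideanSpace ℝ (Fin d) → EuclideanSpace ℝ (Fin d) :=
    fun v => extChartAt (𝓡∂ d) (ψ y) ((extChartAt (𝓡∂ d) x₀).symm v) with hφ
  have hθu : θ (extChartAt (𝓡∂ n) y y) = u := by rw [hθ]; simp only [hly, hru]
  have hys : (extChartAt (𝓡∂ n) y).symm (extChartAt (𝓡∂ n) y y)
      ∈ (extChartAt (𝓡∂ n) s₀).source := by rwa [hly]
  have hθc : ContDiffAt ℝ ∞ θ (extChartAt (𝓡∂ n) y y) :=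
    contDiffAt_extChartAt_comp_symm hu'.1 hys
  have hθb := fderiv_extChartAt_comp_symm_bijective hu'.1 hys
  have hev : coordMap n ψ y (ψ y) =ᶠ[𝓝 (extChartAt (𝓡∂ n) y y)]
      fun v => φ (coordMap n ψ s₀ x₀ (θ v)) := by
    have hopen := (isOpen_coordDomain (d := d) (n := n) hψ.c1.continuous y x₀).mem_nhds
      (extChartAt_mem_coordDomain hyint hy1 hux)
    have hsrc := (contMDiffAt_extChartAt_symm hu'.1).continuousAt.preimage_mem_nhds
      ((isOpen_extChartAt_source s₀).mem_nhds hys)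
    filter_upwards [hopen, hsrc] with v hv hv'
    simp only [hθ, hφ, coordMap]
    rw [(extChartAt (𝓡∂ n) s₀).left_inv hv', (extChartAt (𝓡∂ d) x₀).left_inv hv.2]
  have hcc := isCoordChange_extChartAt W (hψ.interior y hyint) hux hx1
  have hkk : vecComp (ψ y) k = fderiv ℝ φ (coordMap n ψ s₀ x₀ u) (vecComp x₀ k) := by
    rw [hcu]
    exact (fderiv_extChartAt_comp_symm_vecComp (hψ.interior y hyint) hux hx1 k).symm
  have hXθ : ContDiffAt ℝ ∞ (fun v => coordMap n ψ s₀ x₀ (θ v)) (extChartAt (𝓡∂ n) y y) :=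
    ContDiffAt.comp (g := coordMap n ψ s₀ x₀) (f := θ) _ (by rw [hθu]; exact hX) hθc
  rw [h1, focusing_congr hev, hkk]
  have h2 := IsCoordChange.focusing_eq (ε := fun α => EuclideanSpace.single α 1)
    (X := fun v => coordMap n ψ s₀ x₀ (θ v)) hXθ
    (by simp only [hθu]; rw [hcu]; exact hcc) (vecComp x₀ k)
  simp only [hθu] at h2
  rw [h2, focusing_comp_eq (by rw [hθu]; exact hX) hθc hθb, hθu]
  rw [hθu]
  intro a
  rw [euclidean_eq_sum a]
  simp only [map_sum, map_smul, hk', smul_zero, Finset.sum_const_zero]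

end CoordinateChange

/-! ### Deviation vector fields -/

section Deviation

set_option linter.unusedSectionVars false

variable {d : ℕ} [NeZero d] {M : Type*} [TopologicalSpace M]
  [ChartedSpace (EuclideanHalfSpace d) M] [IsManifold (𝓡∂ d) ∞ M] {W : ConformalSpacetime d M}
  {n : ℕ} [NeZero n] {S : Type*} [TopologicalSpace S] [ChartedSpace (EuclideanHalfSpace n) S]
  [IsManifold (𝓡∂ n) ∞ S] {ψ : S → M} {Ψ : ℝ → S → M} {η : ∀ y : S, TangentSpace (𝓡∂ d) (ψ y)}
  {s₀ : S} {x₀ : M} {u : EuclideanSpace ℝ (Fin n)}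

/-- The coordinate expression of a one-parameter family of surfaces. -/
def familyMap (d n : ℕ) [NeZero d] [NeZero n] {M : Type*} [TopologicalSpace M]
    [ChartedSpace (EuclideanHalfSpace d) M] {S : Type*} [TopologicalSpace S]
    [ChartedSpace (EuclideanHalfSpace n) S] (Ψ : ℝ → S → M) (s₀ : S) (x₀ : M) :
    ℝ × EuclideanSpace ℝ (Fin n) → EuclideanSpace ℝ (Fin d) :=
  fun p => coordMap n (Ψ p.1) s₀ x₀ p.2

lemma IsNormalDeviation.contMDiffAt (h : IsNormalDeviation n W ψ Ψ η) {y : S}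
    (hy : y ∈ (𝓡∂ n).interior S) : ∀ᶠ l in 𝓝 (0 : ℝ),
    ContMDiffAt (𝓘(ℝ, ℝ).prod (𝓡∂ n)) (𝓡∂ d) ∞ (fun p : ℝ × S => Ψ p.1 p.2) (l, y) := by
  obtain ⟨ε, hε, -, h2, -⟩ := h.family
  filter_upwards [Ioo_mem_nhds (neg_lt_zero.2 hε) hε] with l hl
  exact h2.contMDiffAt ((isOpen_Ioo.prod
    (ModelWithCorners.isOpen_interior (n := ∞) (by simp))).mem_nhds ⟨hl, hy⟩)

lemma IsNormalDeviation.eventually_mem_coordDomain (h : IsNormalDeviation n W ψ Ψ η)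
    (hu : u ∈ coordDomain d n ψ s₀ x₀) : ∀ᶠ l in 𝓝 (0 : ℝ), u ∈ coordDomain d n (Ψ l) s₀ x₀ := by
  have h0 := h.zero
  subst h0
  have h1 := (h.contMDiffAt (extChartAt_symm_mem_interior hu.1)).self_of_nhds.continuousAt
  have h2 : ContinuousAt (fun l : ℝ => Ψ l ((extChartAt (𝓡∂ n) s₀).symm u)) 0 :=
    ContinuousAt.comp (f := fun l : ℝ => (l, (extChartAt (𝓡∂ n) s₀).symm u)) h1
      (by fun_prop)
  filter_upwards [h2.preimage_mem_nhds ((isOpen_extChartAt_source x₀).mem_nhds hu.2)] with l hl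
  exact ⟨hu.1, hl⟩

lemma IsNormalDeviation.contDiffAt_familyMap (h : IsNormalDeviation n W ψ Ψ η)
    (hu : u ∈ coordDomain d n ψ s₀ x₀) :
    ∀ᶠ l in 𝓝 (0 : ℝ), ContDiffAt ℝ ∞ (familyMap d n Ψ s₀ x₀) (l, u) := by
  filter_upwards [h.contMDiffAt (extChartAt_symm_mem_interior hu.1),
    h.eventually_mem_coordDomain hu] with l h1 h2
  have h3 : ContMDiffAt 𝓘(ℝ, ℝ × EuclideanSpace ℝ (Fin n)) (𝓘(ℝ, ℝ).prod (𝓡∂ n)) ∞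
      (fun p : ℝ × EuclideanSpace ℝ (Fin n) => (p.1, (extChartAt (𝓡∂ n) s₀).symm p.2)) (l, u) :=
    contDiffAt_fst.contMDiffAt.prodMk
      (ContMDiffAt.comp (l, u) (contMDiffAt_extChartAt_symm hu.1) contDiffAt_snd.contMDiffAt)
  exact ((contMDiffAt_extChartAt_of_mem h2.2).comp (l, u)
    (ContMDiffAt.comp (l, u) h1 h3)).contDiffAt

lemma IsNormalDeviation.fderiv_familyMap (h : IsNormalDeviation n W ψ Ψ η)
    (hu : u ∈ coordDomain d n ψ s₀ x₀) :
    fderiv ℝ (familyMap d n Ψ s₀ x₀) (0, u) (1, 0)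
      = vecComp x₀ (η ((extChartAt (𝓡∂ n) s₀).symm u)) := by
  have h0 := h.zero
  subst h0
  have h1 := (h.contDiffAt_familyMap hu).self_of_nhds.differentiableAt (by simp)
  have h2 := (h.contMDiffAt (extChartAt_symm_mem_interior hu.1)).self_of_nhds
  have h3 : MDifferentiableAt 𝓘(ℝ, ℝ) (𝓡∂ d)
      (fun l : ℝ => Ψ l ((extChartAt (𝓡∂ n) s₀).symm u)) 0 :=
    (ContMDiffAt.comp (0 : ℝ) h2 (contMDiffAt_id.prodMk contMDiffAt_const)).mdifferentiableAt
      (by simp)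
  have h4 := mfderiv_comp (0 : ℝ)
    ((contMDiffAt_extChartAt_of_mem hu.2).mdifferentiableAt (by simp)) h3
  have h5 : HasFDerivAt (fun l : ℝ => (l, u)) (ContinuousLinearMap.inl ℝ ℝ
      (EuclideanSpace ℝ (Fin n))) 0 := hasFDerivAt_prodMk_left 0 u
  have h6 := (h1.hasFDerivAt.comp (0 : ℝ) h5).fderiv
  have h7 := congrArg (fun p : TangentBundle (𝓡∂ d) M => vecComp x₀ p.2)
    (h.deviation ((extChartAt (𝓡∂ n) s₀).symm u))
  rw [← h7]
  -- the derivative in the parameter direction is that of the curve `l ↦ Ψ l y`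
  have h8 : fderiv ℝ (familyMap d n Ψ s₀ x₀ ∘ fun l : ℝ => (l, u)) 0 1
      = fderiv ℝ (familyMap d n Ψ s₀ x₀) (0, u) (1, 0) := by
    rw [h6]; simp
  rw [← h8, ← mfderiv_eq_fderiv]
  exact DFunLike.congr_fun h4 (1 : ℝ)

lemma IsNormalDeviation.contDiffAt_vecComp (h : IsNormalDeviation n W ψ Ψ η) (hψ : Continuous ψ)
    (hu : u ∈ coordDomain d n ψ s₀ x₀) :
    ContDiffAt ℝ ∞ (fun u => vecComp x₀ (η ((extChartAt (𝓡∂ n) s₀).symm u))) u := by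
  have h1 : ContDiffAt ℝ ∞ (fun v => fderiv ℝ (familyMap d n Ψ s₀ x₀) (0, v) (1, 0)) u :=
    ContDiffAt.comp (f := fun v => ((0 : ℝ), v)) u
      (contDiffAt_fderiv_apply (h.contDiffAt_familyMap hu).self_of_nhds (1, 0))
      (contDiffAt_const.prodMk contDiffAt_id)
  refine h1.congr_of_eventuallyEq ?_
  filter_upwards [(isOpen_coordDomain hψ s₀ x₀).mem_nhds hu] with v hv
  exact (h.fderiv_familyMap hv).symm

/-- The deviation field solves the Jacobi equation. -/
theorem IsNormalDeviation.jacobi_eq_zero (h : IsNormalDeviation n W ψ Ψ η)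
    (hψ : IsAnchoredSurface n W ψ) (hu : u ∈ coordDomain d n ψ s₀ x₀)
    {k : EuclideanSpace ℝ (Fin d)}
    (hk : ∀ α, metricForm (W.metricComp x₀) (coordMap n ψ s₀ x₀ u) k
      (fderiv ℝ (coordMap n ψ s₀ x₀) u (EuclideanSpace.single α 1)) = 0) :
    jacobi (metricForm (W.metricComp x₀)) (christoffelForm (W.metricComp x₀))
      (coordMap n ψ s₀ x₀) (fun α => EuclideanSpace.single α 1) k
      (fun u => vecComp x₀ (η ((extChartAt (𝓡∂ n) s₀).symm u))) u = 0 := by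
  have h0 := h.zero
  subst h0
  have hx := hψ.coordMap_mem hu
  have hopen := (isOpen_coordDomain hψ.c1.continuous s₀ x₀).mem_nhds hu
  have hfam : ∀ᶠ l in 𝓝 (0 : ℝ), IsAnchoredSurface n W (Ψ l) ∧ IsExtremal n W (Ψ l) := by
    obtain ⟨ε, hε, -, -, h3⟩ := h.family
    filter_upwards [Ioo_mem_nhds (neg_lt_zero.2 hε) hε] with l hl using h3 l hl
  have key := jacobi_family_eq_zero (F := familyMap d n Ψ s₀ x₀) (u := u)
    (ε := fun α => EuclideanSpace.single α 1) (g := metricForm (W.metricComp x₀))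
    (Γ := christoffelForm (W.metricComp x₀)) (k := k)
    (contDiffAt_metricForm (contDiffAt_metricComp W hx))
    (contDiffAt_christoffelForm (contDiffAt_metricComp W hx) (det_metricComp_ne_zero W hx))
    (eventually_isLeviCivitaAt W hx) (h.contDiffAt_familyMap hu)
    (hψ.posDef_firstForm hu).det_pos.ne' ?_ ?_ hk
  · refine Eq.trans (jacobi_congr (X := coordMap n (Ψ 0) s₀ x₀) ?_) key
    filter_upwards [hopen] with v hv
    exact (h.fderiv_familyMap hv).symm
  · filter_upwards [hfam, h.eventually_mem_coordDomain hu] with l h1 h2 N hN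
    exact h1.1.metric_frameTrace_eq_zero h1.2 h2 hN
  · intro δ
    filter_upwards [hopen] with v hv
    rw [h.fderiv_familyMap hv]
    exact (hψ.forall_metricForm_eq_zero_iff hv _).2 (h.normal _) δ

/-- The deviation field is continuous up to the boundary. -/
lemma IsNormalDeviation.continuous (h : IsNormalDeviation n W ψ Ψ η) :
    Continuous (fun y => (⟨ψ y, η y⟩ : TangentBundle (𝓡∂ d) M)) := by
  have : IsManifold (𝓡∂ d) 1 M := .of_le (n := ∞) (by simp)
  have : IsManifold (𝓡∂ n) 1 S := .of_le (n := ∞) (by simp)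
  have h0 : (fun y => (⟨ψ y, η y⟩ : TangentBundle (𝓡∂ d) M)) = fun y =>
      ⟨Ψ 0 y, mfderiv 𝓘(ℝ, ℝ) (𝓡∂ d) (fun l => Ψ l y) 0 (1 : ℝ)⟩ :=
    funext fun y => (h.deviation y).symm
  rw [h0, continuous_iff_continuousAt]
  intro y₀
  obtain ⟨ε, hε, h1, -, -⟩ := h.family
  have h2 : ContMDiffAt (𝓘(ℝ, ℝ).prod (𝓡∂ n)) (𝓡∂ d) 1 (fun p : ℝ × S => Ψ p.1 p.2) (0, y₀) :=
    h1.contMDiffAt ((isOpen_Ioo.prod isOpen_univ).mem_nhds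
      ⟨⟨neg_lt_zero.2 hε, hε⟩, mem_univ _⟩)
  have h3 : ContMDiffAt ((𝓡∂ n).prod 𝓘(ℝ, ℝ)) (𝓡∂ d) 1
      (Function.uncurry fun (y : S) (l : ℝ) => Ψ l y) (y₀, 0) :=
    ContMDiffAt.comp (y₀, (0 : ℝ)) (g := fun p : ℝ × S => Ψ p.1 p.2)
      (f := fun p : S × ℝ => (p.2, p.1)) h2 (contMDiffAt_snd.prodMk contMDiffAt_fst)
  have h4 := ContMDiffAt.mfderiv (m := 0) (fun (y : S) (l : ℝ) => Ψ l y) (fun _ => 0) h3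
    contMDiffAt_const (by simp)
  have h5 := h4.continuousAt
  rw [FiberBundle.continuousAt_totalSpace]
  have hb : ContinuousAt (fun y => Ψ 0 y) y₀ :=
    ContinuousAt.comp (f := fun y => ((0 : ℝ), y)) h2.continuousAt (by fun_prop)
  refine ⟨hb, ?_⟩
  have h6 := h5.clm_apply (continuousAt_const (y := (1 : ℝ)))
  refine h6.congr ?_
  have hsrc : (chartAt (EuclideanHalfSpace d) (Ψ 0 y₀)).source ∈ 𝓝 (Ψ 0 y₀) :=
    (chartAt (EuclideanHalfSpace d) (Ψ 0 y₀)).open_source.mem_nhds (mem_chart_source _ _)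
  filter_upwards [hb.preimage_mem_nhds hsrc] with y hy
  simp only [inTangentCoordinates, ContinuousLinearMap.inCoordinates,
    TangentBundle.symmL_model_space]
  change Trivialization.continuousLinearMapAt ℝ (trivializationAt (EuclideanSpace ℝ (Fin d))
    (TangentSpace (𝓡∂ d)) (Ψ 0 y₀)) (Ψ 0 y) (mfderiv 𝓘(ℝ, ℝ) (𝓡∂ d) (fun l => Ψ l y) 0 (1 : ℝ)) = _
  rw [Trivialization.continuousLinearMapAt_apply, Trivialization.linearMapAt_apply,
    if_pos (by rw [TangentBundle.trivializationAt_baseSet]; exact hy)]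

end Deviation

/-! ### The normal plane and the wedge -/

section Wedge

/-- A vector of the closed quadrant around `ν` in the Lorentzian normal plane pairs nonnegatively
with the null edge `κ`, and positively if it does not lie along that edge. -/
lemma IsAdaptedFrame.pairing_pos {E : Type*} [NormedAddCommGroup E] [NormedSpace ℝ E]
    [FiniteDimensional ℝ E] {n : ℕ} {B : E →L[ℝ] E →L[ℝ] ℝ} {e : Fin n → E} {κ ν : E}
    (hf : IsAdaptedFrame B e κ ν) (hdim : Module.finrank ℝ E = n + 2) (hκν : 0 < B κ ν)
    (hνν : 0 < B ν ν) {η : E} (hη : ∀ α, B η (e α) = 0) (h0 : 0 ≤ B η η) (h1 : 0 < B η ν) :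
    0 ≤ B η κ ∧ ((¬ ∃ c : ℝ, η = c • κ) → 0 < B η κ) := by
  have h := hf.normal_eq hdim hη
  generalize (B η ν - B η κ / B ν κ * B ν ν) / B ν κ = a at h
  generalize B η κ / B ν κ = b at h
  have h2 : B η κ = b * B κ ν := by rw [h]; simp [hf.null, hf.symm ν κ]
  have h3 : B η ν = a * B κ ν + b * B ν ν := by rw [h]; simp
  have h4 : B η η = b * (2 * a * B κ ν + b * B ν ν) := by
    rw [h]; simp [hf.null, hf.symm ν κ]; ring
  -- if `b < 0`, then `0 ≤ B η η` and `0 < B η ν` force opposite signs of `a`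
  have hb : 0 ≤ b := by
    by_contra hb
    rw [not_le] at hb
    rw [h4] at h0
    rw [h3] at h1
    have h5 : 2 * a * B κ ν + b * B ν ν ≤ 0 := by
      by_contra h5
      exact absurd h0 (not_le.2 (mul_neg_of_neg_of_pos hb (not_le.1 h5)))
    have h6 : b * B ν ν < 0 := mul_neg_of_neg_of_pos hb hνν
    linarith
  refine ⟨by rw [h2]; positivity, fun hne => ?_⟩
  have hb' : b ≠ 0 := fun hb' => hne ⟨a, by rw [h, hb', zero_smul, add_zero]⟩
  rw [h2]
  have := lt_of_le_of_ne hb hb'.symm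
  positivity

set_option linter.unusedSectionVars false

variable {n : ℕ} [NeZero n] {M : Type*} [TopologicalSpace M]
  [ChartedSpace (EuclideanHalfSpace (n + 2)) M] [IsManifold (𝓡∂ (n + 2)) ∞ M]
  {W : ConformalSpacetime (n + 2) M}
  {S : Type*} [TopologicalSpace S] [ChartedSpace (EuclideanHalfSpace n) S]
  {ψ : S → M} {ν κ : ∀ y : S, TangentSpace (𝓡∂ (n + 2)) (ψ y)}

/-- The metric at a point of the surface as a form on the model space. -/
def metricAt (W : ConformalSpacetime (n + 2) M) (x : M) : EuclideanSpace ℝ (Fin (n + 2)) →L[ℝ]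
    EuclideanSpace ℝ (Fin (n + 2)) →L[ℝ] ℝ := W.metric x

lemma IsAnchoredSurface.isAdaptedFrame (hψ : IsAnchoredSurface n W ψ) {y : S}
    {k ξ : TangentSpace (𝓡∂ (n + 2)) (ψ y)} (hk : IsNormal n W ψ y k) (hξ : IsNormal n W ψ y ξ)
    (hnull : W.metric (ψ y) k k = 0) (hp : W.metric (ψ y) ξ k ≠ 0) :
    IsAdaptedFrame (metricAt W (ψ y))
      (fun α => mfderiv (𝓡∂ n) (𝓡∂ (n + 2)) ψ y (EuclideanSpace.single α (1 : ℝ))) k ξ where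
  symm := W.symm _
  det_ne_zero := by
    intro h
    obtain ⟨c, hc0, hc⟩ := Matrix.exists_mulVec_eq_zero_iff.2 h
    set v : TangentSpace (𝓡∂ n) y := WithLp.toLp 2 c with hv
    have hv0 : v ≠ 0 := fun h => hc0 (congrArg WithLp.ofLp h)
    have hve : v = ∑ α, c α • (EuclideanSpace.single α (1 : ℝ) : EuclideanSpace ℝ (Fin n)) :=
      euclidean_eq_sum (WithLp.toLp 2 c)
    refine (hψ.spacelike y v hv0).ne' ?_
    have h1 : mfderiv (𝓡∂ n) (𝓡∂ (n + 2)) ψ y v = ∑ α, c α • (mfderiv (𝓡∂ n) (𝓡∂ (n + 2)) ψ y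
        (EuclideanSpace.single α (1 : ℝ))) := by
      rw [hve]
      exact (map_sum _ _ _).trans (Finset.sum_congr rfl fun α _ => map_smul _ _ _)
    have h2 : ∀ t, W.metric (ψ y) t (mfderiv (𝓡∂ n) (𝓡∂ (n + 2)) ψ y v)
        = ∑ α, W.metric (ψ y) t (mfderiv (𝓡∂ n) (𝓡∂ (n + 2)) ψ y (EuclideanSpace.single α (1 : ℝ)))
          * c α := fun t => by
      rw [h1]
      simp only [map_sum, map_smul, smul_eq_mul]
      exact Finset.sum_congr rfl fun β _ => mul_comm _ _
    have h3 : ∀ α, W.metric (ψ y) (mfderiv (𝓡∂ n) (𝓡∂ (n + 2)) ψ y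
        (EuclideanSpace.single α (1 : ℝ))) (mfderiv (𝓡∂ n) (𝓡∂ (n + 2)) ψ y v) = 0 :=
      fun α => (h2 _).trans (congrFun hc α)
    rw [h2]
    exact Finset.sum_eq_zero fun α _ => by rw [W.symm, h3, zero_mul]
  normal_left _ := (W.symm _ _ _).trans (hk _)
  normal_right _ := (W.symm _ _ _).trans (hξ _)
  null := hnull
  pairing_ne_zero := hp

lemma IsWedgeNullNormal.pairing_pos (hκ : IsWedgeNullNormal n W ψ ν κ)
    (hψ : IsAnchoredSurface n W ψ) (hν : IsWedgeSide n W ψ ν) {y : S}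
    {a : TangentSpace (𝓡∂ (n + 2)) (ψ y)} (ha : PointsIntoWedge n W ψ ν y a) :
    0 ≤ W.metric (ψ y) a (κ y) ∧ ((¬ ∃ c : ℝ, a = c • κ y) → 0 < W.metric (ψ y) a (κ y)) := by
  have h1 := (hκ.inward y).2.2
  exact (hψ.isAdaptedFrame (hκ.inward y).1 (hν.normal y) (hκ.null y)
    (by rw [W.symm]; exact h1.ne')).pairing_pos finrank_euclideanSpace_fin h1 (hν.spacelike y)
    (fun _ => (W.symm _ _ _).trans (ha.1 _)) ha.2.1 ha.2.2

lemma IsAnchoredSurface.normal_eq (hψ : IsAnchoredSurface n W ψ) {y : S}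
    {k ξ a : TangentSpace (𝓡∂ (n + 2)) (ψ y)} (hk : IsNormal n W ψ y k) (hξ : IsNormal n W ψ y ξ)
    (hnull : W.metric (ψ y) k k = 0) (hp : W.metric (ψ y) ξ k ≠ 0) (ha : IsNormal n W ψ y a) :
    a = ((W.metric (ψ y) a ξ - W.metric (ψ y) a k / W.metric (ψ y) ξ k * W.metric (ψ y) ξ ξ)
      / W.metric (ψ y) ξ k) • k + (W.metric (ψ y) a k / W.metric (ψ y) ξ k) • ξ :=
  (hψ.isAdaptedFrame hk hξ hnull hp).normal_eq finrank_euclideanSpace_fin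
    fun _ => (W.symm _ _ _).trans (ha _)

end Wedge

/-! ### The elliptic equation on the surface -/

section Elliptic

set_option linter.unusedSectionVars false

variable {n : ℕ} [NeZero n] {M : Type*} [TopologicalSpace M]
  [ChartedSpace (EuclideanHalfSpace (n + 2)) M] [IsManifold (𝓡∂ (n + 2)) ∞ M]
  {W : ConformalSpacetime (n + 2) M}
  {S : Type*} [TopologicalSpace S] [ChartedSpace (EuclideanHalfSpace n) S] [IsManifold (𝓡∂ n) ∞ S]
  {ψ : S → M} {s₀ : S} {x₀ : M} {u : EuclideanSpace ℝ (Fin n)}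

lemma IsAnchoredSurface.contMDiffAt_comp_symm (hψ : IsAnchoredSurface n W ψ)
    (hu : u ∈ coordDomain (n + 2) n ψ s₀ x₀) :
    ContMDiffAt 𝓘(ℝ, EuclideanSpace ℝ (Fin n)) (𝓡∂ (n + 2)) ∞
      (fun u => ψ ((extChartAt (𝓡∂ n) s₀).symm u)) u :=
  (hψ.contMDiffAt (extChartAt_symm_mem_interior hu.1)).comp u (contMDiffAt_extChartAt_symm hu.1)

lemma IsAnchoredSurface.contDiffAt_metric (hψ : IsAnchoredSurface n W ψ)
    (hu : u ∈ coordDomain (n + 2) n ψ s₀ x₀) {ξ ζ : ∀ y : S, TangentSpace (𝓡∂ (n + 2)) (ψ y)}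
    (hξ : ContDiffAt ℝ ∞ (fun u => vecComp x₀ (ξ ((extChartAt (𝓡∂ n) s₀).symm u))) u)
    (hζ : ContDiffAt ℝ ∞ (fun u => vecComp x₀ (ζ ((extChartAt (𝓡∂ n) s₀).symm u))) u) :
    ContDiffAt ℝ ∞ (fun u => W.metric (ψ ((extChartAt (𝓡∂ n) s₀).symm u))
      (ξ ((extChartAt (𝓡∂ n) s₀).symm u)) (ζ ((extChartAt (𝓡∂ n) s₀).symm u))) u :=
  (contMDiffAt_metric_apply W (b := fun u => ψ ((extChartAt (𝓡∂ n) s₀).symm u))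
    (v := fun u => ξ ((extChartAt (𝓡∂ n) s₀).symm u))
    (w := fun u => ζ ((extChartAt (𝓡∂ n) s₀).symm u))
    (hψ.interior _ (extChartAt_symm_mem_interior hu.1))
    ((contMDiffAt_tangentBundle_iff (x₀ := x₀) hu.2).2 ⟨hψ.contMDiffAt_comp_symm hu,
      hξ.contMDiffAt⟩)
    ((contMDiffAt_tangentBundle_iff (x₀ := x₀) hu.2).2 ⟨hψ.contMDiffAt_comp_symm hu,
      hζ.contMDiffAt⟩)).contDiffAt

lemma IsWedgeNullNormal.contDiffAt_vecComp {ν κ : ∀ y : S, TangentSpace (𝓡∂ (n + 2)) (ψ y)}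
    (hκ : IsWedgeNullNormal n W ψ ν κ) (hu : u ∈ coordDomain (n + 2) n ψ s₀ x₀) :
    ContDiffAt ℝ ∞ (fun u => vecComp x₀ (κ ((extChartAt (𝓡∂ n) s₀).symm u))) u := by
  have h1 := (hκ.smooth.contMDiffAt ((ModelWithCorners.isOpen_interior (n := ∞)
    (by simp)).mem_nhds (extChartAt_symm_mem_interior hu.1))).comp u
    (contMDiffAt_extChartAt_symm hu.1)
  exact ((contMDiffAt_tangentBundle_iff (x₀ := x₀) hu.2).1 h1).2.contDiffAt

/-- In coordinates around an interior point of the surface, the coefficient `V` of `η₁` in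
`η₂ = a κ + V η₁` solves an elliptic equation whose inhomogeneity is `a` times the focusing term of
`κ`, and which has no zeroth-order term. -/
theorem exists_elliptic_equation (hψ : IsAnchoredSurface n W ψ)
    {ν κ η₁ η₂ : ∀ y : S, TangentSpace (𝓡∂ (n + 2)) (ψ y)} (hκ : IsWedgeNullNormal n W ψ ν κ)
    {Ψ₁ Ψ₂ : ℝ → S → M} (hη₁ : IsNormalDeviation n W ψ Ψ₁ η₁)
    (hη₂ : IsNormalDeviation n W ψ Ψ₂ η₂) (hp : ∀ y, 0 < W.metric (ψ y) (η₁ y) (κ y))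
    {a V : S → ℝ} (hV : ∀ y, V y = W.metric (ψ y) (η₂ y) (κ y) / W.metric (ψ y) (η₁ y) (κ y))
    (ha : ∀ y, a y = (W.metric (ψ y) (η₂ y) (η₁ y) - V y * W.metric (ψ y) (η₁ y) (η₁ y))
      / W.metric (ψ y) (η₁ y) (κ y)) (s₀ : S) (x₀ : M) :
    ∃ (A : EuclideanSpace ℝ (Fin n) → Matrix (Fin n) (Fin n) ℝ)
      (b : EuclideanSpace ℝ (Fin n) → Fin n → ℝ), ∀ u ∈ coordDomain (n + 2) n ψ s₀ x₀,
      (A u).PosDef ∧ (∀ i j, ContinuousAt (fun u => A u i j) u) ∧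
      (∀ i, ContinuousAt (fun u => b u i) u) ∧
      ContDiffAt ℝ ∞ (fun u => V ((extChartAt (𝓡∂ n) s₀).symm u)) u ∧
      a ((extChartAt (𝓡∂ n) s₀).symm u) * Qkk n W ψ ((extChartAt (𝓡∂ n) s₀).symm u)
        (κ ((extChartAt (𝓡∂ n) s₀).symm u))
      + secondOrderOp (A u) (b u) (fun u => V ((extChartAt (𝓡∂ n) s₀).symm u)) u = 0 := by
  set σ := (extChartAt (𝓡∂ n) s₀).symm with hσ
  set g := metricForm (W.metricComp x₀) with hg
  set Γ := christoffelForm (W.metricComp x₀) with hΓ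
  set X := coordMap (d := n + 2) n ψ s₀ x₀ with hX
  set ε : Fin n → EuclideanSpace ℝ (Fin n) := fun α => EuclideanSpace.single α 1 with hε
  set k : EuclideanSpace ℝ (Fin n) → EuclideanSpace ℝ (Fin (n + 2)) :=
    fun u => vecComp x₀ (κ (σ u)) with hk
  set ξ : EuclideanSpace ℝ (Fin n) → EuclideanSpace ℝ (Fin (n + 2)) :=
    fun u => vecComp x₀ (η₁ (σ u)) with hξ
  have hψc := hψ.c1.continuous
  -- the coefficients of `focusing_eq_of_jacobi`
  refine ⟨fun u => g (X u) (k u) (ξ u) • (firstForm g X ε u)⁻¹,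
    fun u δ => 2 * (∑ α, (firstForm g X ε u)⁻¹ δ α * g (X u) (k u) (cov Γ X (ε α) ξ u))
      - tangentCoef g Γ X ε δ u * g (X u) (k u) (ξ u), fun u hu => ?_⟩
  have hopen := (isOpen_coordDomain hψc s₀ x₀).mem_nhds hu
  have hx := hψ.coordMap_mem hu
  have hΩ := W.Ω_pos _ (hψ.interior _ (extChartAt_symm_mem_interior hu.1))
  have hgs : ContDiffAt ℝ ∞ g (X u) := contDiffAt_metricForm (contDiffAt_metricComp W hx)
  have hΓs : ContDiffAt ℝ ∞ Γ (X u) :=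
    contDiffAt_christoffelForm (contDiffAt_metricComp W hx) (det_metricComp_ne_zero W hx)
  have hXs : ContDiffAt ℝ ∞ X u := hψ.contDiffAt_coordMap hu
  have hks : ContDiffAt ℝ ∞ k u := hκ.contDiffAt_vecComp hu
  have hξs : ContDiffAt ℝ ∞ ξ u := hη₁.contDiffAt_vecComp hψc hu
  have hη₂s : ContDiffAt ℝ ∞ (fun u => vecComp x₀ (η₂ (σ u))) u := hη₂.contDiffAt_vecComp hψc hu
  have hpd := hψ.posDef_firstForm hu
  have hLC := eventually_isLeviCivitaAt W hx
  have hVs : ContDiffAt ℝ ∞ (fun u => V (σ u)) u := by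
    simp only [hV]
    exact (hψ.contDiffAt_metric hu hη₂s hks).div (hψ.contDiffAt_metric hu hξs hks) (hp _).ne'
  have has : ContDiffAt ℝ ∞ (fun u => a (σ u)) u := by
    simp only [ha]
    exact ((hψ.contDiffAt_metric hu hη₂s hξs).sub (hVs.mul (hψ.contDiffAt_metric hu hξs hξs))).div
      (hψ.contDiffAt_metric hu hξs hks) (hp _).ne'
  have hgp : ∀ a b : TangentSpace (𝓡∂ (n + 2)) (ψ (σ u)),
      g (X u) (vecComp x₀ a) (vecComp x₀ b) = (W.Ω (ψ (σ u)) ^ 2)⁻¹ * W.metric (ψ (σ u)) a b :=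
    fun a b => metricForm_vecComp W hu.2 a b
  have hpk : 0 < g (X u) (k u) (ξ u) := by
    have := hp (σ u)
    rw [hk, hξ]
    simp only
    rw [hgp, W.symm]
    positivity
  have hkn : ∀ᶠ v in 𝓝 u, ∀ α, g (X v) (k v) (fderiv ℝ X v (ε α)) = 0 := by
    filter_upwards [hopen] with v hv
    exact (hψ.forall_metricForm_eq_zero_iff hv _).2 (hκ.inward _).1
  have hnull : ∀ᶠ v in 𝓝 u, g (X v) (k v) (k v) = 0 := by
    filter_upwards [hopen] with v hv
    refine (metricForm_vecComp W hv.2 _ _).trans ?_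
    rw [physMetric_apply, hκ.null, mul_zero]
  have hframe : IsAdaptedFrame (g (X u)) (fun α => fderiv ℝ X u (ε α)) (k u) (ξ u) :=
    { symm := hLC.self_of_nhds.metric_symm
      det_ne_zero := hpd.det_pos.ne'
      normal_left := hkn.self_of_nhds
      normal_right := (hψ.forall_metricForm_eq_zero_iff hu _).2 (hη₁.normal _)
      null := hnull.self_of_nhds
      pairing_ne_zero := by rw [hLC.self_of_nhds.metric_symm]; exact hpk.ne' }
  have hgc := fun (v w : EuclideanSpace ℝ (Fin n) → EuclideanSpace ℝ (Fin (n + 2)))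
    (hv : ContDiffAt ℝ ∞ v u) (hw : ContDiffAt ℝ ∞ w u) => contDiffAt_metric hgs hXs hv hw
  have hinv := fun α β => contDiffAt_firstForm_inv (ε := ε) hgs hXs hpd.det_pos.ne' α β
  refine ⟨hpd.inv.smul hpk, fun i j => ((hgc _ _ hks hξs).mul (hinv i j)).continuousAt,
    fun δ => ((contDiffAt_const.mul (ContDiffAt.sum fun α _ => (hinv δ α).mul
      (hgc _ _ hks (contDiffAt_cov hΓs hXs hξs _)))).sub
      ((contDiffAt_tangentCoef hgs hΓs hXs hpd.det_pos.ne' δ).mul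
        (hgc _ _ hks hξs))).continuousAt, hVs, ?_⟩
  have hrel : ∀ᶠ v in 𝓝 u, vecComp x₀ (η₂ (σ v)) = a (σ v) • k v + V (σ v) • ξ v := by
    refine Filter.Eventually.of_forall fun v => ?_
    have h := hψ.normal_eq (hκ.inward (σ v)).1 (hη₁.normal (σ v)) (hκ.null _) (hp _).ne'
      (hη₂.normal (σ v))
    rw [← hV, ← ha] at h
    rw [h, vecComp_add, vecComp_smul, vecComp_smul]
  have key := focusing_eq_of_jacobi (finrank_euclideanSpace_fin) hgs hΓs hXs hLC hks hξs hframe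
    hnull (fun α => hkn.mono fun v hv => hv α)
    (hη₁.jacobi_eq_zero hψ hu hkn.self_of_nhds) (hη₂.jacobi_eq_zero hψ hu hkn.self_of_nhds)
    has hVs hrel
  rw [hψ.Qkk_eq_focusing hu (hκ.inward _).1]
  rw [← key, secondOrderOp]
  congr 2
  exact Finset.sum_congr rfl fun α _ => Finset.sum_congr rfl fun β _ => by
    simp only [Matrix.smul_apply, smul_eq_mul, pd]; ring

end Elliptic

/-! ### The maximum principle on the surface -/

section MaximumPrinciple

lemma secondOrderOp_eq_zero_of_eventually_eq {n : ℕ} {a : Matrix (Fin n) (Fin n) ℝ}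
    {b : Fin n → ℝ} {f : EuclideanSpace ℝ (Fin n) → ℝ} {x : EuclideanSpace ℝ (Fin n)} {c : ℝ}
    (h : ∀ᶠ y in 𝓝 x, f y = c) : secondOrderOp a b f x = 0 := by
  have h1 : ∀ j, ∀ᶠ y in 𝓝 x, pd f j y = 0 := fun j => by
    filter_upwards [h.eventually_nhds] with y hy
    rw [pd, Filter.EventuallyEq.fderiv_eq (f₁ := f) (f := fun _ => c) hy]
    simp
  have h2 : ∀ i j, pd (fun z => pd f j z) i x = 0 := fun i j => by
    rw [pd, Filter.EventuallyEq.fderiv_eq (f₁ := fun z => pd f j z) (f := fun _ => 0) (h1 j)]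
    simp
  simp [secondOrderOp, h2, (h1 _).self_of_nhds]

/-- A nonnegative continuous function on a compact, locally connected space that vanishes on a set
`B`, and is constant near every local maximum point outside `B`, is locally constant. -/
lemma eventually_eq_of_forall_isLocalMax {S : Type*} [TopologicalSpace S] [CompactSpace S]
    [LocallyConnectedSpace S] {V : S → ℝ} (hV : Continuous V) (h0 : ∀ y, 0 ≤ V y) {B : Set S}
    (hB : ∀ y ∈ B, V y = 0)
    (hmax : ∀ y ∉ B, (∀ᶠ z in 𝓝 y, V z ≤ V y) → ∀ᶠ z in 𝓝 y, V z = V y) (y₀ : S) :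
    ∀ᶠ y in 𝓝 y₀, V y = V y₀ := by
  have hCo : IsOpen (connectedComponent y₀) := isOpen_connectedComponent
  have hCc : IsClosed (connectedComponent y₀) := isClosed_connectedComponent
  obtain ⟨y₁, hy₁, hm⟩ := hCc.isCompact.exists_isMaxOn ⟨y₀, mem_connectedComponent⟩
    hV.continuousOn
  have hC : ∀ y ∈ connectedComponent y₀, V y = V y₁ := by
    -- if the maximum is positive, it is attained outside `B` only, and the set of maxima is clopen
    rcases (h0 y₁).eq_or_lt with h | h
    · exact fun y hy => le_antisymm (hm hy) (by rw [← h]; exact h0 y)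
    · have hclopen : IsClopen (connectedComponent y₀ ∩ {y | V y = V y₁}) := by
        refine ⟨hCc.inter (isClosed_eq hV continuous_const), ?_⟩
        rw [isOpen_iff_mem_nhds]
        rintro y ⟨hy, hyV⟩
        have hyB : y ∉ B := fun hyB => h.ne' (by rw [← hyV.out, hB y hyB])
        have h1 := hmax y hyB (by
          filter_upwards [hCo.mem_nhds hy] with z hz
          rw [hyV.out]
          exact hm hz)
        filter_upwards [hCo.mem_nhds hy, h1] with z hz hz'
        exact ⟨hz, hz'.trans hyV⟩
      exact fun y hy => (isPreconnected_connectedComponent.subset_isClopen hclopen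
        ⟨y₁, hy₁, hy₁, rfl⟩ hy).2
  filter_upwards [hCo.mem_nhds mem_connectedComponent] with y hy
  rw [hC y hy, hC y₀ mem_connectedComponent]

set_option linter.unusedSectionVars false

variable {n : ℕ} [NeZero n] {M : Type*} [TopologicalSpace M]
  [ChartedSpace (EuclideanHalfSpace (n + 2)) M] [IsManifold (𝓡∂ (n + 2)) ∞ M]
  {W : ConformalSpacetime (n + 2) M}
  {S : Type*} [TopologicalSpace S] [ChartedSpace (EuclideanHalfSpace n) S] [IsManifold (𝓡∂ n) ∞ S]
  {ψ : S → M} {ν κ η₁ η₂ : ∀ y : S, TangentSpace (𝓡∂ (n + 2)) (ψ y)} {Ψ₁ Ψ₂ : ℝ → S → M}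
  {a V : S → ℝ}

lemma extChartAt_mem_coordDomain_self {d : ℕ} [NeZero d] {M : Type*} [TopologicalSpace M]
    [ChartedSpace (EuclideanHalfSpace d) M] [IsManifold (𝓡∂ d) ∞ M] {ψ : S → M} {y : S}
    (hy : y ∈ (𝓡∂ n).interior S) : extChartAt (𝓡∂ n) y y ∈ coordDomain d n ψ y (ψ y) :=
  extChartAt_mem_coordDomain hy (mem_extChartAt_source y) (mem_extChartAt_source (ψ y))

lemma tendsto_extChartAt_symm {y : S} (hy : y ∈ (𝓡∂ n).interior S) :
    Filter.Tendsto (extChartAt (𝓡∂ n) y).symm (𝓝 (extChartAt (𝓡∂ n) y y)) (𝓝 y) := by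
  have h := (contMDiffAt_extChartAt_symm
    (extChartAt_mem_interior_target (mem_extChartAt_source (I := 𝓡∂ n) y) hy)).continuousAt
  rwa [ContinuousAt, extChartAt_to_inv] at h

/-- If `a Q ≤ 0`, the coefficient `V` is constant near its local maxima in the interior. -/
lemma eventually_eq_of_isLocalMax (hψ : IsAnchoredSurface n W ψ)
    (hκ : IsWedgeNullNormal n W ψ ν κ) (hη₁ : IsNormalDeviation n W ψ Ψ₁ η₁)
    (hη₂ : IsNormalDeviation n W ψ Ψ₂ η₂) (hp : ∀ y, 0 < W.metric (ψ y) (η₁ y) (κ y))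
    (hV : ∀ y, V y = W.metric (ψ y) (η₂ y) (κ y) / W.metric (ψ y) (η₁ y) (κ y))
    (ha : ∀ y, a y = (W.metric (ψ y) (η₂ y) (η₁ y) - V y * W.metric (ψ y) (η₁ y) (η₁ y))
      / W.metric (ψ y) (η₁ y) (κ y))
    (hQ : ∀ y ∈ (𝓡∂ n).interior S, a y * Qkk n W ψ y (κ y) ≤ 0) {y : S}
    (hy : y ∈ (𝓡∂ n).interior S) (hmax : ∀ᶠ z in 𝓝 y, V z ≤ V y) : ∀ᶠ z in 𝓝 y, V z = V y := by
  obtain ⟨A, b, h⟩ := exists_elliptic_equation hψ hκ hη₁ hη₂ hp hV ha y (ψ y)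
  have hu := extChartAt_mem_coordDomain_self (d := n + 2) (ψ := ψ) hy
  obtain ⟨U, hUs, hUo, hUu⟩ := mem_nhds_iff.1 (Filter.inter_mem
    ((isOpen_coordDomain hψ.c1.continuous y (ψ y)).mem_nhds hu)
    ((tendsto_extChartAt_symm hy).eventually hmax))
  have h1 := eventually_eq_of_isMax_of_subsolution (v := fun u => V ((extChartAt (𝓡∂ n) y).symm u))
    hUo (fun u hu => (h u (hUs hu).1).1)
    (fun i j u hu => ((h u (hUs hu).1).2.1 i j).continuousWithinAt)
    (fun i u hu => ((h u (hUs hu).1).2.2.1 i).continuousWithinAt)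
    (fun u hu => (h u (hUs hu).1).2.2.2.1.of_le two_le_infty)
    (fun u hu => by
      have h2 := (h u (hUs hu).1).2.2.2.2
      have h3 := hQ _ (extChartAt_symm_mem_interior (hUs hu).1.1)
      linarith) hUu
    (fun u hu => by rw [extChartAt_to_inv]; exact (hUs hu).2)
  filter_upwards [(continuousAt_extChartAt (I := 𝓡∂ n) y).eventually h1,
    extChartAt_source_mem_nhds (I := 𝓡∂ n) y] with z hz hz'
  rwa [(extChartAt (𝓡∂ n) y).left_inv hz', extChartAt_to_inv] at hz

/-- Where `V` is locally constant, the elliptic equation reduces to `a Q = 0`. -/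
lemma mul_Qkk_eq_zero_of_eventually_eq (hψ : IsAnchoredSurface n W ψ)
    (hκ : IsWedgeNullNormal n W ψ ν κ) (hη₁ : IsNormalDeviation n W ψ Ψ₁ η₁)
    (hη₂ : IsNormalDeviation n W ψ Ψ₂ η₂) (hp : ∀ y, 0 < W.metric (ψ y) (η₁ y) (κ y))
    (hV : ∀ y, V y = W.metric (ψ y) (η₂ y) (κ y) / W.metric (ψ y) (η₁ y) (κ y))
    (ha : ∀ y, a y = (W.metric (ψ y) (η₂ y) (η₁ y) - V y * W.metric (ψ y) (η₁ y) (η₁ y))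
      / W.metric (ψ y) (η₁ y) (κ y)) {y : S}
    (hy : y ∈ (𝓡∂ n).interior S) (hconst : ∀ᶠ z in 𝓝 y, V z = V y) :
    a y * Qkk n W ψ y (κ y) = 0 := by
  obtain ⟨A, b, h⟩ := exists_elliptic_equation hψ hκ hη₁ hη₂ hp hV ha y (ψ y)
  have h1 := (h _ (extChartAt_mem_coordDomain_self hy)).2.2.2.2
  rw [secondOrderOp_eq_zero_of_eventually_eq ((tendsto_extChartAt_symm hy).eventually hconst),
    extChartAt_to_inv, add_zero] at h1
  exact h1

lemma Qkk_smul (y : S) (c : ℝ) (k : TangentSpace (𝓡∂ (n + 2)) (ψ y)) :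
    Qkk n W ψ y (c • k) = c ^ 2 * Qkk n W ψ y k := by
  have h : ∀ (G : EuclideanSpace ℝ (Fin (n + 2)) → Matrix (Fin (n + 2)) (Fin (n + 2)) ℝ)
      (X : EuclideanSpace ℝ (Fin n) → EuclideanSpace ℝ (Fin (n + 2))) (u : EuclideanSpace ℝ (Fin n))
      (N : EuclideanSpace ℝ (Fin (n + 2))) (α β : Fin n),
      extrinsicCurvature G X u (c • N) α β = c * extrinsicCurvature G X u N α β := by
    intro G X u N α β
    simp only [extrinsicCurvature, mul_neg, Finset.mul_sum, PiLp.smul_apply, smul_eq_mul]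
    exact congrArg _ (Finset.sum_congr rfl fun i _ => Finset.sum_congr rfl fun j _ => by ring)
  simp only [Qkk, ConformalSpacetime.ricciKK, shearSq, vecComp_smul, h, mul_add, Finset.mul_sum,
    PiLp.smul_apply, smul_eq_mul]
  congr 1
  · exact Finset.sum_congr rfl fun i _ => Finset.sum_congr rfl fun j _ => by ring
  · exact Finset.sum_congr rfl fun i _ => Finset.sum_congr rfl fun j _ =>
      Finset.sum_congr rfl fun k _ => Finset.sum_congr rfl fun l _ => by ring

end MaximumPrinciple

end ExtremalSurface

end

open ExtremalSurface

theorem mainTheorem2 {n : ℕ} [NeZero n]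
    {M : Type*} [TopologicalSpace M] [T2Space M]
    [ChartedSpace (EuclideanHalfSpace (n + 2)) M] [IsManifold (𝓡∂ (n + 2)) ∞ M]
    {S : Type*} [TopologicalSpace S] [T2Space S] [CompactSpace S]
    [ChartedSpace (EuclideanHalfSpace n) S] [IsManifold (𝓡∂ n) ∞ S]
    (W : ExtremalSurface.ConformalSpacetime (n + 2) M) (ψ : S → M)
    (hψ : ExtremalSurface.IsAnchoredSurface n W ψ) (hψ_ext : ExtremalSurface.IsExtremal n W ψ)
    (ν : ∀ y : S, TangentSpace (𝓡∂ (n + 2)) (ψ y)) (hν : ExtremalSurface.IsWedgeSide n W ψ ν)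
    (hEWN : ExtremalSurface.ExtremalWedgeNesting n W ψ ν)
    -- `κ = Ω⁻¹ k` extends to the boundary without zeros
    (κ : ∀ y : S, TangentSpace (𝓡∂ (n + 2)) (ψ y))
    (hκ : ExtremalSurface.IsWedgeNullNormal n W ψ ν κ)
    (Ψ₁ Ψ₂ : ℝ → S → M) (η₁ η₂ : ∀ y : S, TangentSpace (𝓡∂ (n + 2)) (ψ y))
    (hη₁ : ExtremalSurface.IsNormalDeviation n W ψ Ψ₁ η₁)
    (hη₂ : ExtremalSurface.IsNormalDeviation n W ψ Ψ₂ η₂)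
    (hb₁ : ∀ y ∈ (𝓡∂ n).boundary S, ExtremalSurface.PointsIntoWedge n W ψ ν y (η₁ y))
    (hb₁' : ∀ y ∈ (𝓡∂ n).boundary S, ¬ ∃ c : ℝ, η₁ y = c • κ y)
    (hb₂ : ∀ y ∈ (𝓡∂ n).boundary S, ∃ c : ℝ, 0 < c ∧ η₂ y = c • κ y)
    (k : ∀ y : S, TangentSpace (𝓡∂ (n + 2)) (ψ y)) (hk : ∀ y : S, k y = W.Ω (ψ y) • κ y) :
    ∃ w v : (𝓡∂ n).interior S → ℝ,
      (∀ y : (𝓡∂ n).interior S, η₂ y = w y • k y + v y • η₁ y) ∧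
      (∀ w' v' : (𝓡∂ n).interior S → ℝ,
        (∀ y : (𝓡∂ n).interior S, η₂ y = w' y • k y + v' y • η₁ y) → w' = w ∧ v' = v) ∧
      ((∃ y, 0 < w y * ExtremalSurface.Qkk n W ψ y (k y)) ∨
        ∀ y, w y * ExtremalSurface.Qkk n W ψ y (k y) = 0) ∧
      ((∀ y, 0 < w y) →
        (∃ y : (𝓡∂ n).interior S, 0 < ExtremalSurface.Qkk n W ψ y (k y)) ∨
        ∀ y : (𝓡∂ n).interior S, ExtremalSurface.Qkk n W ψ y (k y) = 0) := by
  -- nesting for both families: the pairings of `η₁` and `η₂` with `κ` have a sign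
  have hwedge₁ := hEWN Ψ₁ η₁ hη₁ hb₁
  have hp : ∀ y, 0 < W.metric (ψ y) (η₁ y) (κ y) := fun y =>
    (hκ.pairing_pos hψ hν (hwedge₁.1 y)).2 (hwedge₁.2 κ hκ hb₁' y)
  have hwedge₂ := hEWN Ψ₂ η₂ hη₂ fun y hy => by
    obtain ⟨c, hc, h⟩ := hb₂ y hy
    obtain ⟨-, -, h2⟩ := hκ.inward y
    refine ⟨hη₂.normal y, ?_, ?_⟩
    · rw [h]
      simp [hκ.null]
    · rw [h]
      simpa using mul_pos hc h2
  -- the coefficients of `η₂ = a κ + V η₁`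
  obtain ⟨V, hV⟩ : ∃ V : S → ℝ, ∀ y, V y
      = W.metric (ψ y) (η₂ y) (κ y) / W.metric (ψ y) (η₁ y) (κ y) := ⟨_, fun _ => rfl⟩
  obtain ⟨a, ha⟩ : ∃ a : S → ℝ, ∀ y, a y = (W.metric (ψ y) (η₂ y) (η₁ y)
      - V y * W.metric (ψ y) (η₁ y) (η₁ y)) / W.metric (ψ y) (η₁ y) (κ y) := ⟨_, fun _ => rfl⟩
  have hV0 : ∀ y, 0 ≤ V y := fun y => by
    rw [hV]
    exact div_nonneg (hκ.pairing_pos hψ hν (hwedge₂.1 y)).1 (hp y).le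
  have hVb : ∀ y ∈ (𝓡∂ n).boundary S, V y = 0 := fun y hy => by
    obtain ⟨c, -, h⟩ := hb₂ y hy
    rw [hV, h]
    simp [hκ.null]
  have hVc : Continuous V := by
    rw [show V = fun y => W.metric (ψ y) (η₂ y) (κ y) / W.metric (ψ y) (η₁ y) (κ y) from
      funext hV]
    exact (continuous_metric_apply W (𝓡∂ n) hη₂.continuous hκ.continuous).div
      (continuous_metric_apply W (𝓡∂ n) hη₁.continuous hκ.continuous) fun y => (hp y).ne'
  have hdec : ∀ y, η₂ y = a y • κ y + V y • η₁ y := fun y => by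
    have h := hψ.normal_eq (hκ.inward y).1 (hη₁.normal y) (hκ.null y) (hp y).ne' (hη₂.normal y)
    rwa [← hV, ← ha] at h
  have hΩ : ∀ y : (𝓡∂ n).interior S, 0 < W.Ω (ψ y) := fun y => W.Ω_pos _ (hψ.interior _ y.2)
  have hQ : ∀ y : (𝓡∂ n).interior S, a y / W.Ω (ψ y) * Qkk n W ψ y (k y)
      = W.Ω (ψ y) * (a y * Qkk n W ψ y (κ y)) := fun y => by
    have := (hΩ y).ne'
    rw [hk, Qkk_smul]
    field_simp
  have hmain : (∃ y : (𝓡∂ n).interior S, 0 < a y / W.Ω (ψ y) * Qkk n W ψ y (k y)) ∨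
      ∀ y : (𝓡∂ n).interior S, a y / W.Ω (ψ y) * Qkk n W ψ y (k y) = 0 := by
    refine or_iff_not_imp_left.2 fun hneg y₀ => ?_
    have hle : ∀ y ∈ (𝓡∂ n).interior S, a y * Qkk n W ψ y (κ y) ≤ 0 := fun y hy => by
      by_contra h
      refine hneg ⟨⟨y, hy⟩, ?_⟩
      rw [hQ]
      exact mul_pos (hΩ ⟨y, hy⟩) (not_le.1 h)
    have : LocallyConnectedSpace S := ChartedSpace.locallyConnectedSpace (EuclideanHalfSpace n) S
    have hconst := eventually_eq_of_forall_isLocalMax hVc hV0 hVb (fun y hy hmax =>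
      eventually_eq_of_isLocalMax hψ hκ hη₁ hη₂ hp hV ha hle
        (by rwa [← ModelWithCorners.compl_interior, notMem_compl_iff] at hy) hmax) (y₀ : S)
    rw [hQ, mul_Qkk_eq_zero_of_eventually_eq hψ hκ hη₁ hη₂ hp hV ha y₀.2 hconst, mul_zero]
  refine ⟨fun y => a y / W.Ω (ψ y), fun y => V y, fun y => ?_, fun w' v' h => ?_, hmain,
    fun hw => ?_⟩
  · rw [hk, smul_smul, div_mul_cancel₀ _ (hΩ y).ne']
    exact hdec y
  · have hv : ∀ y, v' y = V y := fun y => by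
      have h1 : W.metric (ψ y) (η₂ y) (κ y) = v' y * W.metric (ψ y) (η₁ y) (κ y) := by
        rw [h y, hk]
        simp [hκ.null]
      rw [hV, h1, mul_div_cancel_right₀ _ (hp y).ne']
    refine ⟨funext fun y => ?_, funext hv⟩
    -- the coefficients of `κ` are compared by pairing with `ν`, as `0 < g(κ, ν)`
    have h1 := congrArg (fun t => W.metric (ψ y) t (ν y)) ((h y).symm.trans (hdec y))
    rw [hv, hk] at h1
    have h2 := (hκ.inward (y : S)).2.2
    simp only [map_add, map_smul, add_apply, smul_apply, smul_eq_mul, add_left_inj] at h1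
    rw [eq_div_iff (hΩ y).ne']
    exact mul_right_cancel₀ h2.ne' (by rw [← h1]; ring)
  · rcases hmain with ⟨y, hy⟩ | h
    · exact Or.inl ⟨y, (pos_iff_pos_of_mul_pos hy).1 (hw y)⟩
    · exact Or.inr fun y => (mul_eq_zero.1 (h y)).resolve_left (hw y).ne'
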